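/- Let $k\ge 1$ and $0<\gamma\le 1$. Write $E(m,C,\rho)=\{x\in\mathbb R^k:(x-m)'C^{-1}(x-m)\le\rho^2\}$ and let $S(k)$ be the space of symmetric real $k\times k$ matrices. For a probability measure $P$ on $\mathbb R^k$ and a measurable $\phi:\mathbb R^k\to[0,1]$ with $\int\phi\,dP\ge\gamma$ and $\int\|x\|^2\phi(x)\,P(dx)<\infty$, let $$T_P(\phi)=\frac{1}{\int\phi\,dP}\int x\,\phi(x)\,P(dx),\qquad C_P(\phi)=\frac{1}{\int\phi\,dP}\int (x-T_P(\phi))(x-T_P(\phi))'\phi(x)\,P(dx),$$ $$r_P(\phi)=\inf\{s>0:P(E(T_P(\phi),C_P(\phi),s))\ge\gamma\}.$$ The MCD functional at $P$ is uniquely defined with value $\theta_0=(\mu_0,\Gamma_0,\rho_0)$, $\Gamma_0$ symmetric positive definite, if $\det C_P(\phi)$ has a minimizer over all such $\phi$, and every minimizer satisfies $T_P(\phi)=\mu_0$, $C_P(\phi)=\Gamma_0^2$ and $r_P(\phi)=\rho_0$. For $\theta=(m,G,r)\in\mathbb R^k\times S(k)\times\mathbb R$ with $G$ positive definite, let $\Lambda(\theta)=(\Lambda_1(\theta),\Lambda_2(\theta),\Lambda_3(\theta))\in\mathbb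 R^k\times S(k)\times\mathbb R$, where $$\Lambda_1(\theta)=\int \mathbf 1_{\{\|G^{-1}(y-m)\|\le r\}}\,G^{-1}(y-m)\,P(dy),$$ $$\Lambda_2(\theta)=\int \mathbf 1_{\{\|G^{-1}(y-m)\|\le r\}}\left(G^{-1}(y-m)(y-m)'G^{-1}-I\right)P(dy),$$ $$\Lambda_3(\theta)=\int \left(\mathbf 1_{\{\|G^{-1}(y-m)\|\le r\}}-\gamma\right)P(dy).$$ **Proposition.** Let $P$ be a probability measure on $\mathbb R^k$ with an elliptically contoured density $$f(x)=\det(\Sigma)^{-1/2}\,h\big((x-\mu)'\Sigma^{-1}(x-\mu)\big),$$ where $\mu\in\mathbb R^k$, $\Sigma$ is symmetric positive definite and $h:[0,\infty)\to[0,\infty)$ is non-increasing. Let $r(\gamma)>0$ satisfy $$\frac{2\pi^{k/2}}{\Gamma(k/2)}\int_0^{r(\gamma)}h(s^2)s^{k-1}\,ds=\gamma,$$ and suppose that $h$ is continuous and strictly positive on a neighbourhood of $r(\gamma)^2$, and that $h$ is not constant on $(0,r(\gamma)^2)$. (The last condition holds, for instance, if $h$ is strictly decreasing.) Then the MCD functional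 at $P$ is uniquely defined, with value $\theta_0=(\mu_0,\Gamma_0,\rho_0)$, $\Gamma_0$ symmetric positive definite and $\rho_0>0$. Moreover, with $\sigma_0$ the surface measure on the sphere $\partial B_0=\{\omega\in\mathbb R^k:\|\omega\|=\rho_0\}$, $\nu(d\omega)=\det(\Gamma_0)f(\Gamma_0\omega+\mu_0)\,\sigma_0(d\omega)$ and $\nu_0=\nu(\partial B_0)$, the following hold. 1. $f$ is continuous and strictly positive on an open neighbourhood of the boundary of $E(\mu_0,\Gamma_0^2,\rho_0)$. 2. For all $i$ and all $\omega\in\partial B_0$, $f(\Gamma_0\omega_{(-i)}+\mu_0)=f(\Gamma_0\omega+\mu_0)$, where $\omega_{(-i)}$ is $\omega$ with the sign of its $i$-th coordinate changed. 3. $\int_{\partial B_0}\omega_i^2\,\nu(d\omega)\ne\gamma\rho_0$ for all $i$. 4. $\int_{\partial B_0}\omega_i^2\omega_j^2\,\nu(d\omega)\ne\gamma\rho_0$ for all $i\ne j$. 5. Let $M$ be the $k\times k$ matrix with entries $$M_{ij}=\int_{\partial B_0}\omega_i^2\omega_j^2\,\nu(d\omega)-\frac1{\nu_0}\int_{\partial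 B_0}\omega_i^2\,\nu(d\omega)\int_{\partial B_0}\omega_j^2\,\nu(d\omega)-2\gamma\rho_0\mathbf 1_{\{i=j\}}.$$ If $x\in\mathbb R^k$, $Mx=0$ and $x_1+\cdots+x_k=0$, then $x=0$. 6. The derivative $\Lambda'(\theta_0)$ exists and is non-singular as a linear map of $\mathbb R^k\times S(k)\times\mathbb R$ to itself. -/

import Mathlib

open MeasureTheory Set Filter Topology

noncomputable section

/-- `ℝᵏ` with its Euclidean norm. -/
abbrev Vec (k : ℕ) : Type := EuclideanSpace ℝ (Fin k)

/-- The space `S(k)` of symmetric real `k × k` matrices. -/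
def symMat (k : ℕ) : Submodule ℝ (Matrix (Fin k) (Fin k) ℝ) where
  carrier := {A | A.IsSymm}
  add_mem' := fun ha hb => Matrix.IsSymm.add ha hb
  zero_mem' := Matrix.isSymm_zero
  smul_mem' := fun c _ ha => Matrix.IsSymm.smul ha c

/-- The product `A x` of a matrix and a vector of `ℝᵏ`. -/
def matMul {k : ℕ} (A : Matrix (Fin k) (Fin k) ℝ) (x : Vec k) : Vec k :=
  WithLp.toLp 2 (A.mulVec x.ofLp)

/-- The squared Mahalanobis distance `(x - μ)' S⁻¹ (x - μ)`. -/
def mahalanobisSq {k : ℕ} (μ : Vec k) (S : Matrix (Fin k) (Fin k) ℝ) (x : Vec k) : ℝ :=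
  (x - μ).ofLp ⬝ᵥ S⁻¹.mulVec (x - μ).ofLp

/-- The ellipsoid `E(μ, S, ρ) = {x : (x - μ)' S⁻¹ (x - μ) ≤ ρ²}`. -/
def ellipsoid {k : ℕ} (μ : Vec k) (S : Matrix (Fin k) (Fin k) ℝ) (ρ : ℝ) : Set (Vec k) :=
  {x | mahalanobisSq μ S x ≤ ρ ^ 2}

/-- The elliptically contoured function `det(S)^(-1/2) h((x - μ)' S⁻¹ (x - μ))` with
generator `h`, of which only the values on `[0, ∞)` matter if `S` is positive definite. -/
def ellipticalDensity {k : ℕ} (μ : Vec k) (S : Matrix (Fin k) (Fin k) ℝ) (h : ℝ → ℝ)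
    (x : Vec k) : ℝ :=
  S.det ^ (-(1 / 2) : ℝ) * h (mahalanobisSq μ S x)

/-! ### The minimum covariance determinant (MCD) functional -/

/-- The trimming functions: measurable `φ : ℝᵏ → [0, 1]` with `∫ φ dP ≥ γ` and
`∫ ‖x‖² φ(x) P(dx) < ∞`. -/
structure IsTrimming {k : ℕ} (P : Measure (Vec k)) (γ : ℝ) (φ : Vec k → ℝ) : Prop where
  measurable : Measurable φ
  mem_Icc : ∀ x, φ x ∈ Icc (0 : ℝ) 1
  mass : γ ≤ ∫ x, φ x ∂P
  second_moment : Integrable (fun x => ‖x‖ ^ 2 * φ x) P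

/-- The trimmed mean `T_P(φ)`. -/
def trimmedMean {k : ℕ} (P : Measure (Vec k)) (φ : Vec k → ℝ) : Vec k :=
  (∫ x, φ x ∂P)⁻¹ • ∫ x, φ x • x ∂P

/-- The trimmed covariance matrix `C_P(φ)`, entry by entry. -/
def trimmedCov {k : ℕ} (P : Measure (Vec k)) (φ : Vec k → ℝ) : Matrix (Fin k) (Fin k) ℝ :=
  Matrix.of fun i j => (∫ x, φ x ∂P)⁻¹ *
    ∫ x, (x i - trimmedMean P φ i) * (x j - trimmedMean P φ j) * φ x ∂P

/-- The radius `r_P(φ) = inf {s > 0 : P(E(T_P(φ), C_P(φ), s)) ≥ γ}`. -/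
def trimmedRadius {k : ℕ} (P : Measure (Vec k)) (γ : ℝ) (φ : Vec k → ℝ) : ℝ :=
  sInf {s : ℝ | 0 < s ∧ γ ≤ P.real (ellipsoid (trimmedMean P φ) (trimmedCov P φ) s)}

/-- `φ` minimizes `det C_P` over all trimming functions. -/
def IsMCDMinimizer {k : ℕ} (P : Measure (Vec k)) (γ : ℝ) (φ : Vec k → ℝ) : Prop :=
  IsTrimming P γ φ ∧
    ∀ ψ, IsTrimming P γ ψ → (trimmedCov P φ).det ≤ (trimmedCov P ψ).det

/-- The MCD functional at `P` is uniquely defined and equal to `(μ₀, S₀)`, with radius `ρ₀`: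
a minimizer exists, and every minimizer has this mean, covariance and radius. -/
def IsUniqueMCD {k : ℕ} (P : Measure (Vec k)) (γ : ℝ) (μ₀ : Vec k)
    (S₀ : Matrix (Fin k) (Fin k) ℝ) (ρ₀ : ℝ) : Prop :=
  (∃ φ, IsMCDMinimizer P γ φ) ∧
    ∀ φ, IsMCDMinimizer P γ φ →
      trimmedMean P φ = μ₀ ∧ trimmedCov P φ = S₀ ∧ trimmedRadius P γ φ = ρ₀

/-! ### The map `Λ = (Λ₁, Λ₂, Λ₃)` -/

/-- The set `{y : ‖G⁻¹ (y - m)‖ ≤ r}`. -/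
def scatterBall {k : ℕ} (m : Vec k) (G : Matrix (Fin k) (Fin k) ℝ) (r : ℝ) : Set (Vec k) :=
  {y | ‖matMul G⁻¹ (y - m)‖ ≤ r}

/-- `Λ₁(m, G, r) = ∫ 1{‖G⁻¹(y-m)‖ ≤ r} G⁻¹(y-m) P(dy)`. -/
def Lam1 {k : ℕ} (P : Measure (Vec k)) (m : Vec k) (G : Matrix (Fin k) (Fin k) ℝ) (r : ℝ) :
    Vec k :=
  ∫ y, (scatterBall m G r).indicator (fun y => matMul G⁻¹ (y - m)) y ∂P

/-- `Λ₂(m, G, r) = ∫ 1{‖G⁻¹(y-m)‖ ≤ r} (G⁻¹(y-m)(y-m)'G⁻¹ - I) P(dy)`, entry by entry. -/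
def Lam2 {k : ℕ} (P : Measure (Vec k)) (m : Vec k) (G : Matrix (Fin k) (Fin k) ℝ) (r : ℝ) :
    Matrix (Fin k) (Fin k) ℝ :=
  Matrix.of fun i j => ∫ y, (scatterBall m G r).indicator
    (fun y => (G⁻¹ * Matrix.vecMulVec (y - m).ofLp (y - m).ofLp * G⁻¹ - 1) i j) y ∂P

/-- `Λ₃(m, G, r) = ∫ (1{‖G⁻¹(y-m)‖ ≤ r} - γ) P(dy)`. -/
def Lam3 {k : ℕ} (P : Measure (Vec k)) (γ : ℝ) (m : Vec k) (G : Matrix (Fin k) (Fin k) ℝ)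
    (r : ℝ) : ℝ :=
  ∫ y, ((scatterBall m G r).indicator (fun _ => (1 : ℝ)) y - γ) ∂P

/-- If `G` is symmetric, so is `Λ₂(m, G, r)`. -/
theorem Lam2_mem {k : ℕ} (P : Measure (Vec k)) (m : Vec k) (G : symMat k) (r : ℝ) :
    Lam2 P m G.1 r ∈ symMat k := by
  have hG : (G.1⁻¹).transpose = G.1⁻¹ := by
    rw [Matrix.transpose_nonsing_inv]; exact congrArg _ G.2
  change (Lam2 P m G.1 r).transpose = Lam2 P m G.1 r
  ext i j
  simp only [Lam2, Matrix.transpose_apply, Matrix.of_apply]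
  congr 1
  funext y
  congr 1
  funext z
  have h : (G.1⁻¹ * Matrix.vecMulVec (z - m).ofLp (z - m).ofLp * G.1⁻¹ - 1).transpose
      = G.1⁻¹ * Matrix.vecMulVec (z - m).ofLp (z - m).ofLp * G.1⁻¹ - 1 := by
    simp only [Matrix.transpose_sub, Matrix.transpose_mul, Matrix.transpose_vecMulVec, hG,
      Matrix.transpose_one, Matrix.mul_assoc]
  exact congrFun (congrFun h i) j

/-- `Λ` as a map of `ℝᵏ × S(k) × ℝ` to itself. At a non-invertible `G` its value is irrelevant:
the positive definite matrices form an open subset of `S(k)`. -/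
def Lam {k : ℕ} (P : Measure (Vec k)) (γ : ℝ) (θ : Vec k × symMat k × ℝ) :
    Vec k × symMat k × ℝ :=
  (Lam1 P θ.1 θ.2.1.1 θ.2.2, ⟨Lam2 P θ.1 θ.2.1.1 θ.2.2, Lam2_mem P θ.1 θ.2.1 θ.2.2⟩,
    Lam3 P γ θ.1 θ.2.1.1 θ.2.2)

/-! ### Conditions on the density at the boundary of the MCD ellipsoid -/

/-- `f` is continuous and strictly positive on an open neighbourhood of the boundary of
`E(μ₀, S₀, ρ₀)`. -/
def ContPosNearBoundary {k : ℕ} (f : Vec k → ℝ) (μ₀ : Vec k)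
    (S₀ : Matrix (Fin k) (Fin k) ℝ) (ρ₀ : ℝ) : Prop :=
  ∃ U : Set (Vec k), IsOpen U ∧ frontier (ellipsoid μ₀ S₀ ρ₀) ⊆ U ∧
    ContinuousOn f U ∧ ∀ x ∈ U, 0 < f x

/-- The vector `ω₍₋ᵢ₎`: the sign of the `i`-th coordinate is changed. -/
def flipCoord {k : ℕ} (i : Fin k) (ω : Vec k) : Vec k :=
  WithLp.toLp 2 (Function.update ω.ofLp i (-(ω i)))

/-- Half-space symmetry: `f(Γ₀ ω₍₋ᵢ₎ + μ₀) = f(Γ₀ ω + μ₀)` for all `i` and all `ω` with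
`‖ω‖ = ρ₀`. -/
def HalfSpaceSymmetric {k : ℕ} (f : Vec k → ℝ) (μ₀ : Vec k)
    (Γ₀ : Matrix (Fin k) (Fin k) ℝ) (ρ₀ : ℝ) : Prop :=
  ∀ i : Fin k, ∀ ω ∈ Metric.sphere (0 : Vec k) ρ₀,
    f (matMul Γ₀ (flipCoord i ω) + μ₀) = f (matMul Γ₀ ω + μ₀)

/-- The Lebesgue surface measure on the sphere of radius `ρ > 0` around the origin of `ℝᵏ`,
as a measure on `ℝᵏ`: the surface measure of the unit sphere, scaled. -/
def surfaceMeasure (k : ℕ) (ρ : ℝ) : Measure (Vec k) :=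
  ENNReal.ofReal (ρ ^ (k - 1)) •
    ((volume : Measure (Vec k)).toSphere).map
      (fun ω : Metric.sphere (0 : Vec k) 1 => ρ • (ω : Vec k))

/-- The measure `ν(dω) = det(Γ₀) f(Γ₀ ω + μ₀) σ₀(dω)` on the sphere of radius `ρ₀`. -/
def boundaryMeasure {k : ℕ} (f : Vec k → ℝ) (μ₀ : Vec k)
    (Γ₀ : Matrix (Fin k) (Fin k) ℝ) (ρ₀ : ℝ) : Measure (Vec k) :=
  (surfaceMeasure k ρ₀).withDensity
    fun ω => ENNReal.ofReal (Γ₀.det * f (matMul Γ₀ ω + μ₀))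

/-- The matrix `M` with entries
`∫ ωᵢ² ωⱼ² dν - ν₀⁻¹ ∫ ωᵢ² dν ∫ ωⱼ² dν - 2 γ ρ₀ 1{i = j}`, where `ν₀` is the total mass of `ν`
on the sphere of radius `ρ₀`. -/
def momentMatrix {k : ℕ} (ν : Measure (Vec k)) (γ ρ₀ : ℝ) : Matrix (Fin k) (Fin k) ℝ :=
  Matrix.of fun i j =>
    (∫ ω, ω i ^ 2 * ω j ^ 2 ∂ν)
      - (1 / ν.real (Metric.sphere (0 : Vec k) ρ₀)) *
          ((∫ ω, ω i ^ 2 ∂ν) * ∫ ω, ω j ^ 2 ∂ν)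
      - 2 * γ * ρ₀ * (if i = j then 1 else 0)

end

/-!
An affine change of variables, together with a rescaling of `(S, h)` that leaves the density alone
(`exists_standardProfile_rescale`), reduces everything to a `StandardProfile`: with `Γ₀ = N`,
`ρ₀ = r`, the law `P` is the image under `z ↦ N z + μ` of `h(‖z‖²) dz`, the ball of radius `r` has
mass `γ`, and the second moment matrix of that ball is `γ I`.

*Uniqueness of the MCD functional.* Let `φ` be a trimming function with mass `c`, mean `T` and
covariance `C`, let `S = N²`, and let `l = (det C / det S)^(1/k)`, so that `l⁻¹ C` has the
determinant of `S`. Write `q` and `q₀` for the squared Mahalanobis distances that belong to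
`(T, l⁻¹ C)` and `(μ, S)`. Since `∫ q φ dP = l c k` and `0 ≤ φ ≤ 1`,
`r² c - l c k ≤ ∫ (r² - q)⁺ dP`. At each level the sublevel sets of `q` and `q₀` have equal volume,
and that of `q₀` is a superlevel set of the density, so it has the larger mass
(`measureReal_ellipsoid_le`), whence `∫ (r² - q)⁺ dP ≤ ∫ (r² - q₀)⁺ dP = (r² - k) γ`. As `k ≤ r²`
and `γ ≤ c` this gives `l ≥ 1`. If `l = 1`, all these masses agree for levels in `(0, r²)`; were the
ellipsoids different at every level, `h` would be locally constant on `(0, r²)`, which is excluded,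
and two equal ellipsoids have the same centre and matrix (`eq_of_mahalanobisSq_le_eq`). This is
`det_le_det_trimmedCov`.

*The derivative of `Λ`.* The components of `Λ` are integrals of quadratic polynomials in `B z + b`
over `{z : ‖B z + b‖ ≤ ρ}` against `h(‖z‖²) dz`, where `B = G⁻¹ N` and `b = G⁻¹ (μ - m)`. In polar
coordinates such an integral runs over the unit sphere, and its integrand is a `C¹` function of
`(B ω, b, ρ)` built from primitives of `h(t²) tⁿ` at the point where the ray leaves the moving
ellipsoid (`rayIntegral`); so one may differentiate under the integral sign although `h` is only
continuous near `r²`. The second and fourth moments of the sphere then give the derivative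
explicitly; the equations for the mean decouple from those for mass and covariance.

*Non-degeneracy.* With `κ = |Sᵏ⁻¹| h(r²) rᵏ`, where `|Sᵏ⁻¹|` is the area of the unit sphere, both
the injectivity of the derivative and the moment conditions on the sphere come down to `κ < k γ` and
`κ r² < k (k + 2) γ`. These are strict since a non-increasing `h` that is not constant on `(0, r²)`
has larger moments on the ball than the constant `h(r²)` (`pow_div_lt_integral_profile`).
-/

noncomputable section

/-! ### Ellipsoids and Mahalanobis distances -/

section Ellipsoids

variable {k : ℕ}

theorem matMul_eq_toEuclideanCLM (A : Matrix (Fin k) (Fin k) ℝ) (x : Vec k) :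
    matMul A x = Matrix.toEuclideanCLM (𝕜 := ℝ) A x := rfl

theorem matMul_apply (A : Matrix (Fin k) (Fin k) ℝ) (x : Vec k) (i : Fin k) :
    matMul A x i = ∑ j, A i j * x j := rfl

theorem continuous_matMul (A : Matrix (Fin k) (Fin k) ℝ) : Continuous (matMul A) :=
  (Matrix.toEuclideanCLM (𝕜 := ℝ) A).continuous

theorem matMul_mul (A B : Matrix (Fin k) (Fin k) ℝ) (x : Vec k) :
    matMul (A * B) x = matMul A (matMul B x) := by
  simp [matMul_eq_toEuclideanCLM]

theorem matMul_one (x : Vec k) : matMul 1 x = x := by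
  simp [matMul_eq_toEuclideanCLM]

theorem Matrix.PosDef.inv_mul_self {N : Matrix (Fin k) (Fin k) ℝ} (hN : N.PosDef) :
    N⁻¹ * N = 1 :=
  Matrix.nonsing_inv_mul N hN.det_pos.ne'.isUnit

theorem Matrix.PosDef.mul_inv_self {N : Matrix (Fin k) (Fin k) ℝ} (hN : N.PosDef) :
    N * N⁻¹ = 1 :=
  Matrix.mul_nonsing_inv N hN.det_pos.ne'.isUnit

theorem Matrix.PosDef.isSymm_real {N : Matrix (Fin k) (Fin k) ℝ} (hN : N.PosDef) :
    N.IsSymm := by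
  have := hN.isHermitian
  rwa [Matrix.IsHermitian, Matrix.conjTranspose_eq_transpose_of_trivial] at this

open scoped MatrixOrder in
theorem Matrix.PosDef.exists_posDef_mul_self {S : Matrix (Fin k) (Fin k) ℝ} (hS : S.PosDef) :
    ∃ N : Matrix (Fin k) (Fin k) ℝ, N.PosDef ∧ N * N = S :=
  ⟨CFC.sqrt S, Matrix.IsStrictlyPositive.posDef hS.isStrictlyPositive.sqrt,
    CFC.sqrt_mul_sqrt_self S hS.isStrictlyPositive.nonneg⟩

theorem Matrix.PosDef.mul_self {N : Matrix (Fin k) (Fin k) ℝ} (hN : N.PosDef) :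
    (N * N).PosDef := by
  have h := Matrix.PosDef.conjTranspose_mul_self N
    (Matrix.mulVec_injective_iff_isUnit.mpr ((Matrix.isUnit_iff_isUnit_det N).mpr
      hN.det_pos.ne'.isUnit))
  rwa [hN.isHermitian.eq] at h

theorem mahalanobisSq_mul_self {N : Matrix (Fin k) (Fin k) ℝ} (hN : N.PosDef) (m x : Vec k) :
    mahalanobisSq m (N * N) x = ‖matMul N⁻¹ (x - m)‖ ^ 2 := by
  have hs : (N⁻¹).transpose = N⁻¹ := hN.inv.isSymm_real
  rw [EuclideanSpace.real_norm_sq_eq, mahalanobisSq, Matrix.mul_inv_rev, ← Matrix.mulVec_mulVec]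
  have : (matMul N⁻¹ (x - m)).ofLp ⬝ᵥ (matMul N⁻¹ (x - m)).ofLp
      = ∑ i, (matMul N⁻¹ (x - m)) i ^ 2 := by
    simp [dotProduct, sq]
  rw [← this, matMul, Matrix.dotProduct_mulVec, ← Matrix.mulVec_transpose, hs]

theorem mahalanobisSq_affine {N : Matrix (Fin k) (Fin k) ℝ} (hN : N.PosDef) (m z : Vec k) :
    mahalanobisSq m (N * N) (matMul N z + m) = ‖z‖ ^ 2 := by
  rw [mahalanobisSq_mul_self hN, add_sub_cancel_right, ← matMul_mul, hN.inv_mul_self, matMul_one]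

theorem mahalanobisSq_nonneg {C : Matrix (Fin k) (Fin k) ℝ} (hC : C.PosDef) (m x : Vec k) :
    0 ≤ mahalanobisSq m C x := by
  obtain ⟨N, hN, rfl⟩ := hC.exists_posDef_mul_self
  rw [mahalanobisSq_mul_self hN]; positivity

theorem continuous_mahalanobisSq (m : Vec k) (C : Matrix (Fin k) (Fin k) ℝ) :
    Continuous (mahalanobisSq m C) := by
  have : Continuous fun x : Vec k => (x - m).ofLp ⬝ᵥ (matMul C⁻¹ (x - m)).ofLp := by
    have := continuous_matMul (C⁻¹)
    simp only [dotProduct]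
    fun_prop
  exact this

theorem mahalanobisSq_pos {C : Matrix (Fin k) (Fin k) ℝ} (hC : C.PosDef) {m x : Vec k}
    (h : x ≠ m) : 0 < mahalanobisSq m C x := by
  have := hC.inv.dotProduct_mulVec_pos (x := (x - m).ofLp) (by
    intro h'
    exact h (sub_eq_zero.mp (WithLp.ofLp_injective 2 h')))
  simpa [mahalanobisSq] using this

theorem mahalanobisSq_add_smul (m : Vec k) (C : Matrix (Fin k) (Fin k) ℝ) (s : ℝ) (a : Vec k) :
    mahalanobisSq m C (m + s • a) = s ^ 2 * mahalanobisSq m C (m + a) := by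
  simp only [mahalanobisSq, add_sub_cancel_left, WithLp.ofLp_smul, Matrix.mulVec_smul,
    smul_dotProduct, dotProduct_smul, smul_eq_mul]
  ring

theorem mahalanobisSq_smul_matrix (m : Vec k) (C : Matrix (Fin k) (Fin k) ℝ) {c : ℝ}
    (hc : c ≠ 0) (x : Vec k) :
    mahalanobisSq m (c • C) x = c⁻¹ * mahalanobisSq m C x := by
  by_cases hC : IsUnit C.det
  · have h : (c • C)⁻¹ = c⁻¹ • C⁻¹ := by
      have := Matrix.inv_smul' C (Units.mk0 c hc) hC
      simpa [Units.smul_def] using this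
    simp [mahalanobisSq, h, Matrix.smul_mulVec, dotProduct_smul]
  · have h' : ¬ IsUnit (c • C).det := by
      rw [Matrix.det_smul]
      intro h
      exact hC (isUnit_of_mul_isUnit_right h)
    simp [mahalanobisSq, Matrix.nonsing_inv_apply_not_isUnit _ hC,
      Matrix.nonsing_inv_apply_not_isUnit _ h']

/-- The image of Lebesgue measure under the affine map `z ↦ N z + m`. -/
theorem map_affine_volume {N : Matrix (Fin k) (Fin k) ℝ} (hN : N.PosDef) (m : Vec k) :
    (volume : Measure (Vec k)).map (fun z => matMul N z + m)
      = ENNReal.ofReal (N.det⁻¹) • volume := by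
  have hdet : LinearMap.det (Matrix.toEuclideanCLM (𝕜 := ℝ) N : Vec k →ₗ[ℝ] Vec k) = N.det := by
    rw [Matrix.coe_toEuclideanCLM_eq_toEuclideanLin]
    exact LinearMap.det_toLpLin 2 N
  have h1 := Measure.map_linearMap_addHaar_eq_smul_addHaar (volume : Measure (Vec k))
    (f := (Matrix.toEuclideanCLM (𝕜 := ℝ) N : Vec k →ₗ[ℝ] Vec k))
    (by rw [hdet]; exact hN.det_pos.ne')
  rw [hdet, abs_of_pos (inv_pos.mpr hN.det_pos)] at h1
  have h1' : Measure.map (Matrix.toEuclideanCLM (𝕜 := ℝ) N) (volume : Measure (Vec k))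
      = ENNReal.ofReal (N.det⁻¹) • volume := h1
  have h2 : (fun z : Vec k => matMul N z + m) = (fun z => z + m) ∘
      ⇑(Matrix.toEuclideanCLM (𝕜 := ℝ) N) := rfl
  rw [h2, ← Measure.map_map (measurable_add_const m)
    (Matrix.toEuclideanCLM (𝕜 := ℝ) N).continuous.measurable]
  rw [h1', Measure.map_smul, map_add_right_eq_self]

/-- The affine bijection `z ↦ N z + m` of `ℝᵏ`. -/
def affineHomeo (N : Matrix (Fin k) (Fin k) ℝ) (hN : N.PosDef) (m : Vec k) : Vec k ≃ₜ Vec k where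
  toFun z := matMul N z + m
  invFun x := matMul N⁻¹ (x - m)
  left_inv z := by
    simp only [add_sub_cancel_right]; rw [← matMul_mul, hN.inv_mul_self, matMul_one]
  right_inv x := by
    simp only; rw [← matMul_mul, hN.mul_inv_self, matMul_one, sub_add_cancel]
  continuous_toFun := (continuous_matMul N).add continuous_const
  continuous_invFun := (continuous_matMul N⁻¹).comp (continuous_id.sub continuous_const)

theorem measurableEmbedding_affine {N : Matrix (Fin k) (Fin k) ℝ} (hN : N.PosDef) (m : Vec k) :
    MeasurableEmbedding (fun z : Vec k => matMul N z + m) :=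
  (affineHomeo N hN m).measurableEmbedding

/-- Ellipsoids whose matrices have the same determinant have the same volume: both are affine
images of a ball. -/
theorem volume_mahalanobisSq_le {C : Matrix (Fin k) (Fin k) ℝ} (hC : C.PosDef) (m : Vec k)
    (t : ℝ) :
    volume {x | mahalanobisSq m C x ≤ t}
      = ENNReal.ofReal (√C.det) * volume {z : Vec k | ‖z‖ ^ 2 ≤ t} := by
  obtain ⟨N, hN, rfl⟩ := hC.exists_posDef_mul_self
  have h := congrArg (fun ν => ν {x | mahalanobisSq m (N * N) x ≤ t}) (map_affine_volume hN m)
  simp only [Measure.smul_apply, smul_eq_mul] at h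
  rw [(measurableEmbedding_affine hN m).map_apply] at h
  have hpre : (fun z : Vec k => matMul N z + m) ⁻¹' {x | mahalanobisSq m (N * N) x ≤ t}
      = {z | ‖z‖ ^ 2 ≤ t} := by
    ext z; simp [mahalanobisSq_affine hN]
  rw [hpre] at h
  rw [h, Matrix.det_mul, Real.sqrt_mul_self hN.det_pos.le, ← mul_assoc,
    ← ENNReal.ofReal_mul hN.det_pos.le, mul_inv_cancel₀ hN.det_pos.ne']
  simp

theorem volume_normSq_le_lt_top (t : ℝ) : volume {z : Vec k | ‖z‖ ^ 2 ≤ t} < ⊤ := by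
  refine (measure_mono (t := Metric.closedBall 0 (√t)) ?_).trans_lt
    measure_closedBall_lt_top
  intro z hz
  simp only [mem_closedBall_zero_iff]
  exact Real.le_sqrt_of_sq_le hz

/-- The measure on `ℝᵏ` with density `z ↦ h(‖z‖²)`. -/
def radialMeasure (k : ℕ) (h : ℝ → ℝ) : Measure (Vec k) :=
  volume.withDensity fun z => ENNReal.ofReal (h (‖z‖ ^ 2))

theorem AntitoneOn.measurable_comp_of_nonneg {α : Type*} [MeasurableSpace α] {h : ℝ → ℝ}
    (ha : AntitoneOn h (Ici 0)) {q : α → ℝ} (hq : Measurable q) (hq0 : ∀ x, 0 ≤ q x) :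
    Measurable fun x => h (q x) := by
  have h1 : Antitone fun t => h (max t 0) := fun s t hst =>
    ha (mem_Ici.mpr (le_max_right _ _)) (mem_Ici.mpr (le_max_right _ _)) (max_le_max_right _ hst)
  have h2 := h1.measurable.comp hq
  convert! h2 using 2 with x
  simp [max_eq_left (hq0 x)]

theorem measurable_radialDensity {h : ℝ → ℝ} (ha : AntitoneOn h (Ici 0)) :
    Measurable fun z : Vec k => h (‖z‖ ^ 2) :=
  ha.measurable_comp_of_nonneg (by fun_prop) fun z => by positivity

theorem measurable_ellipticalDensity {S : Matrix (Fin k) (Fin k) ℝ} (hS : S.PosDef) (m : Vec k)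
    {h : ℝ → ℝ} (ha : AntitoneOn h (Ici 0)) : Measurable (ellipticalDensity m S h) :=
  (ha.measurable_comp_of_nonneg (continuous_mahalanobisSq m S).measurable
    (mahalanobisSq_nonneg hS m)).const_mul _

theorem det_mul_self_rpow {N : Matrix (Fin k) (Fin k) ℝ} (hN : N.PosDef) :
    (N * N).det ^ (-(1 / 2) : ℝ) = N.det⁻¹ := by
  rw [Matrix.det_mul, Real.rpow_neg (mul_nonneg hN.det_pos.le hN.det_pos.le),
    ← Real.sqrt_eq_rpow, Real.sqrt_mul_self hN.det_pos.le]

theorem ellipticalDensity_affine {N : Matrix (Fin k) (Fin k) ℝ} (hN : N.PosDef) (m z : Vec k)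
    (h : ℝ → ℝ) :
    ellipticalDensity m (N * N) h (matMul N z + m) = N.det⁻¹ * h (‖z‖ ^ 2) := by
  rw [ellipticalDensity, mahalanobisSq_affine hN, det_mul_self_rpow hN]

/-- The elliptical distribution with scatter matrix `N²` is the affine image of the radial one. -/
theorem withDensity_ellipticalDensity {N : Matrix (Fin k) (Fin k) ℝ} (hN : N.PosDef) (m : Vec k)
    (h : ℝ → ℝ) :
    volume.withDensity (fun x => ENNReal.ofReal (ellipticalDensity m (N * N) h x))
      = (radialMeasure k h).map (fun z => matMul N z + m) := by
  have hvol : (volume : Measure (Vec k))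
      = ENNReal.ofReal N.det • (volume : Measure (Vec k)).map (fun z => matMul N z + m) := by
    rw [map_affine_volume hN, smul_smul, ← ENNReal.ofReal_mul hN.det_pos.le,
      mul_inv_cancel₀ hN.det_pos.ne']
    simp
  ext s hs
  rw [withDensity_apply _ hs, (measurableEmbedding_affine hN m).map_apply, radialMeasure,
    withDensity_apply _ ((measurableEmbedding_affine hN m).measurable hs)]
  conv_lhs => rw [hvol]
  rw [Measure.restrict_smul, lintegral_smul_measure,
    (measurableEmbedding_affine hN m).restrict_map, (measurableEmbedding_affine hN m).lintegral_map,
    smul_eq_mul, ← lintegral_const_mul']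
  · refine lintegral_congr fun z => ?_
    rw [ellipticalDensity_affine hN, ← ENNReal.ofReal_mul hN.det_pos.le, ← mul_assoc,
      mul_inv_cancel₀ hN.det_pos.ne', one_mul]
  · simp

end Ellipsoids

/-! ### Comparison of ellipsoids of equal volume -/

section Comparison

/-- Bathtub principle: among sets of equal measure, a superlevel set `B` of `f` has the largest
integral of `f`; in the case of equality `f` is a.e. constant on the symmetric difference. -/
theorem setIntegral_le_and_ae_eq_of_volume_eq {α : Type*} [MeasurableSpace α] {ν : Measure α}
    {f : α → ℝ} (hf : Integrable f ν) {B E : Set α} (hB : MeasurableSet B)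
    (hE : MeasurableSet E) (hBE : ν B = ν E) (hfin : ν B ≠ ⊤) {c : ℝ}
    (hge : ∀ x ∈ B, c ≤ f x) (hle : ∀ x ∉ B, f x ≤ c) :
    (∫ x in E, f x ∂ν ≤ ∫ x in B, f x ∂ν) ∧
      (∫ x in E, f x ∂ν = ∫ x in B, f x ∂ν →
        (∀ᵐ x ∂ν, x ∈ B \ E → f x = c) ∧ ∀ᵐ x ∂ν, x ∈ E \ B → f x = c) := by
  have hEfin : ν E ≠ ⊤ := hBE ▸ hfin
  have hBd : ν (B \ E) ≠ ⊤ := measure_ne_top_of_subset sdiff_subset hfin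
  have hEd : ν (E \ B) ≠ ⊤ := measure_ne_top_of_subset sdiff_subset hEfin
  have hvol : ν.real (B \ E) = ν.real (E \ B) := by
    have h1 := measureReal_inter_add_sdiff (μ := ν) (s := B) (t := E) hE hfin
    have h2 := measureReal_inter_add_sdiff (μ := ν) (s := E) (t := B) hB hEfin
    have h3 : ν.real B = ν.real E := by simp [Measure.real, hBE]
    rw [inter_comm] at h2
    linarith
  have i1 : IntegrableOn (fun x => f x - c) (B \ E) ν :=
    hf.integrableOn.sub (integrableOn_const hBd)
  have i2 : IntegrableOn (fun x => c - f x) (E \ B) ν :=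
    (integrableOn_const hEd).sub hf.integrableOn
  have n1 : 0 ≤ᵐ[ν.restrict (B \ E)] fun x => f x - c := by
    filter_upwards [ae_restrict_mem (hB.diff hE)] with x hx
    exact sub_nonneg.mpr (hge x hx.1)
  have n2 : 0 ≤ᵐ[ν.restrict (E \ B)] fun x => c - f x := by
    filter_upwards [ae_restrict_mem (hE.diff hB)] with x hx
    exact sub_nonneg.mpr (hle x hx.2)
  have p1 : 0 ≤ ∫ x in B \ E, (f x - c) ∂ν := integral_nonneg_of_ae n1
  have p2 : 0 ≤ ∫ x in E \ B, (c - f x) ∂ν := integral_nonneg_of_ae n2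
  have e1 : ∫ x in B \ E, (f x - c) ∂ν = ∫ x in B \ E, f x ∂ν - ν.real (B \ E) * c := by
    rw [integral_sub hf.integrableOn (integrableOn_const hBd)]; simp
  have e2 : ∫ x in E \ B, (c - f x) ∂ν = ν.real (E \ B) * c - ∫ x in E \ B, f x ∂ν := by
    have hc : IntegrableOn (fun _ => c) (E \ B) ν := integrableOn_const hEd
    rw [integral_sub hc hf.integrableOn]; simp
  have s1 := integral_inter_add_sdiff (s := B) hE hf.integrableOn
  have s2 := integral_inter_add_sdiff (s := E) hB hf.integrableOn
  rw [inter_comm] at s2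
  rw [hvol] at e1
  refine ⟨by linarith, fun heq => ⟨?_, ?_⟩⟩
  · have z : ∫ x in B \ E, (f x - c) ∂ν = 0 := by linarith
    rw [integral_eq_zero_iff_of_nonneg_ae n1 i1] at z
    filter_upwards [(ae_restrict_iff' (hB.diff hE)).mp z] with x hx hx'
    have := hx hx'
    simp only [Pi.zero_apply] at this
    linarith
  · have z : ∫ x in E \ B, (c - f x) ∂ν = 0 := by linarith
    rw [integral_eq_zero_iff_of_nonneg_ae n2 i2] at z
    filter_upwards [(ae_restrict_iff' (hE.diff hB)).mp z] with x hx hx'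
    have := hx hx'
    simp only [Pi.zero_apply] at this
    linarith

variable {k : ℕ}

theorem mahalanobisSq_le_of_forall_lt {m₀ m : Vec k} {S C : Matrix (Fin k) (Fin k) ℝ} {t : ℝ}
    (ht : 0 < t) (hlt : ∀ p, mahalanobisSq m₀ S p < t → mahalanobisSq m C p ≤ t) (p : Vec k)
    (hp : mahalanobisSq m₀ S p ≤ t) : mahalanobisSq m C p ≤ t := by
  have hc : Tendsto (fun s : ℝ => mahalanobisSq m C (m₀ + s • (p - m₀))) (𝓝[<] 1)
      (𝓝 (mahalanobisSq m C (m₀ + (1 : ℝ) • (p - m₀)))) := by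
    have h : Continuous (fun s : ℝ => mahalanobisSq m C (m₀ + s • (p - m₀))) :=
      (continuous_mahalanobisSq m C).comp (by fun_prop)
    exact (h.tendsto 1).mono_left nhdsWithin_le_nhds
  have hp' : m₀ + (1 : ℝ) • (p - m₀) = p := by simp
  rw [hp'] at hc
  refine le_of_tendsto hc ?_
  filter_upwards [Ioo_mem_nhdsLT (show (0 : ℝ) < 1 by norm_num)] with s hs
  apply hlt
  rw [mahalanobisSq_add_smul, add_sub_cancel]
  have h1 : s ^ 2 < 1 := by nlinarith [hs.1, hs.2]
  have h0 : 0 ≤ s ^ 2 := sq_nonneg s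
  nlinarith

/-- If two different ellipsoids have the same volume, some point lies in the interior of the first
and outside the second. -/
theorem exists_mahalanobisSq_lt_lt {m₀ m : Vec k} {S C : Matrix (Fin k) (Fin k) ℝ} {t : ℝ}
    (ht : 0 < t)
    (hvol : volume {x | mahalanobisSq m₀ S x ≤ t} = volume {x | mahalanobisSq m C x ≤ t})
    (hfin : volume {x | mahalanobisSq m₀ S x ≤ t} ≠ ⊤)
    (hne : {x | mahalanobisSq m₀ S x ≤ t} ≠ {x | mahalanobisSq m C x ≤ t}) :
    ∃ p, mahalanobisSq m₀ S p < t ∧ t < mahalanobisSq m C p := by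
  by_contra! hcon
  have hsub : {x | mahalanobisSq m₀ S x ≤ t} ⊆ {x | mahalanobisSq m C x ≤ t} :=
    fun x hx => mahalanobisSq_le_of_forall_lt ht hcon x hx
  refine hne (Subset.antisymm hsub fun p hp => mahalanobisSq_le_of_forall_lt ht ?_ p hp)
  intro p hp
  by_contra! hp'
  have c0 := continuous_mahalanobisSq m₀ S
  have c1 := continuous_mahalanobisSq m C
  have hnull : volume ({x | mahalanobisSq m C x ≤ t} \ {x | mahalanobisSq m₀ S x ≤ t}) = 0 := by
    rw [measure_sdiff hsub (isClosed_le c0 continuous_const).measurableSet.nullMeasurableSet hfin,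
      hvol, tsub_self]
  have hopen : IsOpen {x | mahalanobisSq m C x < t ∧ t < mahalanobisSq m₀ S x} :=
    (isOpen_lt c1 continuous_const).inter (isOpen_lt continuous_const c0)
  have hsub' : {x | mahalanobisSq m C x < t ∧ t < mahalanobisSq m₀ S x} ⊆
      {x | mahalanobisSq m C x ≤ t} \ {x | mahalanobisSq m₀ S x ≤ t} :=
    fun x hx => ⟨hx.1.le, not_le.mpr hx.2⟩
  have := (hopen.measure_eq_zero_iff volume).mp (measure_mono_null hsub' hnull)
  exact Set.notMem_empty p (this ▸ ⟨hp, hp'⟩)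

/-- The parallelogram law. -/
theorem mahalanobisSq_add_add_sub (m : Vec k) (C : Matrix (Fin k) (Fin k) ℝ) (a v : Vec k) :
    mahalanobisSq m C (m + v + a) + mahalanobisSq m C (m + v - a)
      = 2 * (mahalanobisSq m C (m + a) + mahalanobisSq m C (m + v)) := by
  have e1 : m + v + a - m = v + a := by abel
  have e2 : m + v - a - m = v - a := by abel
  simp only [mahalanobisSq, e1, e2, add_sub_cancel_left, WithLp.ofLp_add, WithLp.ofLp_sub,
    Matrix.mulVec_add, Matrix.mulVec_sub, add_dotProduct, sub_dotProduct, dotProduct_add,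
    dotProduct_sub]
  ring

theorem mahalanobisSq_translate (m m' : Vec k) (C : Matrix (Fin k) (Fin k) ℝ) (a : Vec k) :
    mahalanobisSq m C (m + a) = mahalanobisSq m' C (m' + a) := by
  simp [mahalanobisSq]

theorem mahalanobisSq_add_neg (m : Vec k) (C : Matrix (Fin k) (Fin k) ℝ) (a : Vec k) :
    mahalanobisSq m C (m - a) = mahalanobisSq m C (m + a) := by
  simp [mahalanobisSq, sub_eq_add_neg, Matrix.mulVec_neg]

theorem exists_mahalanobisSq_eq (hk : 0 < k) {S : Matrix (Fin k) (Fin k) ℝ} (hS : S.PosDef)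
    (m : Vec k) {t : ℝ} (ht : 0 < t) : ∃ a, mahalanobisSq m S (m + a) = t := by
  have : Nonempty (Fin k) := ⟨⟨0, hk⟩⟩
  obtain ⟨a, ha⟩ := exists_ne (0 : Vec k)
  have hpos : 0 < mahalanobisSq m S (m + a) := mahalanobisSq_pos hS (by simpa using ha)
  refine ⟨√(t / mahalanobisSq m S (m + a)) • a, ?_⟩
  rw [mahalanobisSq_add_smul, Real.sq_sqrt (by positivity)]
  field_simp

theorem eq_of_mahalanobisSq_eq {S C : Matrix (Fin k) (Fin k) ℝ} (hS : S.PosDef) (hC : C.PosDef)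
    (h : ∀ a : Vec k, mahalanobisSq 0 C (0 + a) = mahalanobisSq 0 S (0 + a)) : C = S := by
  have hA : (C⁻¹).IsSymm := hC.inv.isSymm_real
  have hB : (S⁻¹).IsSymm := hS.inv.isSymm_real
  have key : ∀ a b : Fin k → ℝ, a ⬝ᵥ C⁻¹.mulVec b = a ⬝ᵥ S⁻¹.mulVec b := by
    intro a b
    have q : ∀ v : Fin k → ℝ, v ⬝ᵥ C⁻¹.mulVec v = v ⬝ᵥ S⁻¹.mulVec v := fun v => by
      simpa [mahalanobisSq] using h (WithLp.toLp 2 v)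
    have sC : b ⬝ᵥ C⁻¹.mulVec a = a ⬝ᵥ C⁻¹.mulVec b := by
      rw [Matrix.dotProduct_mulVec, ← Matrix.mulVec_transpose, hA.eq, dotProduct_comm]
    have sS : b ⬝ᵥ S⁻¹.mulVec a = a ⬝ᵥ S⁻¹.mulVec b := by
      rw [Matrix.dotProduct_mulVec, ← Matrix.mulVec_transpose, hB.eq, dotProduct_comm]
    have := q (a + b)
    simp only [Matrix.mulVec_add, add_dotProduct, dotProduct_add, q a, q b, sC, sS] at this
    linarith
  have hinv : C⁻¹ = S⁻¹ := by
    ext i j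
    simpa using key (Pi.single i 1) (Pi.single j 1)
  have := congrArg (fun M => M⁻¹) hinv
  simpa [Matrix.nonsing_inv_nonsing_inv _ hC.det_pos.ne'.isUnit,
    Matrix.nonsing_inv_nonsing_inv _ hS.det_pos.ne'.isUnit] using this

/-- An ellipsoid determines its centre and, its radius being given, its matrix. -/
theorem eq_of_mahalanobisSq_le_eq (hk : 0 < k) {m₀ m : Vec k} {S C : Matrix (Fin k) (Fin k) ℝ}
    (hS : S.PosDef) (hC : C.PosDef) {t : ℝ} (ht : 0 < t)
    (heq : {x | mahalanobisSq m₀ S x ≤ t} = {x | mahalanobisSq m C x ≤ t}) :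
    m = m₀ ∧ C = S := by
  have hiff : ∀ x, mahalanobisSq m₀ S x ≤ t ↔ mahalanobisSq m C x ≤ t := fun x => by
    have := congrArg (x ∈ ·) heq
    simpa using this
  -- The parallelogram law for the two points at `±a` from one centre, which both lie in the
  -- ellipsoid around the other one.
  have step1 : ∀ a, mahalanobisSq m₀ S (m₀ + a) ≤ t →
      mahalanobisSq m C (m + a) + mahalanobisSq m C (m + (m₀ - m)) ≤ t := by
    intro a ha
    have h1 := (hiff _).mp ha
    have h2 := (hiff (m₀ - a)).mp (by rwa [mahalanobisSq_add_neg])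
    have := mahalanobisSq_add_add_sub m C a (m₀ - m)
    rw [add_sub_cancel] at this ⊢
    linarith
  have step2 : ∀ a, mahalanobisSq m C (m + a) ≤ t →
      mahalanobisSq m₀ S (m₀ + a) + mahalanobisSq m₀ S (m₀ + (m - m₀)) ≤ t := by
    intro a ha
    have h1 := (hiff _).mpr ha
    have h2 := (hiff (m - a)).mpr (by rwa [mahalanobisSq_add_neg])
    have := mahalanobisSq_add_add_sub m₀ S a (m - m₀)
    rw [add_sub_cancel] at this ⊢
    linarith
  -- Applied in turn to a boundary point, the two inequalities force the centres to agree.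
  have hm : m = m₀ := by
    by_contra hne
    obtain ⟨a, ha⟩ := exists_mahalanobisSq_eq hk hS m₀ ht
    have h1 := step1 a ha.le
    have h2 := step2 a (by
      have := mahalanobisSq_nonneg hC m (m + (m₀ - m)); linarith)
    rw [ha, add_sub_cancel] at h2
    have := mahalanobisSq_pos hS hne
    linarith
  subst hm
  refine ⟨rfl, eq_of_mahalanobisSq_eq hS hC fun a => ?_⟩
  rw [mahalanobisSq_translate 0 m, mahalanobisSq_translate 0 m]
  have aux : ∀ D D' : Matrix (Fin k) (Fin k) ℝ, D.PosDef → D'.PosDef →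
      (∀ x, mahalanobisSq m D x ≤ t → mahalanobisSq m D' x ≤ t) →
      mahalanobisSq m D' (m + a) ≤ mahalanobisSq m D (m + a) := by
    intro D D' hD hD' hsub
    by_cases ha : a = 0
    · simp [ha, mahalanobisSq]
    have hpos : 0 < mahalanobisSq m D (m + a) := mahalanobisSq_pos hD (by simpa using ha)
    have := hsub (m + √(t / mahalanobisSq m D (m + a)) • a) (by
      rw [mahalanobisSq_add_smul, Real.sq_sqrt (by positivity)]
      field_simp; rfl)
    rw [mahalanobisSq_add_smul, Real.sq_sqrt (by positivity)] at this
    rwa [div_mul_eq_mul_div, div_le_iff₀ hpos, mul_le_mul_iff_right₀ ht] at this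
  exact le_antisymm (aux S C hS hC fun x => (hiff x).mp) (aux C S hC hS fun x => (hiff x).mpr)

end Comparison

/-! ### Trimmed moments -/

section Trimming

variable {k : ℕ} {P : Measure (Vec k)} {γ : ℝ} {φ : Vec k → ℝ}

theorem IsTrimming.integrable [IsFiniteMeasure P] (hφ : IsTrimming P γ φ) : Integrable φ P :=
  Integrable.of_bound hφ.measurable.aestronglyMeasurable 1 (ae_of_all _ fun x => by
    rw [Real.norm_of_nonneg (hφ.mem_Icc x).1]; exact (hφ.mem_Icc x).2)

theorem sq_apply_le_norm_sq (x : Vec k) (i : Fin k) : x i ^ 2 ≤ ‖x‖ ^ 2 := by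
  rw [EuclideanSpace.real_norm_sq_eq]
  exact Finset.single_le_sum (f := fun i => x i ^ 2) (fun _ _ => sq_nonneg _) (Finset.mem_univ i)

theorem IsTrimming.integrable_mul_mul [IsFiniteMeasure P] (hφ : IsTrimming P γ φ) (a b : ℝ)
    (i j : Fin k) : Integrable (fun x => (x i - a) * (x j - b) * φ x) P := by
  refine ((hφ.second_moment.const_mul 2).add (hφ.integrable.const_mul (a ^ 2 + b ^ 2))).mono'
    ?_ (ae_of_all _ fun x => ?_)
  · have := hφ.measurable
    exact Measurable.aestronglyMeasurable (by fun_prop)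
  · have h0 := (hφ.mem_Icc x).1
    have h1 : |(x i - a) * (x j - b)| ≤ 2 * ‖x‖ ^ 2 + (a ^ 2 + b ^ 2) := by
      have := sq_apply_le_norm_sq x i
      have := sq_apply_le_norm_sq x j
      rw [abs_le]
      constructor <;> nlinarith [sq_nonneg (x i - a + (x j - b)), sq_nonneg (x i - a - (x j - b)),
        sq_nonneg (x i + a), sq_nonneg (x j + b)]
    rw [Real.norm_eq_abs, abs_mul, abs_of_nonneg h0]
    simp only [Pi.add_apply]
    nlinarith [mul_le_mul_of_nonneg_right h1 h0]

theorem sum_mul_trimmedCov [IsFiniteMeasure P] (hφ : IsTrimming P γ φ)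
    (A : Matrix (Fin k) (Fin k) ℝ) :
    ∑ i, ∑ j, A i j * trimmedCov P φ i j = (∫ x, φ x ∂P)⁻¹ *
      ∫ x, (∑ i, ∑ j, A i j * ((x i - trimmedMean P φ i) * (x j - trimmedMean P φ j))) * φ x
        ∂P := by
  have e : ∀ x : Vec k,
      (∑ i, ∑ j, A i j * ((x i - trimmedMean P φ i) * (x j - trimmedMean P φ j))) * φ x
      = ∑ i, ∑ j, A i j * ((x i - trimmedMean P φ i) * (x j - trimmedMean P φ j) * φ x) := by
    intro x
    simp only [Finset.sum_mul, mul_assoc]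
  simp_rw [e]
  have hI : ∀ i j, Integrable (fun x => A i j *
      ((x i - trimmedMean P φ i) * (x j - trimmedMean P φ j) * φ x)) P := fun i j =>
    (hφ.integrable_mul_mul _ _ i j).const_mul _
  rw [integral_finsetSum _ fun i _ => integrable_finsetSum _ fun j _ => hI i j, Finset.mul_sum]
  refine Finset.sum_congr rfl fun i _ => ?_
  rw [integral_finsetSum _ fun j _ => hI i j, Finset.mul_sum]
  refine Finset.sum_congr rfl fun j _ => ?_
  rw [integral_const_mul, trimmedCov, Matrix.of_apply]
  ring

theorem trimmedCov_isSymm : (trimmedCov P φ).IsSymm := by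
  ext i j
  simp only [trimmedCov, Matrix.transpose_apply, Matrix.of_apply]
  congr 2; funext x; ring

theorem volume_hyperplane_eq_zero {v : Fin k → ℝ} (hv : v ≠ 0) (a : Vec k) :
    (volume : Measure (Vec k)) {x | ∑ i, v i * (x i - a i) = 0} = 0 := by
  let L : Vec k →ₗ[ℝ] ℝ := (innerSL ℝ (WithLp.toLp 2 v : Vec k)).toLinearMap
  have hL : ∀ x : Vec k, L x = ∑ i, v i * x i := fun x => by
    simp [L, PiLp.inner_apply, mul_comm]
  have hset : {x : Vec k | ∑ i, v i * (x i - a i) = 0}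
      = (AffineSubspace.mk' a (LinearMap.ker L) : Set (Vec k)) := by
    ext x
    simp [AffineSubspace.mem_mk', hL]
  rw [hset]
  refine Measure.addHaar_affineSubspace _ _ fun htop => hv ?_
  have h1 := congrArg AffineSubspace.direction htop
  rw [AffineSubspace.direction_mk', AffineSubspace.direction_top, LinearMap.ker_eq_top] at h1
  funext i
  have := LinearMap.congr_fun h1 (EuclideanSpace.single i 1)
  rw [hL] at this
  simpa using this

/-- A trimmed covariance is non-singular, as `P` does not charge hyperplanes. -/
theorem trimmedCov_posDef [IsFiniteMeasure P] (hP : P ≪ volume) (hγ : 0 < γ)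
    (hφ : IsTrimming P γ φ) : (trimmedCov P φ).PosDef := by
  have hc : 0 < ∫ x, φ x ∂P := hγ.trans_le hφ.mass
  refine Matrix.PosDef.of_dotProduct_mulVec_pos ?_ fun v hv => ?_
  · rw [Matrix.IsHermitian, Matrix.conjTranspose_eq_transpose_of_trivial]
    exact trimmedCov_isSymm
  have e : star v ⬝ᵥ (trimmedCov P φ).mulVec v
      = ∑ i, ∑ j, (Matrix.vecMulVec v v) i j * trimmedCov P φ i j := by
    simp only [dotProduct, Matrix.mulVec, Matrix.vecMulVec_apply, Finset.mul_sum, star_trivial]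
    refine Finset.sum_congr rfl fun i _ => Finset.sum_congr rfl fun j _ => by ring
  have e2 : ∀ x : Vec k, ∑ i, ∑ j, (Matrix.vecMulVec v v) i j *
      ((x i - trimmedMean P φ i) * (x j - trimmedMean P φ j))
      = (∑ i, v i * (x i - trimmedMean P φ i)) ^ 2 := by
    intro x
    rw [sq, Finset.sum_mul_sum]
    simp only [Matrix.vecMulVec_apply]
    refine Finset.sum_congr rfl fun i _ => Finset.sum_congr rfl fun j _ => by ring
  have hint : Integrable (fun x => (∑ i, v i * (x i - trimmedMean P φ i)) ^ 2 * φ x) P := by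
    have : (fun x : Vec k => (∑ i, v i * (x i - trimmedMean P φ i)) ^ 2 * φ x)
        = fun x => ∑ i, ∑ j, (Matrix.vecMulVec v v) i j *
          ((x i - trimmedMean P φ i) * (x j - trimmedMean P φ j) * φ x) := by
      funext x
      rw [← e2]; simp only [Finset.sum_mul, mul_assoc]
    rw [this]
    exact integrable_finsetSum _ fun i _ => integrable_finsetSum _ fun j _ =>
      (hφ.integrable_mul_mul _ _ i j).const_mul _
  rw [e, sum_mul_trimmedCov hφ]
  simp_rw [e2]
  refine mul_pos (inv_pos.mpr hc) ?_
  have h0 : 0 ≤ fun x : Vec k => (∑ i, v i * (x i - trimmedMean P φ i)) ^ 2 * φ x :=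
    fun x => mul_nonneg (sq_nonneg _) (hφ.mem_Icc x).1
  refine (integral_nonneg h0).lt_of_ne fun hzero => hc.ne' ?_
  have hae := (integral_eq_zero_iff_of_nonneg h0 hint).mp hzero.symm
  have hnull : ∀ᵐ x ∂P, ∑ i, v i * (x i - trimmedMean P φ i) ≠ 0 := by
    rw [ae_iff]
    simpa using hP (volume_hyperplane_eq_zero hv (trimmedMean P φ))
  have : φ =ᵐ[P] 0 := by
    filter_upwards [hae, hnull] with x h1 h2
    simpa [h2] using h1
  rw [integral_congr_ae this]; simp

/-- The trimmed Mahalanobis distances sum up to the trace of `C⁻¹ C`. -/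
theorem integral_mahalanobisSq_mul [IsFiniteMeasure P] (hP : P ≪ volume) (hγ : 0 < γ)
    (hφ : IsTrimming P γ φ) :
    ∫ x, mahalanobisSq (trimmedMean P φ) (trimmedCov P φ) x * φ x ∂P
      = (∫ x, φ x ∂P) * k := by
  have hc : 0 < ∫ x, φ x ∂P := hγ.trans_le hφ.mass
  have hC := trimmedCov_posDef hP hγ hφ
  have e : ∀ x : Vec k, mahalanobisSq (trimmedMean P φ) (trimmedCov P φ) x
      = ∑ i, ∑ j, (trimmedCov P φ)⁻¹ i j *
        ((x i - trimmedMean P φ i) * (x j - trimmedMean P φ j)) := by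
    intro x
    simp only [mahalanobisSq, dotProduct, Matrix.mulVec, Finset.mul_sum]
    refine Finset.sum_congr rfl fun i _ => Finset.sum_congr rfl fun j _ => ?_
    simp only [PiLp.sub_apply]; ring
  have h := sum_mul_trimmedCov hφ (trimmedCov P φ)⁻¹
  have htr : ∑ i, ∑ j, (trimmedCov P φ)⁻¹ i j * trimmedCov P φ i j = k := by
    have h1 : Matrix.trace ((trimmedCov P φ)⁻¹ * trimmedCov P φ) = k := by
      rw [hC.inv_mul_self]; simp
    rw [← h1, Matrix.trace]
    refine Finset.sum_congr rfl fun i _ => ?_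
    rw [Matrix.diag_apply, Matrix.mul_apply]
    refine Finset.sum_congr rfl fun j _ => ?_
    rw [trimmedCov_isSymm.apply i j]
  simp_rw [e]
  rw [htr] at h
  rw [h]
  field_simp

theorem integrable_mahalanobisSq_mul [IsFiniteMeasure P] (hφ : IsTrimming P γ φ) (m : Vec k)
    (C : Matrix (Fin k) (Fin k) ℝ) : Integrable (fun x => mahalanobisSq m C x * φ x) P := by
  have : (fun x : Vec k => mahalanobisSq m C x * φ x)
      = fun x => ∑ i, ∑ j, C⁻¹ i j * ((x i - m i) * (x j - m j) * φ x) := by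
    funext x
    simp only [mahalanobisSq, dotProduct, Matrix.mulVec, Finset.mul_sum, Finset.sum_mul]
    refine Finset.sum_congr rfl fun i _ => Finset.sum_congr rfl fun j _ => ?_
    simp only [PiLp.sub_apply]; ring
  rw [this]
  exact integrable_finsetSum _ fun i _ => integrable_finsetSum _ fun j _ =>
    (hφ.integrable_mul_mul _ _ i j).const_mul _

/-- Layer-cake formula for the integral of `(R - q)⁺`. -/
theorem integral_max_sub_eq {α : Type*} [MeasurableSpace α] {P : Measure α} [IsFiniteMeasure P]
    {q : α → ℝ} (hq : Measurable q) (hq0 : ∀ x, 0 ≤ q x) {R : ℝ} (hR : 0 ≤ R) :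
    ∫ x, max (R - q x) 0 ∂P = ∫ s in Ioc 0 R, P.real {x | q x ≤ R - s} := by
  have hint : Integrable (fun x => max (R - q x) 0) P :=
    Integrable.of_bound (Measurable.aestronglyMeasurable (by fun_prop)) R (ae_of_all _ fun x => by
      rw [Real.norm_of_nonneg (le_max_right _ _)]
      exact max_le (by linarith [hq0 x]) hR)
  rw [hint.integral_eq_integral_Ioc_meas_le (M := R) (ae_of_all _ fun x => le_max_right _ _)
    (ae_of_all _ fun x => max_le (by linarith [hq0 x]) hR)]
  refine setIntegral_congr_fun measurableSet_Ioc fun s hs => ?_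
  congr 1
  ext x
  change s ≤ max (R - q x) 0 ↔ q x ≤ R - s
  rw [le_max_iff, or_iff_left (not_le.mpr hs.1)]
  constructor <;> intro h <;> linarith

/-- Two stochastically ordered nonnegative functions with `∫ (R - q)⁺` equal have the same
distribution function on `(0, R)`. -/
theorem measureReal_le_eq_of_integral_max_eq {α : Type*} [MeasurableSpace α] {P : Measure α}
    [IsProbabilityMeasure P] {q₀ q₁ : α → ℝ} (h₀ : Measurable q₀) (h₁ : Measurable q₁)
    (h₀0 : ∀ x, 0 ≤ q₀ x) (h₁0 : ∀ x, 0 ≤ q₁ x) {R : ℝ} (hR : 0 ≤ R)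
    (hle : ∀ t, P.real {x | q₁ x ≤ t} ≤ P.real {x | q₀ x ≤ t}) :
    (∫ x, max (R - q₁ x) 0 ∂P ≤ ∫ x, max (R - q₀ x) 0 ∂P) ∧
      (∫ x, max (R - q₁ x) 0 ∂P = ∫ x, max (R - q₀ x) 0 ∂P →
        ∀ t ∈ Ioo 0 R, P.real {x | q₁ x ≤ t} = P.real {x | q₀ x ≤ t}) := by
  have hint : ∀ q : α → ℝ, IntegrableOn (fun s => P.real {x | q x ≤ R - s}) (Ioc 0 R) := by
    intro q
    have hanti : Antitone fun s => P.real {x | q x ≤ R - s} := fun s t hst =>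
      measureReal_mono (fun x (hx : q x ≤ R - t) => show q x ≤ R - s by linarith)
    exact Integrable.of_bound hanti.measurable.aestronglyMeasurable 1
      (ae_of_all _ fun s => by
        rw [Real.norm_of_nonneg measureReal_nonneg]; exact measureReal_le_one)
  rw [integral_max_sub_eq h₀ h₀0 hR, integral_max_sub_eq h₁ h₁0 hR]
  refine ⟨setIntegral_mono (hint q₁) (hint q₀) fun s => hle _, fun heq t ht => ?_⟩
  have hz : ∫ s in Ioc 0 R, (P.real {x | q₀ x ≤ R - s} - P.real {x | q₁ x ≤ R - s}) = 0 := by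
    rw [integral_sub (hint q₀) (hint q₁), heq, sub_self]
  rw [integral_eq_zero_iff_of_nonneg (fun s => sub_nonneg.mpr (hle _))
    ((hint q₀).sub (hint q₁)), EventuallyEq, ae_restrict_iff' measurableSet_Ioc] at hz
  -- Equality holds for almost every level, and both distribution functions are right-continuous.
  have hright : ∀ q : α → ℝ, Measurable q →
      Tendsto (fun t => P.real {x | q x ≤ t}) (𝓝[>] t) (𝓝 (P.real {x | q x ≤ t})) := by
    intro q hq
    have : IsProbabilityMeasure (P.map q) := Measure.isProbabilityMeasure_map hq.aemeasurable
    have hcdf : ∀ s, ProbabilityTheory.cdf (P.map q) s = P.real {x | q x ≤ s} := fun s => by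
      rw [ProbabilityTheory.cdf_eq_real, map_measureReal_apply hq measurableSet_Iic]; rfl
    have := ((ProbabilityTheory.cdf (P.map q)).right_continuous t).mono Ioi_subset_Ici_self
    rw [ContinuousWithinAt, hcdf] at this
    exact this.congr hcdf
  have hlim := (hright q₀ h₀).sub (hright q₁ h₁)
  have hfreq : ∃ᶠ u in 𝓝[>] t, P.real {x | q₀ x ≤ u} - P.real {x | q₁ x ≤ u} ∈ ({0} : Set ℝ) := by
    intro hev
    obtain ⟨u, hu, hsub⟩ := (mem_nhdsGT_iff_exists_Ioo_subset' ht.2).mp hev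
    have hnull : volume (Ioo (R - min u R) (R - t)) = 0 := by
      refine measure_mono_null (fun s hs => ?_) (ae_iff.mp hz)
      intro hcon
      have hsu : R - s ∈ Ioo t u :=
        ⟨by linarith [hs.2], by linarith [hs.1, min_le_left u R]⟩
      refine hsub hsu (hcon ⟨?_, ?_⟩)
      · linarith [hs.1, min_le_right u R]
      · linarith [hs.2, ht.1]
    rw [Real.volume_Ioo, ENNReal.ofReal_eq_zero] at hnull
    have : t < min u R := lt_min hu ht.2
    linarith
  have := isClosed_singleton.mem_of_frequently_of_tendsto hfreq hlim
  rw [mem_singleton_iff] at this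
  linarith

end Trimming

/-! ### Minimality of the covariance determinant -/

section Minimality

variable {k : ℕ}

theorem integrable_ellipticalDensity {S : Matrix (Fin k) (Fin k) ℝ} (hS : S.PosDef) (μ : Vec k)
    {h : ℝ → ℝ} (h_nonneg : ∀ t ∈ Ici (0 : ℝ), 0 ≤ h t) (h_anti : AntitoneOn h (Ici (0 : ℝ)))
    {P : Measure (Vec k)} [IsProbabilityMeasure P]
    (hP : P = volume.withDensity (fun x => ENNReal.ofReal (ellipticalDensity μ S h x))) :
    Integrable (ellipticalDensity μ S h) ∧
      ∀ s, MeasurableSet s → P.real s = ∫ x in s, ellipticalDensity μ S h x := by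
  have hm := measurable_ellipticalDensity hS μ h_anti
  have h0 : ∀ x, 0 ≤ ellipticalDensity μ S h x := fun x =>
    mul_nonneg (Real.rpow_nonneg hS.det_pos.le _) (h_nonneg _ (mahalanobisSq_nonneg hS μ x))
  constructor
  · refine ⟨hm.aestronglyMeasurable, ?_⟩
    have h1 : ∫⁻ x, ENNReal.ofReal (ellipticalDensity μ S h x) = 1 := by
      have := measure_univ (μ := P)
      rwa [hP, withDensity_apply _ MeasurableSet.univ, Measure.restrict_univ] at this
    rw [hasFiniteIntegral_iff_ofReal (ae_of_all _ h0), h1]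
    exact ENNReal.one_lt_top
  · intro s hs
    rw [Measure.real, hP, withDensity_apply _ hs,
      integral_eq_lintegral_of_nonneg_ae (ae_of_all _ h0) hm.aestronglyMeasurable]

/-- Among the ellipsoids of a given volume, the one that is a level set of the density has the
largest mass. If another ellipsoid ties, the density takes the boundary value both inside and
outside the level set, so that `h` is constant around `t`. -/
theorem measureReal_ellipsoid_le {S C : Matrix (Fin k) (Fin k) ℝ} (hS : S.PosDef) (hC : C.PosDef)
    (hdet : C.det = S.det) (μ m : Vec k)
    {h : ℝ → ℝ} (h_nonneg : ∀ t ∈ Ici (0 : ℝ), 0 ≤ h t) (h_anti : AntitoneOn h (Ici (0 : ℝ)))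
    {P : Measure (Vec k)} [IsProbabilityMeasure P]
    (hP : P = volume.withDensity (fun x => ENNReal.ofReal (ellipticalDensity μ S h x))) (t : ℝ) :
    P.real {x | mahalanobisSq m C x ≤ t} ≤ P.real {x | mahalanobisSq μ S x ≤ t} ∧
      (0 < t →
        P.real {x | mahalanobisSq m C x ≤ t} = P.real {x | mahalanobisSq μ S x ≤ t} →
        {x | mahalanobisSq μ S x ≤ t} ≠ {x | mahalanobisSq m C x ≤ t} →
        ∀ᶠ u in 𝓝 t, h u = h t) := by
  have hdS : 0 < S.det ^ (-(1 / 2) : ℝ) := Real.rpow_pos_of_pos hS.det_pos _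
  have c0 := continuous_mahalanobisSq μ S
  have c1 := continuous_mahalanobisSq m C
  have mB : MeasurableSet {x | mahalanobisSq μ S x ≤ t} :=
    (isClosed_le c0 continuous_const).measurableSet
  have mE : MeasurableSet {x | mahalanobisSq m C x ≤ t} :=
    (isClosed_le c1 continuous_const).measurableSet
  obtain ⟨hint, hreal⟩ := integrable_ellipticalDensity hS μ h_nonneg h_anti hP
  rcases lt_or_ge t 0 with ht | ht
  · have hempty : {x | mahalanobisSq m C x ≤ t} = ∅ := by
      ext x
      simpa using ht.trans_le (mahalanobisSq_nonneg hC m x)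
    refine ⟨by rw [hempty]; simp, fun h' => absurd h' (not_lt.mpr ht.le)⟩
  have hvol : volume {x | mahalanobisSq μ S x ≤ t} = volume {x | mahalanobisSq m C x ≤ t} := by
    rw [volume_mahalanobisSq_le hS, volume_mahalanobisSq_le hC, hdet]
  have hfin : volume {x | mahalanobisSq μ S x ≤ t} ≠ ⊤ := by
    rw [volume_mahalanobisSq_le hS]
    exact (ENNReal.mul_lt_top ENNReal.ofReal_lt_top (volume_normSq_le_lt_top t)).ne
  obtain ⟨hle, heq⟩ := setIntegral_le_and_ae_eq_of_volume_eq hint mB mE hvol hfin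
    (c := S.det ^ (-(1 / 2) : ℝ) * h t)
    (fun x hx => mul_le_mul_of_nonneg_left
      (h_anti (mahalanobisSq_nonneg hS μ x) ht hx) hdS.le)
    (fun x hx => mul_le_mul_of_nonneg_left
      (h_anti ht (mahalanobisSq_nonneg hS μ x) (not_le.mp hx).le) hdS.le)
  rw [hreal _ mB, hreal _ mE]
  refine ⟨hle, fun ht0 h' hne => ?_⟩
  obtain ⟨ae1, ae2⟩ := heq h'
  -- A non-empty open set is not null, so the a.e. identity holds at one of its points.
  have pick : ∀ {O A : Set (Vec k)}, IsOpen O → O.Nonempty → O ⊆ A →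
      (∀ᵐ x, x ∈ A → ellipticalDensity μ S h x = S.det ^ (-(1 / 2) : ℝ) * h t) →
      ∃ p ∈ O, h (mahalanobisSq μ S p) = h t := by
    intro O A hO hne hsub hae
    by_contra! hcon
    have hnull : O ⊆ {x | ¬(x ∈ A → ellipticalDensity μ S h x = S.det ^ (-(1 / 2) : ℝ) * h t)} :=
      fun x hx hx' => hcon x hx (mul_left_cancel₀ hdS.ne' (hx' (hsub hx)))
    exact (hO.measure_pos volume hne).ne' (measure_mono_null hnull (ae_iff.mp hae))
  have sub1 : {x | mahalanobisSq μ S x < t} ∩ {x | t < mahalanobisSq m C x} ⊆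
      {x | mahalanobisSq μ S x ≤ t} \ {x | mahalanobisSq m C x ≤ t} := fun x hx =>
    ⟨(show mahalanobisSq μ S x < t from hx.1).le,
      not_le.mpr (show t < mahalanobisSq m C x from hx.2)⟩
  have sub2 : {x | mahalanobisSq m C x < t} ∩ {x | t < mahalanobisSq μ S x} ⊆
      {x | mahalanobisSq m C x ≤ t} \ {x | mahalanobisSq μ S x ≤ t} := fun x hx =>
    ⟨(show mahalanobisSq m C x < t from hx.1).le,
      not_le.mpr (show t < mahalanobisSq μ S x from hx.2)⟩
  obtain ⟨p, hp, hpt⟩ := pick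
    ((isOpen_lt c0 continuous_const).inter (isOpen_lt continuous_const c1))
    (exists_mahalanobisSq_lt_lt ht0 hvol hfin hne)
    sub1 ae1
  obtain ⟨p', hp', hpt'⟩ := pick
    ((isOpen_lt c1 continuous_const).inter (isOpen_lt continuous_const c0))
    (exists_mahalanobisSq_lt_lt ht0 hvol.symm (hvol ▸ hfin) hne.symm)
    sub2 ae2
  have hq := mahalanobisSq_nonneg hS μ p
  filter_upwards [Ioo_mem_nhds hp.1 hp'.2] with u hu
  rcases le_total u t with hut | hut
  · refine le_antisymm ?_ (h_anti (hq.trans hu.1.le) ht hut)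
    rw [← hpt]; exact h_anti hq (hq.trans hu.1.le) hu.1.le
  · refine le_antisymm (h_anti ht (hq.trans hu.1.le) hut) ?_
    rw [← hpt']; exact h_anti (hq.trans hu.1.le) (mahalanobisSq_nonneg hS μ p') hu.2.le

/-- The covariance determinant of a trimming function is at least that of the central ellipsoid,
with equality only if mean and covariance agree. -/
theorem det_le_det_trimmedCov (hk : 0 < k) {S : Matrix (Fin k) (Fin k) ℝ} (hS : S.PosDef)
    (μ : Vec k)
    {h : ℝ → ℝ} (h_nonneg : ∀ t ∈ Ici (0 : ℝ), 0 ≤ h t) (h_anti : AntitoneOn h (Ici (0 : ℝ)))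
    {P : Measure (Vec k)} [IsProbabilityMeasure P]
    (hP : P = volume.withDensity (fun x => ENNReal.ofReal (ellipticalDensity μ S h x)))
    {γ : ℝ} (hγ : 0 < γ) {R : ℝ} (hR : 0 < R) (hkR : k ≤ R)
    (hI : ∫ x, max (R - mahalanobisSq μ S x) 0 ∂P = (R - k) * γ)
    (h_nonconst : ∃ s ∈ Ioo (0 : ℝ) R, ∃ t ∈ Ioo (0 : ℝ) R, h s ≠ h t)
    {φ : Vec k → ℝ} (hφ : IsTrimming P γ φ) :
    S.det ≤ (trimmedCov P φ).det ∧
      ((trimmedCov P φ).det = S.det → trimmedMean P φ = μ ∧ trimmedCov P φ = S) := by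
  have hac : P ≪ volume := hP ▸ withDensity_absolutelyContinuous _ _
  have hC := trimmedCov_posDef hac hγ hφ
  have hmah := integral_mahalanobisSq_mul hac hγ hφ
  set c := ∫ x, φ x ∂P with hc_def
  set C := trimmedCov P φ
  set T := trimmedMean P φ
  have hc : 0 < c := hγ.trans_le hφ.mass
  have hk' : (k : ℝ) ≠ 0 := by exact_mod_cast hk.ne'
  have hk0 : (0 : ℝ) < k := by exact_mod_cast hk
  -- `l⁻¹ C` has the same determinant as `S`
  set l : ℝ := (C.det / S.det) ^ ((k : ℝ)⁻¹) with hl_def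
  have hratio : 0 < C.det / S.det := div_pos hC.det_pos hS.det_pos
  have hl : 0 < l := Real.rpow_pos_of_pos hratio _
  have hlk : l ^ k = C.det / S.det := by
    rw [hl_def, ← Real.rpow_natCast, ← Real.rpow_mul hratio.le, inv_mul_cancel₀ hk', Real.rpow_one]
  have hC' : (l⁻¹ • C).PosDef := hC.smul (inv_pos.mpr hl)
  have hdet' : (l⁻¹ • C).det = S.det := by
    rw [Matrix.det_smul, Fintype.card_fin, inv_pow, hlk]
    field_simp [hC.det_pos.ne', hS.det_pos.ne']
  have hq1 : ∀ x, mahalanobisSq T (l⁻¹ • C) x = l * mahalanobisSq T C x := fun x => by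
    rw [mahalanobisSq_smul_matrix _ _ (inv_ne_zero hl.ne'), inv_inv]
  obtain ⟨hle, heq⟩ := measureReal_le_eq_of_integral_max_eq (P := P)
    (continuous_mahalanobisSq μ S).measurable (continuous_mahalanobisSq T (l⁻¹ • C)).measurable
    (mahalanobisSq_nonneg hS μ) (mahalanobisSq_nonneg hC' T) hR.le
    (fun t => (measureReal_ellipsoid_le hS hC' hdet' μ T h_nonneg h_anti hP t).1)
  have hupper : R * c - l * (c * k) ≤ ∫ x, max (R - mahalanobisSq T (l⁻¹ • C) x) 0 ∂P := by
    have e : R * c - l * (c * k) = ∫ x, (R * φ x - l * (mahalanobisSq T C x * φ x)) ∂P := by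
      rw [integral_sub (hφ.integrable.const_mul R)
        ((integrable_mahalanobisSq_mul hφ T C).const_mul l), integral_const_mul,
        integral_const_mul, hmah]
    rw [e]
    have hmeas := (continuous_mahalanobisSq T (l⁻¹ • C)).measurable
    refine integral_mono ((hφ.integrable.const_mul R).sub
        ((integrable_mahalanobisSq_mul hφ T C).const_mul l))
      (Integrable.of_bound (Measurable.aestronglyMeasurable (by fun_prop)) R
        (ae_of_all _ fun x => ?_)) fun x => ?_
    · rw [Real.norm_of_nonneg (le_max_right _ _)]
      exact max_le (by linarith [mahalanobisSq_nonneg hC' T x]) hR.le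
    · have h01 := hφ.mem_Icc x
      simp only [hq1]
      calc R * φ x - l * (mahalanobisSq T C x * φ x)
          = (R - l * mahalanobisSq T C x) * φ x := by ring
        _ ≤ max (R - l * mahalanobisSq T C x) 0 * φ x :=
          mul_le_mul_of_nonneg_right (le_max_left _ _) h01.1
        _ ≤ max (R - l * mahalanobisSq T C x) 0 :=
          mul_le_of_le_one_right (le_max_right _ _) h01.2
  have hcγ : γ ≤ c := hφ.mass
  have hprod : 0 ≤ (c - γ) * (R - k) := mul_nonneg (by linarith) (by linarith)
  have hl1 : 1 ≤ l := by
    have : c * k ≤ l * (c * k) := by linarith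
    exact (le_mul_iff_one_le_left (by positivity)).mp this
  refine ⟨?_, fun hdet => ?_⟩
  · have : 1 ≤ C.det / S.det := hlk ▸ one_le_pow₀ hl1
    rwa [one_le_div hS.det_pos] at this
  have hl_one : l = 1 := by rw [hl_def, hdet, div_self hS.det_pos.ne', Real.one_rpow]
  have hCl : l⁻¹ • C = C := by rw [hl_one, inv_one, one_smul]
  have hall := heq (le_antisymm hle (by
    have h1 : l * (c * k) = c * k := by rw [hl_one, one_mul]
    rw [hI]; linarith))
  rw [hCl] at hall hC' hdet'
  -- Either the two ellipsoids agree at some level, or `h` is locally constant on `(0, R)`.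
  by_cases hex : ∃ t ∈ Ioo 0 R, {x | mahalanobisSq μ S x ≤ t} = {x | mahalanobisSq T C x ≤ t}
  · obtain ⟨t, ht, hset⟩ := hex
    exact eq_of_mahalanobisSq_le_eq hk hS hC ht.1 hset
  · push Not at hex
    have hloc : ∀ t ∈ Ioo 0 R, HasDerivAt h 0 t := fun t ht =>
      (hasDerivAt_const t (h t)).congr_of_eventuallyEq
        ((measureReal_ellipsoid_le hS hC hdet μ T h_nonneg h_anti hP t).2 ht.1 (hall t ht)
          (hex t ht))
    obtain ⟨s, hs, t, ht, hst⟩ := h_nonconst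
    exact absurd (isOpen_Ioo.is_const_of_deriv_eq_zero isPreconnected_Ioo
      (fun u hu => (hloc u hu).differentiableAt.differentiableWithinAt)
      (fun u hu => (hloc u hu).deriv) hs ht) hst

end Minimality

/-! ### Moments of rotation invariant measures -/

section Moments

variable {k : ℕ}

/-- A measure on `ℝᵏ` that is invariant under all linear isometries. -/
def RotationInvariant (ν : Measure (Vec k)) : Prop :=
  ∀ U : Vec k ≃ₗᵢ[ℝ] Vec k, MeasurePreserving U ν ν

variable {ν : Measure (Vec k)}

theorem RotationInvariant.integral_comp (hν : RotationInvariant ν) (U : Vec k ≃ₗᵢ[ℝ] Vec k)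
    (g : Vec k → ℝ) : ∫ x, g (U x) ∂ν = ∫ x, g x ∂ν :=
  (hν U).integral_comp U.toHomeomorph.measurableEmbedding g

theorem RotationInvariant.integral_eq_zero (hν : RotationInvariant ν) (U : Vec k ≃ₗᵢ[ℝ] Vec k)
    {g : Vec k → ℝ} (hg : ∀ x, g (U x) = -g x) : ∫ x, g x ∂ν = 0 := by
  have h := hν.integral_comp U g
  simp_rw [hg] at h
  rw [integral_neg] at h
  linarith

/-- The reflection in the line spanned by `a eᵢ + b eⱼ`. -/
theorem exists_reflection {i j : Fin k} (hij : i ≠ j) (a b : ℝ) :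
    ∃ U : Vec k ≃ₗᵢ[ℝ] Vec k, ∀ x l, U x l =
      2 * ((a * x i + b * x j) / (a ^ 2 + b ^ 2)) * (if l = i then a else if l = j then b else 0)
        - x l := by
  let u : Vec k := EuclideanSpace.single i a + EuclideanSpace.single j b
  have hu : ∀ l, u l = if l = i then a else if l = j then b else 0 := by
    intro l
    simp only [u, PiLp.add_apply, PiLp.single_apply]
    by_cases h1 : l = i
    · subst h1; simp [hij]
    · simp [h1]
  have hnorm : ‖u‖ ^ 2 = a ^ 2 + b ^ 2 := by
    rw [EuclideanSpace.real_norm_sq_eq]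
    simp_rw [hu]
    rw [← Finset.add_sum_erase _ _ (Finset.mem_univ i),
      ← Finset.add_sum_erase _ _ (Finset.mem_erase.mpr ⟨hij.symm, Finset.mem_univ j⟩),
      Finset.sum_eq_zero]
    · simp [hij.symm]
    · intro l hl
      simp only [Finset.mem_erase] at hl
      simp [hl.1, hl.2.1]
  have hinner : ∀ x : Vec k, inner ℝ u x = a * x i + b * x j := by
    intro x
    simp [u, inner_add_left, EuclideanSpace.inner_single_left]
  refine ⟨(ℝ ∙ u).reflection, fun x l => ?_⟩
  rw [Submodule.reflection_singleton_apply, hinner]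
  simp only [RCLike.ofReal_real_eq_id, id, hnorm, PiLp.sub_apply, PiLp.smul_apply, hu, smul_eq_mul,
    nsmul_eq_mul, Nat.cast_ofNat]
  ring

theorem integrable_of_continuous_of_norm_le [IsFiniteMeasure ν] {b : ℝ}
    (hb : ∀ᵐ x ∂ν, ‖x‖ ≤ b) {E : Type*} [NormedAddCommGroup E] {g : Vec k → E}
    (hg : Continuous g) : Integrable g ν := by
  obtain ⟨C, hC⟩ := (isCompact_closedBall (0 : Vec k) b).exists_bound_of_continuousOn
    hg.continuousOn
  refine Integrable.of_bound hg.aestronglyMeasurable C ?_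
  filter_upwards [hb] with x hx
  exact hC x (by simpa using hx)

theorem RotationInvariant.integral_mul (hν : RotationInvariant ν) [IsFiniteMeasure ν] {b : ℝ}
    (hb : ∀ᵐ x ∂ν, ‖x‖ ≤ b) (i j : Fin k) :
    ∫ x, x i * x j ∂ν = if i = j then (∫ x, ‖x‖ ^ 2 ∂ν) / k else 0 := by
  have hk : (k : ℝ) ≠ 0 := by
    have := i.pos
    exact_mod_cast this.ne'
  split_ifs with hij
  · subst hij
    have hsame : ∀ l, ∫ x, x l * x l ∂ν = ∫ x, x i * x i ∂ν := by
      intro l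
      rcases eq_or_ne i l with rfl | hil
      · rfl
      obtain ⟨U, hU⟩ := exists_reflection hil 1 1
      rw [← hν.integral_comp U]
      refine integral_congr_ae (ae_of_all _ fun x => ?_)
      simp only [hU, if_neg hil.symm, if_true]; ring
    have hsum : ∫ x, ‖x‖ ^ 2 ∂ν = ∑ l, ∫ x, x l * x l ∂ν := by
      rw [← integral_finsetSum _ fun l _ => integrable_of_continuous_of_norm_le hb (by fun_prop)]
      refine integral_congr_ae (ae_of_all _ fun x => ?_)
      simp only [EuclideanSpace.real_norm_sq_eq]
      exact Finset.sum_congr rfl fun l _ => sq _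
    rw [hsum]
    simp_rw [hsame]
    simp [hk]
  · obtain ⟨U, hU⟩ := exists_reflection hij 1 0
    refine hν.integral_eq_zero U fun x => ?_
    simp only [hU, if_neg (Ne.symm hij), if_true]; ring

/-- The fourth moments of a rotation invariant measure are those of an isotropic tensor. -/
theorem RotationInvariant.integral_mul_mul_mul (hν : RotationInvariant ν) [IsFiniteMeasure ν]
    {b : ℝ} (hb : ∀ᵐ x ∂ν, ‖x‖ ≤ b) (i j l m : Fin k) :
    ∫ x, x i * x j * x l * x m ∂ν = (∫ x, ‖x‖ ^ 4 ∂ν) / (k * (k + 2)) *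
      ((if i = j then 1 else 0) * (if l = m then 1 else 0)
        + (if i = l then 1 else 0) * (if j = m then 1 else 0)
        + (if i = m then 1 else 0) * (if j = l then 1 else 0)) := by
  have hk : (0 : ℝ) < k := by
    have := i.pos
    exact_mod_cast this
  -- An index that differs from the three others makes the integrand odd under a reflection.
  have hodd : ∀ p q s t : Fin k, p ≠ q → p ≠ s → p ≠ t →
      ∫ x, x p * x q * x s * x t ∂ν = 0 := by
    intro p q s t h1 h2 h3
    obtain ⟨U, hU⟩ := exists_reflection h1 1 0
    refine hν.integral_eq_zero U fun x => ?_
    simp only [hU]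
    by_cases hs : s = q <;> by_cases ht : t = q <;>
      simp only [hs, ht, if_true, if_neg h1.symm, if_neg h2.symm, if_neg h3.symm, if_false] <;>
      ring
  have hfour : ∀ p q : Fin k, ∫ x, x q ^ 4 ∂ν = ∫ x, x p ^ 4 ∂ν := by
    intro p q
    rcases eq_or_ne p q with rfl | hpq
    · rfl
    obtain ⟨U, hU⟩ := exists_reflection hpq 1 1
    rw [← hν.integral_comp U]
    refine integral_congr_ae (ae_of_all _ fun x => ?_)
    simp only [hU, if_neg hpq.symm, if_true]; ring
  have h31 : ∀ p q : Fin k, p ≠ q → ∫ x, x p ^ 3 * x q ∂ν = 0 := by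
    intro p q hpq
    rw [← hodd q p p p hpq.symm hpq.symm hpq.symm]
    refine integral_congr_ae (ae_of_all _ fun x => ?_)
    simp only; ring
  -- The reflection in the line through `2 eₚ + e_q` has the rational entries `±3/5` and `4/5`,
  -- and expanding the fourth power relates the pure to the mixed moments.
  have htwo : ∀ p q : Fin k, p ≠ q → ∫ x, x p ^ 4 ∂ν = 3 * ∫ x, x p ^ 2 * x q ^ 2 ∂ν := by
    intro p q hpq
    obtain ⟨U, hU⟩ := exists_reflection hpq 2 1
    have h1 := hν.integral_comp U fun x => x p ^ 4
    have h2 : ∀ x : Vec k, (U x) p ^ 4 = 81 / 625 * x p ^ 4 + 432 / 625 * (x p ^ 3 * x q)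
        + 864 / 625 * (x p ^ 2 * x q ^ 2) + 768 / 625 * (x q ^ 3 * x p) + 256 / 625 * x q ^ 4 := by
      intro x
      rw [hU, if_pos rfl]; ring
    have c1 : Integrable (fun x : Vec k => 81 / 625 * x p ^ 4) ν :=
      integrable_of_continuous_of_norm_le hb (by fun_prop)
    have c2 : Integrable (fun x : Vec k => 432 / 625 * (x p ^ 3 * x q)) ν :=
      integrable_of_continuous_of_norm_le hb (by fun_prop)
    have c3 : Integrable (fun x : Vec k => 864 / 625 * (x p ^ 2 * x q ^ 2)) ν :=
      integrable_of_continuous_of_norm_le hb (by fun_prop)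
    have c4 : Integrable (fun x : Vec k => 768 / 625 * (x q ^ 3 * x p)) ν :=
      integrable_of_continuous_of_norm_le hb (by fun_prop)
    have c5 : Integrable (fun x : Vec k => 256 / 625 * x q ^ 4) ν :=
      integrable_of_continuous_of_norm_le hb (by fun_prop)
    have d2 : Integrable (fun x : Vec k => 81 / 625 * x p ^ 4 + 432 / 625 * (x p ^ 3 * x q)) ν :=
      c1.add c2
    have d3 : Integrable (fun x : Vec k => 81 / 625 * x p ^ 4 + 432 / 625 * (x p ^ 3 * x q)
        + 864 / 625 * (x p ^ 2 * x q ^ 2)) ν := d2.add c3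
    have d4 : Integrable (fun x : Vec k => 81 / 625 * x p ^ 4 + 432 / 625 * (x p ^ 3 * x q)
        + 864 / 625 * (x p ^ 2 * x q ^ 2) + 768 / 625 * (x q ^ 3 * x p)) ν := d3.add c4
    simp_rw [h2] at h1
    rw [integral_add d4 c5, integral_add d3 c4, integral_add d2 c3, integral_add c1 c2] at h1
    simp only [integral_const_mul] at h1
    rw [h31 p q hpq, h31 q p hpq.symm, hfour p q] at h1
    linarith
  have hsum : ∫ x, ‖x‖ ^ 4 ∂ν = ∑ p, ∑ q, ∫ x, x p ^ 2 * x q ^ 2 ∂ν := by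
    have e : ∀ x : Vec k, ‖x‖ ^ 4 = ∑ p, ∑ q, x p ^ 2 * x q ^ 2 := by
      intro x
      rw [← Finset.sum_mul_sum, ← EuclideanSpace.real_norm_sq_eq]; ring
    simp_rw [e]
    have hI2 : ∀ p q : Fin k, Integrable (fun x : Vec k => x p ^ 2 * x q ^ 2) ν := fun p q =>
      integrable_of_continuous_of_norm_le hb (by fun_prop)
    rw [integral_finsetSum _ fun p _ => integrable_finsetSum _ fun q _ => hI2 p q]
    exact Finset.sum_congr rfl fun p _ => integral_finsetSum _ fun q _ => hI2 p q
  set Q := ∫ x, x i ^ 4 ∂ν with hQ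
  have hpq : ∀ p q : Fin k, ∫ x, x p ^ 2 * x q ^ 2 ∂ν = Q / 3 * (1 + if p = q then 2 else 0) := by
    intro p q
    split_ifs with h
    · subst h
      rw [hQ, ← hfour i p]
      have : ∀ x : Vec k, x p ^ 2 * x p ^ 2 = x p ^ 4 := fun x => by ring
      simp_rw [this]; ring
    · have := htwo p q h
      rw [hfour i p] at this
      linarith
  have hm22 : (∫ x, ‖x‖ ^ 4 ∂ν) / (k * (k + 2)) = Q / 3 := by
    rw [hsum]
    simp_rw [hpq]
    simp only [← Finset.mul_sum, Finset.sum_add_distrib, Finset.sum_ite_eq, Finset.mem_univ,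
      if_true, Finset.sum_const, Finset.card_univ, Fintype.card_fin, nsmul_eq_mul]
    field_simp
  rw [hm22]
  have hpair : ∀ p q : Fin k, p ≠ q → ∫ x, x p ^ 2 * x q ^ 2 ∂ν = Q / 3 := fun p q h => by
    rw [hpq, if_neg h]; ring
  have hself : ∀ p, ∫ x, x p ^ 4 ∂ν = Q := fun p => hfour i p
  have hperm : ∀ {g g' : Vec k → ℝ} {c : ℝ}, (∀ x, g x = g' x) → ∫ x, g' x ∂ν = c →
      ∫ x, g x ∂ν = c := fun hg h => by simp_rw [hg]; exact h
  by_cases h1 : i = j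
  · subst h1
    by_cases h2 : l = m
    · subst h2
      by_cases h3 : i = l
      · subst h3
        rw [hperm (g' := fun x => x i ^ 4) (fun x => by ring) (hself i)]
        simp; ring
      · rw [hperm (g' := fun x => x i ^ 2 * x l ^ 2) (fun x => by ring) (hpair i l h3)]
        simp [h3]
    · by_cases h3 : l = i
      · subst h3
        rw [hperm (g' := fun x => x m * x l * x l * x l) (fun x => by ring)
          (hodd m l l l (Ne.symm h2) (Ne.symm h2) (Ne.symm h2))]
        simp [h2]
      · rw [hperm (g' := fun x => x l * x i * x i * x m) (fun x => by ring)
          (hodd l i i m h3 h3 h2)]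
        simp [h2, Ne.symm h3]
  · by_cases h2 : i = l
    · subst h2
      by_cases h3 : j = m
      · subst h3
        rw [hperm (g' := fun x => x i ^ 2 * x j ^ 2) (fun x => by ring) (hpair i j h1)]
        simp [h1]
      · rw [hperm (g' := fun x => x j * x i * x i * x m) (fun x => by ring)
          (hodd j i i m (Ne.symm h1) (Ne.symm h1) h3)]
        simp [h1, h3, Ne.symm h1]
    · by_cases h3 : i = m
      · subst h3
        by_cases h4 : j = l
        · subst h4
          rw [hperm (g' := fun x => x i ^ 2 * x j ^ 2) (fun x => by ring) (hpair i j h1)]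
          simp [h1]
        · rw [hperm (g' := fun x => x j * x i * x l * x i) (fun x => by ring)
            (hodd j i l i (Ne.symm h1) h4 (Ne.symm h1))]
          simp [h1, h2, h4]
      · rw [hodd i j l m h1 h2 h3]
        simp [h1, h2, h3]

end Moments

/-! ### Polar coordinates and radial measures -/

section Polar

variable {k : ℕ}

/-- The surface area of the unit sphere of `ℝᵏ`. -/
def sphereArea (k : ℕ) : ℝ := (volume : Measure (Vec k)).toSphere.real univ

theorem sphereArea_eq (hk : 0 < k) :
    sphereArea k = 2 * Real.pi ^ ((k : ℝ) / 2) / Real.Gamma ((k : ℝ) / 2) := by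
  have : Nonempty (Fin k) := ⟨⟨0, hk⟩⟩
  have hk' : (0 : ℝ) < k := by exact_mod_cast hk
  have hG : 0 < Real.Gamma ((k : ℝ) / 2) := Real.Gamma_pos_of_pos (by positivity)
  rw [sphereArea, Measure.toSphere_real_apply_univ, Measure.real, EuclideanSpace.volume_ball,
    Real.Gamma_add_one (by positivity)]
  simp only [ENNReal.ofReal_one, one_pow, one_mul, Fintype.card_fin, finrank_euclideanSpace]
  rw [ENNReal.toReal_ofReal (by positivity), Real.sqrt_eq_rpow, ← Real.rpow_natCast,
    ← Real.rpow_mul Real.pi_pos.le]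
  field_simp

theorem sphereArea_pos (hk : 0 < k) : 0 < sphereArea k := by
  have hk' : (0 : ℝ) < k := by exact_mod_cast hk
  rw [sphereArea_eq hk]
  have : 0 < Real.Gamma ((k : ℝ) / 2) := Real.Gamma_pos_of_pos (by positivity)
  positivity

/-- The surface measure of the unit sphere, as a measure on `ℝᵏ`. -/
def unitSphereMeasure (k : ℕ) : Measure (Vec k) :=
  ((volume : Measure (Vec k)).toSphere).map (fun ω : Metric.sphere (0 : Vec k) 1 => (ω : Vec k))

instance : IsFiniteMeasure (unitSphereMeasure k) := by
  unfold unitSphereMeasure; infer_instance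

theorem measurableEmbedding_sphere_coe :
    MeasurableEmbedding (fun ω : Metric.sphere (0 : Vec k) 1 => (ω : Vec k)) :=
  MeasurableEmbedding.subtype_coe Metric.isClosed_sphere.measurableSet

theorem integral_unitSphereMeasure (g : Vec k → ℝ) :
    ∫ ω, g ω ∂(unitSphereMeasure k) = ∫ ω, g (ω : Vec k) ∂(volume : Measure (Vec k)).toSphere :=
  measurableEmbedding_sphere_coe.integral_map _

theorem ae_norm_eq_one_unitSphereMeasure : ∀ᵐ x ∂(unitSphereMeasure k), ‖x‖ = 1 := by
  rw [unitSphereMeasure, measurableEmbedding_sphere_coe.ae_map_iff]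
  exact ae_of_all _ fun ω => by simp

theorem ae_norm_le_one_unitSphereMeasure : ∀ᵐ x ∂(unitSphereMeasure k), ‖x‖ ≤ 1 :=
  ae_norm_eq_one_unitSphereMeasure.mono fun _ h => h.le

theorem integral_norm_pow_unitSphereMeasure (n : ℕ) :
    ∫ ω, ‖ω‖ ^ n ∂(unitSphereMeasure k) = sphereArea k := by
  rw [integral_unitSphereMeasure]
  simp [sphereArea]

open scoped Pointwise in
/-- The surface measure of a set on the sphere is, up to a factor, the volume of the cone over it,
which isometries preserve. -/
theorem rotationInvariant_unitSphereMeasure : RotationInvariant (unitSphereMeasure k) := by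
  intro U
  refine ⟨U.continuous.measurable, ?_⟩
  ext s hs
  have hpre : ∀ A : Set (Vec k), Subtype.val ''
      ((fun ω : Metric.sphere (0 : Vec k) 1 => (ω : Vec k)) ⁻¹' A) = A ∩ Metric.sphere 0 1 :=
    fun A => by rw [Set.image_preimage_eq_inter_range, Subtype.range_coe]
  rw [Measure.map_apply U.continuous.measurable hs, unitSphereMeasure,
    measurableEmbedding_sphere_coe.map_apply, measurableEmbedding_sphere_coe.map_apply,
    Measure.toSphere_apply' _ (measurableEmbedding_sphere_coe.measurable hs),
    Measure.toSphere_apply' _ (measurableEmbedding_sphere_coe.measurable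
      (U.continuous.measurable hs)), hpre, hpre]
  congr 1
  rw [← U.measurePreserving.measure_preimage_emb U.toHomeomorph.measurableEmbedding
    (Ioo (0 : ℝ) 1 • (s ∩ Metric.sphere (0 : Vec k) 1))]
  congr 1
  ext x
  simp only [Set.mem_smul, mem_preimage, mem_inter_iff, mem_sphere_zero_iff_norm]
  constructor
  · rintro ⟨t, ht, y, ⟨hy, hy1⟩, rfl⟩
    exact ⟨t, ht, U y, ⟨hy, by simpa using hy1⟩, by simp⟩
  · rintro ⟨t, ht, y, ⟨hy, hy1⟩, hty⟩
    refine ⟨t, ht, U.symm y, ⟨by simpa using hy, by simpa using hy1⟩, ?_⟩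
    apply U.injective
    rw [← hty]; simp

theorem integral_polar (hk : 0 < k) {F : Vec k → ℝ} (hF : Integrable F) :
    ∫ x, F x = ∫ ω : Metric.sphere (0 : Vec k) 1,
      (∫ t in Ioi (0 : ℝ), t ^ (k - 1) * F (t • (ω : Vec k)))
        ∂(volume : Measure (Vec k)).toSphere := by
  have : Nonempty (Fin k) := ⟨⟨0, hk⟩⟩
  have hmp := (volume : Measure (Vec k)).measurePreserving_homeomorphUnitSphereProd
  let g : Metric.sphere (0 : Vec k) 1 × Ioi (0 : ℝ) → ℝ := fun p => F ((p.2 : ℝ) • (p.1 : Vec k))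
  have hg : ∀ x : ({0}ᶜ : Set (Vec k)), g (homeomorphUnitSphereProd (Vec k) x) = F x := by
    intro x
    have hx : ‖(x : Vec k)‖ ≠ 0 := norm_ne_zero_iff.mpr x.2
    simp [g, smul_smul, hx]
  have h1 : ∫ x, F x = ∫ x : ({0}ᶜ : Set (Vec k)), F x
      ∂((volume : Measure (Vec k)).comap (↑)) := by
    rw [integral_subtype_comap (measurableSet_singleton _).compl fun x => F x,
      restrict_compl_singleton]
  have hint : Integrable g ((volume : Measure (Vec k)).toSphere.prod
      (Measure.volumeIoiPow (Module.finrank ℝ (Vec k) - 1))) := by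
    rw [← hmp.integrable_comp_emb (Homeomorph.measurableEmbedding _)]
    have : g ∘ homeomorphUnitSphereProd (Vec k) = fun x : ({0}ᶜ : Set (Vec k)) => F x := funext hg
    rw [this]
    have h2 : IntegrableOn F ({0}ᶜ : Set (Vec k)) := hF.integrableOn
    rwa [integrableOn_iff_comap_subtypeVal (measurableSet_singleton _).compl] at h2
  rw [h1, ← integral_congr_ae (ae_of_all _ hg),
    hmp.integral_comp (Homeomorph.measurableEmbedding _) g, integral_prod _ hint]
  refine integral_congr_ae (ae_of_all _ fun ω => ?_)
  simp only [Measure.volumeIoiPow, ENNReal.ofReal, finrank_euclideanSpace, Fintype.card_fin, g]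
  rw [integral_withDensity_eq_integral_smul
      ((measurable_subtype_coe.pow_const _).real_toNNReal),
    integral_subtype_comap measurableSet_Ioi fun a : ℝ =>
      Real.toNNReal (a ^ (k - 1)) • F (a • (ω : Vec k))]
  refine setIntegral_congr_fun measurableSet_Ioi fun t ht => ?_
  simp only [NNReal.smul_def, Real.coe_toNNReal _ (pow_nonneg (le_of_lt (mem_Ioi.mp ht)) _),
    smul_eq_mul]

variable {h : ℝ → ℝ}

theorem integral_radialMeasure (h_nonneg : ∀ t ∈ Ici (0 : ℝ), 0 ≤ h t)
    (h_anti : AntitoneOn h (Ici (0 : ℝ))) (F : Vec k → ℝ) :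
    ∫ z, F z ∂(radialMeasure k h) = ∫ z, h (‖z‖ ^ 2) * F z := by
  rw [radialMeasure, integral_withDensity_eq_integral_toReal_smul
    (measurable_radialDensity h_anti).ennreal_ofReal (ae_of_all _ fun _ => ENNReal.ofReal_lt_top)]
  refine integral_congr_ae (ae_of_all _ fun z => ?_)
  simp only [smul_eq_mul]
  rw [ENNReal.toReal_ofReal (h_nonneg _ (mem_Ici.mpr (sq_nonneg _)))]

theorem setIntegral_norm_radialMeasure (hk : 0 < k) (h_nonneg : ∀ t ∈ Ici (0 : ℝ), 0 ≤ h t)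
    (h_anti : AntitoneOn h (Ici (0 : ℝ))) (g : ℝ → ℝ) {s : ℝ} (hs : 0 ≤ s) :
    ∫ z in Metric.closedBall 0 s, g ‖z‖ ∂(radialMeasure k h)
      = sphereArea k * ∫ t in (0 : ℝ)..s, h (t ^ 2) * t ^ (k - 1) * g t := by
  have : Nonempty (Fin k) := ⟨⟨0, hk⟩⟩
  rw [← integral_indicator Metric.isClosed_closedBall.measurableSet,
    integral_radialMeasure h_nonneg h_anti]
  have e : ∀ z : Vec k,
      h (‖z‖ ^ 2) * (Metric.closedBall (0 : Vec k) s).indicator (fun z => g ‖z‖) z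
      = (fun t : ℝ => h (t ^ 2) * (Iic s).indicator g t) ‖z‖ := by
    intro z
    by_cases hz : ‖z‖ ≤ s <;> simp [indicator, hz]
  simp_rw [e]
  rw [integral_fun_norm_addHaar volume (fun t : ℝ => h (t ^ 2) * (Iic s).indicator g t),
    sphereArea, Measure.toSphere_real_apply_univ]
  simp only [nsmul_eq_mul, smul_eq_mul, mul_assoc]
  congr 2
  rw [intervalIntegral.integral_of_le hs, ← Ioi_inter_Iic,
    ← setIntegral_indicator measurableSet_Iic]
  refine setIntegral_congr_fun measurableSet_Ioi fun t _ => ?_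
  simp only [finrank_euclideanSpace, Fintype.card_fin]
  by_cases ht : t ≤ s
  · simp [indicator, ht]; ring
  · simp [indicator, ht]

theorem rotationInvariant_radialMeasure :
    RotationInvariant (radialMeasure k h) := by
  intro U
  refine ⟨U.continuous.measurable, ?_⟩
  ext s hs
  rw [Measure.map_apply U.continuous.measurable hs, radialMeasure, withDensity_apply _ hs,
    withDensity_apply _ (U.continuous.measurable hs),
    ← U.measurePreserving.setLIntegral_comp_preimage_emb U.toHomeomorph.measurableEmbedding
      (fun z => ENNReal.ofReal (h (‖z‖ ^ 2))) s]
  simp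

theorem rotationInvariant_radialMeasure_restrict (s : ℝ) :
    RotationInvariant ((radialMeasure k h).restrict (Metric.closedBall 0 s)) := by
  intro U
  have h1 := (rotationInvariant_radialMeasure (k := k) (h := h) U).restrict_preimage
    (s := Metric.closedBall 0 s) Metric.isClosed_closedBall.measurableSet
  have h2 : U ⁻¹' Metric.closedBall 0 s = Metric.closedBall 0 s := by
    ext x; simp
  rwa [h2] at h1

theorem ae_restrict_closedBall_norm_le (ν : Measure (Vec k)) (s : ℝ) :
    ∀ᵐ z ∂ν.restrict (Metric.closedBall 0 s), ‖z‖ ≤ s := by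
  filter_upwards [ae_restrict_mem Metric.isClosed_closedBall.measurableSet] with z hz
  simpa using hz

end Polar

/-! ### Standardized radial profiles -/

section Profile

variable {k : ℕ} {h : ℝ → ℝ} {r γ : ℝ}

/-- A non-increasing radial profile `h` on `ℝᵏ`, scaled so that the ball of radius `r` has mass `γ`
and the distribution `h(‖z‖²) dz` restricted to it has second moment matrix `γ I`. -/
structure StandardProfile (k : ℕ) (h : ℝ → ℝ) (r γ : ℝ) : Prop where
  dim_pos : 0 < k
  mass_pos : 0 < γ
  radius_pos : 0 < r
  nonneg : ∀ t ∈ Ici (0 : ℝ), 0 ≤ h t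
  anti : AntitoneOn h (Ici (0 : ℝ))
  regular : ∀ᶠ t in 𝓝 (r ^ 2), ContinuousAt h t ∧ 0 < h t
  nonconst : ∃ s ∈ Ioo (0 : ℝ) (r ^ 2), ∃ t ∈ Ioo (0 : ℝ) (r ^ 2), h s ≠ h t
  mass : sphereArea k * ∫ t in (0 : ℝ)..r, h (t ^ 2) * t ^ (k - 1) = γ
  second_moment : sphereArea k * ∫ t in (0 : ℝ)..r, h (t ^ 2) * t ^ (k - 1) * t ^ 2 = k * γ

theorem intervalIntegrable_profile_mul (h_anti : AntitoneOn h (Ici (0 : ℝ))) {g : ℝ → ℝ}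
    (hg : Continuous g) {a b : ℝ} (ha : 0 ≤ a) (hb : 0 ≤ b) :
    IntervalIntegrable (fun t => h (t ^ 2) * g t) volume a b := by
  have hanti : AntitoneOn (fun t => h (t ^ 2)) (uIcc a b) := by
    intro s hs t ht hst
    have hs0 : 0 ≤ s := (le_min ha hb).trans hs.1
    exact h_anti (mem_Ici.mpr (sq_nonneg _)) (mem_Ici.mpr (sq_nonneg _))
      (pow_le_pow_left₀ hs0 hst 2)
  exact hanti.intervalIntegrable.mul_continuousOn hg.continuousOn

/-- A non-increasing profile that is not constant on `(0, r²)` has larger moments on `(0, r)` than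
its value at `r²`. -/
theorem pow_div_lt_integral_profile (h_anti : AntitoneOn h (Ici (0 : ℝ))) (hr : 0 < r)
    (h_nonconst : ∃ s ∈ Ioo (0 : ℝ) (r ^ 2), ∃ t ∈ Ioo (0 : ℝ) (r ^ 2), h s ≠ h t) (n : ℕ) :
    h (r ^ 2) * (r ^ (n + 1) / (n + 1)) < ∫ t in (0 : ℝ)..r, h (t ^ 2) * t ^ n := by
  obtain ⟨s, hs, hlt⟩ : ∃ s ∈ Ioo (0 : ℝ) (r ^ 2), h (r ^ 2) < h s := by
    by_contra! hcon
    have hconst : ∀ s ∈ Ioo (0 : ℝ) (r ^ 2), h s = h (r ^ 2) := fun s hs =>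
      le_antisymm (hcon s hs) (h_anti hs.1.le (mem_Ici.mpr (sq_nonneg _)) hs.2.le)
    obtain ⟨s, hs, t, ht, hst⟩ := h_nonconst
    exact hst ((hconst s hs).trans (hconst t ht).symm)
  have e : h (r ^ 2) * (r ^ (n + 1) / (n + 1)) = ∫ t in (0 : ℝ)..r, h (r ^ 2) * t ^ n := by
    rw [intervalIntegral.integral_const_mul, integral_pow]; simp
  rw [e]
  refine intervalIntegral.integral_lt_integral_of_ae_le_of_measure_setOfPred_lt_ne_zero hr.le
    ((continuous_const.mul (continuous_pow n)).intervalIntegrable _ _)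
    (intervalIntegrable_profile_mul h_anti (continuous_pow n) le_rfl hr.le) ?_ ?_
  · filter_upwards [ae_restrict_mem measurableSet_Ioc] with t ht
    exact mul_le_mul_of_nonneg_right (h_anti (mem_Ici.mpr (sq_nonneg _))
      (mem_Ici.mpr (sq_nonneg _)) (pow_le_pow_left₀ ht.1.le ht.2 2)) (pow_nonneg ht.1.le n)
  · have hsr : √s < r := (Real.sqrt_lt' hr).mpr hs.2
    have hsub : Ioo 0 (√s) ⊆ {t | h (r ^ 2) * t ^ n < h (t ^ 2) * t ^ n} ∩ Ioc 0 r := by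
      intro t ht
      refine ⟨mul_lt_mul_of_pos_right (hlt.trans_le ?_) (pow_pos ht.1 n), ht.1,
        (ht.2.trans hsr).le⟩
      refine h_anti (mem_Ici.mpr (sq_nonneg _)) hs.1.le ?_
      rw [← Real.sq_sqrt hs.1.le]
      exact pow_le_pow_left₀ ht.1.le ht.2.le 2
    rw [Measure.restrict_apply' measurableSet_Ioc]
    refine fun hz => ?_
    have := measure_mono_null hsub hz
    rw [Real.volume_Ioo, ENNReal.ofReal_eq_zero] at this
    have := Real.sqrt_pos.mpr hs.1
    linarith

namespace StandardProfile

theorem profile_pos (H : StandardProfile k h r γ) : 0 < h (r ^ 2) := H.regular.self_of_nhds.2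

theorem area_lt (H : StandardProfile k h r γ) : sphereArea k * h (r ^ 2) * r ^ k < k * γ := by
  have h1 := pow_div_lt_integral_profile H.anti H.radius_pos H.nonconst (k - 1)
  have hk : (0 : ℝ) < k := by exact_mod_cast H.dim_pos
  have hcast : ((k - 1 : ℕ) : ℝ) + 1 = k := by
    rw [Nat.cast_pred H.dim_pos]; ring
  rw [Nat.sub_add_cancel H.dim_pos, hcast] at h1
  have h2 := mul_lt_mul_of_pos_left h1 (sphereArea_pos H.dim_pos)
  rw [H.mass] at h2
  calc sphereArea k * h (r ^ 2) * r ^ k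
      = k * (sphereArea k * (h (r ^ 2) * (r ^ k / k))) := by field_simp
    _ < k * γ := by gcongr

theorem area_mul_sq_lt (H : StandardProfile k h r γ) :
    sphereArea k * h (r ^ 2) * r ^ (k + 2) < k * (k + 2) * γ := by
  have h1 := pow_div_lt_integral_profile H.anti H.radius_pos H.nonconst (k - 1 + 2)
  have hk : (0 : ℝ) < k := by exact_mod_cast H.dim_pos
  have hcast : ((k - 1 + 2 : ℕ) : ℝ) + 1 = k + 2 := by
    push_cast; rw [Nat.cast_pred H.dim_pos]; ring
  have hexp : k - 1 + 2 + 1 = k + 2 := by have := H.dim_pos; omega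
  rw [hexp, hcast] at h1
  have h2 := mul_lt_mul_of_pos_left h1 (sphereArea_pos H.dim_pos)
  have h3 : ∀ t : ℝ, h (t ^ 2) * t ^ (k - 1 + 2) = h (t ^ 2) * t ^ (k - 1) * t ^ 2 := fun t => by
    rw [pow_add]; ring
  simp_rw [h3] at h2
  rw [H.second_moment] at h2
  calc sphereArea k * h (r ^ 2) * r ^ (k + 2)
      = (k + 2) * (sphereArea k * (h (r ^ 2) * (r ^ (k + 2) / (k + 2)))) := by field_simp
    _ < (k + 2) * (k * γ) := by gcongr
    _ = _ := by ring

/-- The second moment `k γ` of the ball of radius `r` and mass `γ` is at most `r² γ`. -/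
theorem dim_le_sq (H : StandardProfile k h r γ) : (k : ℝ) ≤ r ^ 2 := by
  have hi : IntervalIntegrable (fun t => h (t ^ 2) * t ^ (k - 1)) volume 0 r :=
    intervalIntegrable_profile_mul H.anti (by fun_prop) le_rfl H.radius_pos.le
  have hi2 : IntervalIntegrable (fun t => h (t ^ 2) * t ^ (k - 1) * t ^ 2) volume 0 r :=
    hi.mul_continuousOn (by fun_prop)
  have h1 : ∫ t in (0 : ℝ)..r, h (t ^ 2) * t ^ (k - 1) * t ^ 2
      ≤ ∫ t in (0 : ℝ)..r, h (t ^ 2) * t ^ (k - 1) * r ^ 2 := by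
    refine intervalIntegral.integral_mono_on H.radius_pos.le hi2 (hi.mul_const _) fun t ht => ?_
    have := H.nonneg (t ^ 2) (mem_Ici.mpr (sq_nonneg _))
    have := pow_nonneg ht.1 (k - 1)
    exact mul_le_mul_of_nonneg_left (pow_le_pow_left₀ ht.1 ht.2 2) (by positivity)
  rw [intervalIntegral.integral_mul_const] at h1
  have h2 := mul_le_mul_of_nonneg_left h1 (sphereArea_pos H.dim_pos).le
  rw [H.second_moment, ← mul_assoc, H.mass, mul_comm γ] at h2
  exact le_of_mul_le_mul_right h2 H.mass_pos

theorem measureReal_closedBall (H : StandardProfile k h r γ) {s : ℝ} (hs : 0 ≤ s) :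
    (radialMeasure k h).real (Metric.closedBall 0 s)
      = sphereArea k * ∫ t in (0 : ℝ)..s, h (t ^ 2) * t ^ (k - 1) := by
  have := setIntegral_norm_radialMeasure H.dim_pos H.nonneg H.anti (fun _ => 1) hs
  simpa using this

theorem measureReal_closedBall_eq (H : StandardProfile k h r γ) :
    (radialMeasure k h).real (Metric.closedBall 0 r) = γ := by
  rw [H.measureReal_closedBall H.radius_pos.le, H.mass]

theorem setIntegral_normSq (H : StandardProfile k h r γ) :
    ∫ z in Metric.closedBall 0 r, ‖z‖ ^ 2 ∂(radialMeasure k h) = k * γ := by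
  rw [setIntegral_norm_radialMeasure H.dim_pos H.nonneg H.anti (fun t => t ^ 2) H.radius_pos.le,
    H.second_moment]

theorem setIntegral_mul (H : StandardProfile k h r γ) [IsFiniteMeasure (radialMeasure k h)]
    (i j : Fin k) :
    ∫ z in Metric.closedBall 0 r, z i * z j ∂(radialMeasure k h) = if i = j then γ else 0 := by
  rw [(rotationInvariant_radialMeasure_restrict r).integral_mul
    (ae_restrict_closedBall_norm_le _ r), H.setIntegral_normSq]
  have hk : (k : ℝ) ≠ 0 := by exact_mod_cast H.dim_pos.ne'
  simp [hk]

theorem measureReal_closedBall_lt (H : StandardProfile k h r γ) {s : ℝ} (hs : 0 ≤ s)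
    (hsr : s < r) : (radialMeasure k h).real (Metric.closedBall 0 s) < γ := by
  rw [H.measureReal_closedBall hs, ← H.mass]
  refine mul_lt_mul_of_pos_left ?_ (sphereArea_pos H.dim_pos)
  have hi : ∀ a b, 0 ≤ a → 0 ≤ b →
      IntervalIntegrable (fun t => h (t ^ 2) * t ^ (k - 1)) volume a b := fun a b ha hb =>
    intervalIntegrable_profile_mul H.anti (by fun_prop) ha hb
  rw [← intervalIntegral.integral_add_adjacent_intervals (hi 0 s le_rfl hs)
    (hi s r hs H.radius_pos.le)]
  have : 0 < ∫ t in s..r, h (t ^ 2) * t ^ (k - 1) := by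
    refine intervalIntegral.intervalIntegral_pos_of_pos_on (hi s r hs H.radius_pos.le)
      (fun t ht => ?_) hsr
    have ht0 : 0 < t := hs.trans_lt ht.1
    refine mul_pos (H.profile_pos.trans_le (H.anti (mem_Ici.mpr (sq_nonneg _))
      (mem_Ici.mpr (sq_nonneg _)) (pow_le_pow_left₀ ht0.le ht.2.le 2))) (pow_pos ht0 _)
  linarith

end StandardProfile

end Profile

/-! ### Uniqueness of the MCD functional -/

section MCD

variable {k : ℕ} {h : ℝ → ℝ} {r γ : ℝ} {N : Matrix (Fin k) (Fin k) ℝ} {μ : Vec k}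
  {P : Measure (Vec k)}

theorem isProbabilityMeasure_radialMeasure [IsProbabilityMeasure P] (hN : N.PosDef)
    (hP : P = (radialMeasure k h).map fun z => matMul N z + μ) :
    IsProbabilityMeasure (radialMeasure k h) := by
  constructor
  have h1 := measure_univ (μ := P)
  rwa [hP, (measurableEmbedding_affine hN μ).map_apply, preimage_univ] at h1

theorem measureReal_mahalanobisSq_le (hN : N.PosDef)
    (hP : P = (radialMeasure k h).map fun z => matMul N z + μ) {s : ℝ} (hs : 0 ≤ s) :
    P.real {x | mahalanobisSq μ (N * N) x ≤ s ^ 2}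
      = (radialMeasure k h).real (Metric.closedBall 0 s) := by
  rw [Measure.real, hP, (measurableEmbedding_affine hN μ).map_apply, Measure.real]
  congr 2
  ext z
  simp only [mem_preimage, mem_ofPred_eq, mahalanobisSq_affine hN, mem_closedBall_zero_iff]
  exact sq_le_sq₀ (norm_nonneg z) hs

theorem StandardProfile.integral_max_sub (H : StandardProfile k h r γ)
    [IsProbabilityMeasure P] (hN : N.PosDef)
    (hP : P = (radialMeasure k h).map fun z => matMul N z + μ) :
    ∫ x, max (r ^ 2 - mahalanobisSq μ (N * N) x) 0 ∂P = (r ^ 2 - k) * γ := by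
  have := isProbabilityMeasure_radialMeasure hN hP
  rw [hP, (measurableEmbedding_affine hN μ).integral_map]
  have e : (fun z : Vec k => max (r ^ 2 - mahalanobisSq μ (N * N) (matMul N z + μ)) 0)
      = (Metric.closedBall 0 r).indicator fun z => r ^ 2 - ‖z‖ ^ 2 := by
    funext z
    rw [mahalanobisSq_affine hN]
    have hiff := sq_le_sq₀ (norm_nonneg z) H.radius_pos.le
    by_cases hz : ‖z‖ ≤ r
    · rw [indicator_of_mem (by simpa using hz), max_eq_left (by linarith [hiff.mpr hz])]
    · rw [indicator_of_notMem (by simpa using hz), max_eq_right]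
      have := mt hiff.mp hz
      linarith
  rw [e, integral_indicator Metric.isClosed_closedBall.measurableSet,
    integral_sub (integrable_const _) (integrable_of_continuous_of_norm_le
      (ae_restrict_closedBall_norm_le _ r) (by fun_prop)), H.setIntegral_normSq]
  simp only [integral_const, measureReal_restrict_apply_univ, H.measureReal_closedBall_eq,
    smul_eq_mul]
  ring

theorem StandardProfile.trimmedRadius_eq (H : StandardProfile k h r γ)
    [IsProbabilityMeasure P] (hN : N.PosDef)
    (hP : P = (radialMeasure k h).map fun z => matMul N z + μ) {φ : Vec k → ℝ}
    (hm : trimmedMean P φ = μ) (hc : trimmedCov P φ = N * N) : trimmedRadius P γ φ = r := by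
  have := isProbabilityMeasure_radialMeasure hN hP
  rw [trimmedRadius, hm, hc]
  have : {s : ℝ | 0 < s ∧ γ ≤ P.real (ellipsoid μ (N * N) s)} = Ici r := by
    ext s
    simp only [mem_ofPred_eq, mem_Ici, ellipsoid]
    constructor
    · rintro ⟨hs, hle⟩
      by_contra! hsr
      rw [measureReal_mahalanobisSq_le hN hP hs.le] at hle
      exact absurd hle (not_le.mpr (H.measureReal_closedBall_lt hs.le hsr))
    · intro hrs
      have hs := H.radius_pos.trans_le hrs
      refine ⟨hs, ?_⟩
      rw [measureReal_mahalanobisSq_le hN hP hs.le, ← H.measureReal_closedBall_eq]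
      exact measureReal_mono (Metric.closedBall_subset_closedBall hrs)
  rw [this, csInf_Ici]

/-- The indicator function of the central ellipsoid has mean `μ` and covariance `N²`. -/
theorem StandardProfile.exists_trimming (H : StandardProfile k h r γ)
    [IsProbabilityMeasure P] (hN : N.PosDef)
    (hP : P = (radialMeasure k h).map fun z => matMul N z + μ) :
    ∃ φ, IsTrimming P γ φ ∧ trimmedMean P φ = μ ∧ trimmedCov P φ = N * N := by
  have hfin := isProbabilityMeasure_radialMeasure hN hP
  have hemb := measurableEmbedding_affine hN μ
  set B : Set (Vec k) := Metric.closedBall 0 r with hB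
  have mB : MeasurableSet B := Metric.isClosed_closedBall.measurableSet
  let E : Set (Vec k) := {x | mahalanobisSq μ (N * N) x ≤ r ^ 2}
  have mE : MeasurableSet E :=
    (isClosed_le (continuous_mahalanobisSq μ (N * N)) continuous_const).measurableSet
  let φ : Vec k → ℝ := E.indicator fun _ => 1
  have hφ : ∀ z, φ (matMul N z + μ) = B.indicator (fun _ => 1) z := by
    intro z
    have hiff : (matMul N z + μ ∈ E) ↔ z ∈ B := by
      change mahalanobisSq μ (N * N) (matMul N z + μ) ≤ r ^ 2 ↔ _
      rw [mahalanobisSq_affine hN, sq_le_sq₀ (norm_nonneg z) H.radius_pos.le,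
        mem_closedBall_zero_iff]
    by_cases hz : z ∈ B
    · simp [φ, hz, hiff.mpr hz]
    · simp [φ, hz, mt hiff.mp hz]
  have hb := ae_restrict_closedBall_norm_le (radialMeasure k h) r
  have hcont := continuous_matMul N
  have hmass : ∫ x, φ x ∂P = γ := by
    rw [hP, hemb.integral_map]
    simp_rw [hφ]
    rw [integral_indicator mB]
    simpa using H.measureReal_closedBall_eq
  have hmean : trimmedMean P φ = μ := by
    rw [trimmedMean, hmass, hP, hemb.integral_map]
    have e : ∀ z, φ (matMul N z + μ) • (matMul N z + μ)
        = B.indicator (fun z => matMul N z + μ) z := fun z => by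
      rw [hφ]; by_cases hz : z ∈ B <;> simp [hz]
    simp_rw [e]
    have i1 : Integrable (fun z : Vec k => z) ((radialMeasure k h).restrict B) :=
      integrable_of_continuous_of_norm_le hb continuous_id
    have i2 : Integrable (matMul N) ((radialMeasure k h).restrict B) :=
      integrable_of_continuous_of_norm_le hb hcont
    have hodd : ∫ z in B, z ∂(radialMeasure k h) = 0 := by
      have := (rotationInvariant_radialMeasure_restrict (k := k) (h := h) r
        (LinearIsometryEquiv.neg ℝ)).integral_comp
        (LinearIsometryEquiv.neg ℝ : Vec k ≃ₗᵢ[ℝ] Vec k).toHomeomorph.measurableEmbedding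
        (fun z => z)
      simp only [LinearIsometryEquiv.coe_neg, ← hB] at this
      rw [integral_neg] at this
      have h2 : (2 : ℝ) • ∫ z in B, z ∂(radialMeasure k h) = 0 := by
        rw [two_smul]; nth_rewrite 1 [← this]; simp
      exact (smul_eq_zero.mp h2).resolve_left two_ne_zero
    rw [integral_indicator mB, integral_add i2 (integrable_const _)]
    have e2 : ∫ z in B, matMul N z ∂(radialMeasure k h) = 0 := by
      have := (Matrix.toEuclideanCLM (𝕜 := ℝ) N).integral_comp_comm i1
      rw [hodd, map_zero] at this
      exact this
    rw [e2, integral_const, measureReal_restrict_apply_univ, H.measureReal_closedBall_eq,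
      zero_add, smul_smul, inv_mul_cancel₀ H.mass_pos.ne', one_smul]
  have hcov : trimmedCov P φ = N * N := by
    ext i j
    rw [trimmedCov, Matrix.of_apply, hmass, hmean, hP, hemb.integral_map]
    have e : ∀ z, ((matMul N z + μ) i - μ i) * ((matMul N z + μ) j - μ j) * φ (matMul N z + μ)
        = B.indicator (fun z => ∑ a, ∑ b, N i a * N j b * (z a * z b)) z := fun z => by
      rw [hφ]
      by_cases hz : z ∈ B
      · simp only [hz, indicator_of_mem, mul_one, PiLp.add_apply, add_sub_cancel_right,
          matMul_apply, Finset.sum_mul_sum]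
        exact Finset.sum_congr rfl fun a _ => Finset.sum_congr rfl fun b _ => by ring
      · simp [hz]
    simp_rw [e]
    have hI : ∀ a b : Fin k, Integrable (fun z : Vec k => N i a * N j b * (z a * z b))
        ((radialMeasure k h).restrict B) := fun a b =>
      integrable_of_continuous_of_norm_le hb (by fun_prop)
    rw [integral_indicator mB, integral_finsetSum _ fun a _ => integrable_finsetSum _ fun b _ =>
      hI a b, Matrix.mul_apply, Finset.mul_sum]
    refine Finset.sum_congr rfl fun a _ => ?_
    rw [integral_finsetSum _ fun b _ => hI a b]
    simp_rw [integral_const_mul, hB, H.setIntegral_mul]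
    rw [Finset.sum_eq_single a (fun b _ hba => by rw [if_neg hba.symm, mul_zero])
      (fun h => absurd (Finset.mem_univ a) h), if_pos rfl, hN.isSymm_real.apply a j]
    field_simp [H.mass_pos.ne']
  refine ⟨φ, ⟨measurable_const.indicator mE, fun x => ?_, hmass.ge, ?_⟩, hmean, hcov⟩
  · by_cases hx : x ∈ E <;> simp [φ, hx]
  · rw [hP, hemb.integrable_map_iff]
    have e : (fun x => ‖x‖ ^ 2 * φ x) ∘ (fun z => matMul N z + μ)
        = B.indicator fun z => ‖matMul N z + μ‖ ^ 2 := by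
      funext z
      simp only [Function.comp, hφ]
      by_cases hz : z ∈ B <;> simp [hz]
    rw [e, integrable_indicator_iff mB]
    exact integrable_of_continuous_of_norm_le hb (by fun_prop)

/-- The central ellipsoid attains the minimal determinant, and every minimizer has its mean and
covariance. -/
theorem StandardProfile.isUniqueMCD (H : StandardProfile k h r γ)
    [IsProbabilityMeasure P] (hN : N.PosDef)
    (hP : P = volume.withDensity (fun x => ENNReal.ofReal (ellipticalDensity μ (N * N) h x))) :
    IsUniqueMCD P γ μ (N * N) r := by
  have hP' := hP.trans (withDensity_ellipticalDensity hN μ h)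
  obtain ⟨φ₀, hφ₀, -, hcov₀⟩ := H.exists_trimming hN hP'
  have hmin : ∀ φ, IsTrimming P γ φ → (N * N).det ≤ (trimmedCov P φ).det ∧
      ((trimmedCov P φ).det = (N * N).det → trimmedMean P φ = μ ∧ trimmedCov P φ = N * N) :=
    fun φ hφ => det_le_det_trimmedCov H.dim_pos hN.mul_self μ H.nonneg H.anti hP H.mass_pos
      (pow_pos H.radius_pos 2) H.dim_le_sq (H.integral_max_sub hN hP') H.nonconst hφ
  refine ⟨⟨φ₀, hφ₀, fun ψ hψ => hcov₀ ▸ (hmin ψ hψ).1⟩, fun φ hφ => ?_⟩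
  obtain ⟨h1, h2⟩ := hmin φ hφ.1
  obtain ⟨hm, hc⟩ := h2 (le_antisymm (hcov₀ ▸ hφ.2 φ₀ hφ₀) h1)
  exact ⟨hm, hc, H.trimmedRadius_eq hN hP' hm hc⟩

end MCD

/-! ### Integrals over moving ellipsoids along rays -/

section Rays

variable {k : ℕ} {h : ℝ → ℝ} {r γ : ℝ}

/-- The primitive `s ↦ ∫₀ˢ h(t²) t^(k-1+n) dt`. -/
def radialPrimitive (k : ℕ) (h : ℝ → ℝ) (n : ℕ) (s : ℝ) : ℝ :=
  ∫ t in (0 : ℝ)..s, h (t ^ 2) * t ^ (k - 1 + n)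

theorem hasDerivAt_radialPrimitive (h_anti : AntitoneOn h (Ici (0 : ℝ))) (n : ℕ) {s : ℝ}
    (hs : 0 ≤ s) (hc : ContinuousAt h (s ^ 2)) :
    HasDerivAt (radialPrimitive k h n) (h (s ^ 2) * s ^ (k - 1 + n)) s := by
  have hm : Measurable fun t : ℝ => h (t ^ 2) * t ^ (k - 1 + n) :=
    (h_anti.measurable_comp_of_nonneg (by fun_prop) fun t => sq_nonneg t).mul (by fun_prop)
  refine intervalIntegral.integral_hasDerivAt_right
    (intervalIntegrable_profile_mul h_anti (by fun_prop) le_rfl hs)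
    (hm.stronglyMeasurable.stronglyMeasurableAtFilter) ?_
  exact (hc.comp (f := fun t : ℝ => t ^ 2) (by fun_prop)).mul (by fun_prop)

theorem contDiffAt_radialPrimitive (H : StandardProfile k h r γ) (n : ℕ) :
    ContDiffAt ℝ 1 (radialPrimitive k h n) r := by
  rw [contDiffAt_one_iff]
  have hev : ∀ᶠ s in 𝓝 r, 0 < s ∧ ContinuousAt h (s ^ 2) := by
    have h1 : Tendsto (fun s : ℝ => s ^ 2) (𝓝 r) (𝓝 (r ^ 2)) :=
      (continuous_pow 2).tendsto r
    exact (eventually_gt_nhds H.radius_pos).and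
      ((h1.eventually H.regular).mono fun s hs => hs.1)
  refine ⟨fun s => ContinuousLinearMap.toSpanSingleton ℝ (h (s ^ 2) * s ^ (k - 1 + n)),
    {s | 0 < s ∧ ContinuousAt h (s ^ 2)}, hev, ?_, fun s hs =>
      (hasDerivAt_radialPrimitive H.anti n hs.1.le hs.2).hasFDerivAt⟩
  intro s hs
  refine ContinuousAt.continuousWithinAt ?_
  have h2 : ContinuousAt (fun s => h (s ^ 2) * s ^ (k - 1 + n)) s :=
    (hs.2.comp (f := fun t : ℝ => t ^ 2) (by fun_prop)).mul (by fun_prop)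
  exact (ContinuousLinearMap.toSpanSingletonCLE (𝕜 := ℝ) (E := ℝ)).continuous.continuousAt.comp h2

/-- The positive root `t` of `‖t u + b‖ = ρ`, if `u ≠ 0` and `‖b‖ < ρ`. -/
def exitTime (p : Vec k × Vec k × ℝ) : ℝ :=
  (-inner ℝ p.1 p.2.1 + √(inner ℝ p.1 p.2.1 ^ 2 + ‖p.1‖ ^ 2 * (p.2.2 ^ 2 - ‖p.2.1‖ ^ 2)))
    / ‖p.1‖ ^ 2

theorem norm_smul_add_sq (u b : Vec k) (t : ℝ) :
    ‖t • u + b‖ ^ 2 = t ^ 2 * ‖u‖ ^ 2 + 2 * t * inner ℝ u b + ‖b‖ ^ 2 := by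
  rw [norm_add_sq_real, norm_smul, inner_smul_left, mul_pow, Real.norm_eq_abs, sq_abs]
  simp; ring

theorem exitTime_spec {u b : Vec k} {ρ : ℝ} (hu : u ≠ 0) (hb : ‖b‖ < ρ) :
    0 < exitTime (u, b, ρ) ∧
      (∀ t > 0, ‖t • u + b‖ ≤ ρ ↔ t ≤ exitTime (u, b, ρ)) ∧
      ‖exitTime (u, b, ρ) • u + b‖ ^ 2 = ρ ^ 2 := by
  have hu2 : 0 < ‖u‖ ^ 2 := pow_pos (norm_pos_iff.mpr hu) 2
  have hρ : 0 < ρ := (norm_nonneg b).trans_lt hb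
  have hd : 0 < ρ ^ 2 - ‖b‖ ^ 2 := by
    have := pow_lt_pow_left₀ hb (norm_nonneg b) two_ne_zero
    linarith
  set q : ℝ := inner ℝ u b with hq
  have hpos : 0 < ‖u‖ ^ 2 * (ρ ^ 2 - ‖b‖ ^ 2) := mul_pos hu2 hd
  set D := q ^ 2 + ‖u‖ ^ 2 * (ρ ^ 2 - ‖b‖ ^ 2) with hD
  have hsq : √D ^ 2 = D := Real.sq_sqrt (by positivity)
  have hlt : |q| < √D := by
    rw [← Real.sqrt_sq_eq_abs]
    exact Real.sqrt_lt_sqrt (sq_nonneg _) (by rw [hD]; linarith)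
  have hτ : exitTime (u, b, ρ) * ‖u‖ ^ 2 = -q + √D := by
    simp only [exitTime]
    exact div_mul_cancel₀ _ hu2.ne'
  set τ := exitTime (u, b, ρ)
  have h1 : 0 < τ := by
    have : 0 < τ * ‖u‖ ^ 2 := by rw [hτ]; linarith [le_abs_self q]
    exact pos_of_mul_pos_left this hu2.le
  -- The quadratic `‖t u + b‖² - ρ²` in `t` has roots of opposite sign.
  have hfac : ∀ t : ℝ, ‖u‖ ^ 2 * (‖t • u + b‖ ^ 2 - ρ ^ 2)
      = (t * ‖u‖ ^ 2 - τ * ‖u‖ ^ 2) * (t * ‖u‖ ^ 2 + q + √D) := by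
    intro t
    rw [norm_smul_add_sq, hτ]
    linear_combination hsq + hD
  refine ⟨h1, fun t ht => ?_, ?_⟩
  · have hfac2 : 0 < t * ‖u‖ ^ 2 + q + √D := by
      have := neg_abs_le q
      have := mul_pos ht hu2
      linarith
    have hft := hfac t
    rw [← sub_mul] at hft
    rw [← sq_le_sq₀ (norm_nonneg _) hρ.le]
    constructor
    · intro hle
      by_contra! hgt
      have := mul_nonneg hu2.le (sub_nonneg.mpr hle)
      have := mul_pos (mul_pos (sub_pos.mpr hgt) hu2) hfac2
      linarith
    · intro hle
      by_contra! hgt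
      have := mul_pos hu2 (sub_pos.mpr hgt)
      have := mul_nonneg (mul_nonneg (sub_nonneg.mpr hle) hu2.le) hfac2.le
      linarith
  · have := hfac τ
    rw [sub_self, zero_mul] at this
    have := (mul_eq_zero.mp this).resolve_left hu2.ne'
    linarith

/-- A quadratic polynomial on `ℝᵏ`, in terms of its homogeneous parts. -/
def quadPoly (α : ℝ) (l : Vec k →L[ℝ] ℝ) (β : Vec k →L[ℝ] Vec k →L[ℝ] ℝ) (v : Vec k) : ℝ :=
  α + l v + β v v

/-- The integral of `t ↦ h(t²) t^(k-1) w(t u + b)` over the part of the ray `t > 0` where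
`‖t u + b‖ ≤ ρ`, for the quadratic polynomial `w = α + l + β`; here `p = (u, b, ρ)`. It is defined
by its value in terms of `radialPrimitive` at the exit time, from which smoothness in `p` is plain;
`integral_ray_eq` identifies it with the integral. -/
def rayIntegral (k : ℕ) (h : ℝ → ℝ) (α : ℝ) (l : Vec k →L[ℝ] ℝ)
    (β : Vec k →L[ℝ] Vec k →L[ℝ] ℝ) (p : Vec k × Vec k × ℝ) : ℝ :=
  (α + l p.2.1 + β p.2.1 p.2.1) * radialPrimitive k h 0 (exitTime p)
    + (l p.1 + β p.1 p.2.1 + β p.2.1 p.1) * radialPrimitive k h 1 (exitTime p)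
    + β p.1 p.1 * radialPrimitive k h 2 (exitTime p)

variable (α : ℝ) (l : Vec k →L[ℝ] ℝ) (β : Vec k →L[ℝ] Vec k →L[ℝ] ℝ)

theorem integral_ray_eq (h_anti : AntitoneOn h (Ici (0 : ℝ))) {u b : Vec k} {ρ : ℝ} (hu : u ≠ 0)
    (hb : ‖b‖ < ρ) :
    ∫ t in Ioi (0 : ℝ), t ^ (k - 1) * (h (t ^ 2) *
      {v : Vec k | ‖v‖ ≤ ρ}.indicator (quadPoly α l β) (t • u + b))
      = rayIntegral k h α l β (u, b, ρ) := by
  obtain ⟨hτ, hiff, -⟩ := exitTime_spec hu hb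
  set τ := exitTime (u, b, ρ) with hτ_def
  have hI : ∀ n : ℕ, IntervalIntegrable (fun t => h (t ^ 2) * t ^ (k - 1 + n)) volume 0 τ :=
    fun n => intervalIntegrable_profile_mul h_anti (by fun_prop) le_rfl hτ.le
  have e : ∀ t ∈ Ioi (0 : ℝ), t ^ (k - 1) * (h (t ^ 2) *
      {v : Vec k | ‖v‖ ≤ ρ}.indicator (quadPoly α l β) (t • u + b))
      = (Iic τ).indicator (fun t => (α + l b + β b b) * (h (t ^ 2) * t ^ (k - 1 + 0))
        + (l u + β u b + β b u) * (h (t ^ 2) * t ^ (k - 1 + 1))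
        + β u u * (h (t ^ 2) * t ^ (k - 1 + 2))) t := by
    intro t ht
    by_cases htτ : t ≤ τ
    · rw [indicator_of_mem (show t • u + b ∈ {v : Vec k | ‖v‖ ≤ ρ} from (hiff t ht).mpr htτ),
        indicator_of_mem (show t ∈ Iic τ from htτ)]
      simp only [quadPoly, map_add, map_smul, add_apply, smul_apply, smul_eq_mul]
      ring
    · rw [indicator_of_notMem (show t • u + b ∉ {v : Vec k | ‖v‖ ≤ ρ} from
        mt (hiff t ht).mp htτ), indicator_of_notMem (show t ∉ Iic τ from htτ)]
      ring
  rw [setIntegral_congr_fun measurableSet_Ioi e, setIntegral_indicator measurableSet_Iic,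
    Ioi_inter_Iic, ← intervalIntegral.integral_of_le hτ.le,
    intervalIntegral.integral_add (((hI 0).const_mul _).add ((hI 1).const_mul _))
      ((hI 2).const_mul _),
    intervalIntegral.integral_add ((hI 0).const_mul _) ((hI 1).const_mul _),
    intervalIntegral.integral_const_mul, intervalIntegral.integral_const_mul,
    intervalIntegral.integral_const_mul]
  rfl

theorem contDiffAt_exitTime {u : Vec k} (hu : ‖u‖ = 1) (hr : 0 < r) :
    ContDiffAt ℝ 1 (exitTime (k := k)) (u, 0, r) := by
  unfold exitTime
  refine ContDiffAt.div (ContDiffAt.add ?_ (ContDiffAt.sqrt ?_ ?_)) ?_ ?_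
  · exact (ContDiffAt.inner ℝ contDiffAt_fst (contDiffAt_fst.comp _ contDiffAt_snd)).neg
  · refine ((ContDiffAt.inner ℝ contDiffAt_fst (contDiffAt_fst.comp _ contDiffAt_snd)).pow 2).add
      ((contDiffAt_fst.norm_sq ℝ).mul (((contDiffAt_snd.comp _ contDiffAt_snd).pow 2).sub
        ((contDiffAt_fst.comp _ contDiffAt_snd).norm_sq ℝ)))
  · simp [hu, hr.ne']
  · exact contDiffAt_fst.norm_sq ℝ
  · simp [hu]

theorem exitTime_unit {u : Vec k} (hu : ‖u‖ = 1) (hr : 0 < r) : exitTime (u, 0, r) = r := by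
  simp [exitTime, hu, Real.sqrt_sq hr.le]

theorem contDiffAt_rayIntegral (H : StandardProfile k h r γ) {u : Vec k} (hu : ‖u‖ = 1) :
    ContDiffAt ℝ 1 (rayIntegral k h α l β) (u, 0, r) := by
  have hτ := contDiffAt_exitTime hu H.radius_pos
  have hG : ∀ n, ContDiffAt ℝ 1 (fun p : Vec k × Vec k × ℝ => radialPrimitive k h n (exitTime p))
      (u, 0, r) := fun n => by
    refine ContDiffAt.comp (g := radialPrimitive k h n) _ ?_ hτ
    rw [exitTime_unit hu H.radius_pos]
    exact contDiffAt_radialPrimitive H n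
  have hfst : ContDiffAt ℝ 1 (fun p : Vec k × Vec k × ℝ => p.2.1) (u, 0, r) :=
    contDiffAt_fst.comp _ contDiffAt_snd
  have hfst' : ContDiffAt ℝ 1 (fun p : Vec k × Vec k × ℝ => p.1) (u, 0, r) := contDiffAt_fst
  have hl : ∀ {f : Vec k × Vec k × ℝ → Vec k}, ContDiffAt ℝ 1 f (u, 0, r) →
      ContDiffAt ℝ 1 (fun p => l (f p)) (u, 0, r) := fun hf => l.contDiff.contDiffAt.comp _ hf
  have hβ : ∀ {f g : Vec k × Vec k × ℝ → Vec k}, ContDiffAt ℝ 1 f (u, 0, r) →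
      ContDiffAt ℝ 1 g (u, 0, r) → ContDiffAt ℝ 1 (fun p => β (f p) (g p)) (u, 0, r) :=
    fun hf hg => (β.contDiff.contDiffAt.comp _ hf).clm_apply hg
  exact (((contDiffAt_const.add (hl hfst)).add (hβ hfst hfst)).mul (hG 0)).add
    ((((hl hfst').add (hβ hfst' hfst)).add (hβ hfst hfst')).mul (hG 1)) |>.add
    ((hβ hfst' hfst').mul (hG 2))

theorem fderiv_exitTime_unit {u : Vec k} (hu : ‖u‖ = 1) (hr : 0 < r) (v : Vec k × Vec k × ℝ) :
    fderiv ℝ (exitTime (k := k)) (u, 0, r) v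
      = v.2.2 - r * inner ℝ u v.1 - inner ℝ u v.2.1 := by
  have hτ := ((contDiffAt_exitTime hu hr).differentiableAt one_ne_zero).hasFDerivAt
  have hline : HasDerivAt (fun s : ℝ => ((u, 0, r) : Vec k × Vec k × ℝ) + s • v) v 0 := by
    simpa using ((hasDerivAt_id (0 : ℝ)).smul_const v).const_add ((u, 0, r) : Vec k × Vec k × ℝ)
  have hτl : HasDerivAt (fun s : ℝ => exitTime (((u, 0, r) : Vec k × Vec k × ℝ) + s • v))
      (fderiv ℝ (exitTime (k := k)) (u, 0, r) v) 0 := by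
    have hτ' : HasFDerivAt (exitTime (k := k)) (fderiv ℝ (exitTime (k := k)) (u, 0, r))
        (((u, 0, r) : Vec k × Vec k × ℝ) + (0 : ℝ) • v) := by simpa using hτ
    exact hτ'.comp_hasDerivAt 0 hline
  set d := fderiv ℝ (exitTime (k := k)) (u, 0, r) v
  -- Differentiate the identity `‖τ u + b‖² = ρ²` along the line.
  have hw : HasDerivAt (fun s : ℝ => exitTime (((u, 0, r) : Vec k × Vec k × ℝ) + s • v) •
      (u + s • v.1) + s • v.2.1) (d • u + r • v.1 + v.2.1) 0 := by
    have h1 : HasDerivAt (fun s : ℝ => u + s • v.1) v.1 0 := by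
      simpa using ((hasDerivAt_id (0 : ℝ)).smul_const v.1).const_add u
    have h2 : HasDerivAt (fun s : ℝ => s • v.2.1) v.2.1 0 := by
      simpa using (hasDerivAt_id (0 : ℝ)).smul_const v.2.1
    have h3 := (hτl.smul h1).add h2
    refine h3.congr_deriv ?_
    simp only [zero_smul, add_zero, exitTime_unit hu hr]
    abel
  have hns := hw.norm_sq
  have hρ : HasDerivAt (fun s : ℝ => (r + s * v.2.2) ^ 2) (2 * r * v.2.2) 0 := by
    have h1 : HasDerivAt (fun s : ℝ => r + s * v.2.2) v.2.2 0 := by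
      simpa using ((hasDerivAt_id (0 : ℝ)).mul_const v.2.2).const_add r
    simpa using h1.fun_pow 2
  have hev : (fun s : ℝ => ‖exitTime (((u, 0, r) : Vec k × Vec k × ℝ) + s • v) •
      (u + s • v.1) + s • v.2.1‖ ^ 2) =ᶠ[𝓝 0] fun s => (r + s * v.2.2) ^ 2 := by
    have c1 : ∀ᶠ s : ℝ in 𝓝 0, u + s • v.1 ≠ 0 := by
      have : ContinuousAt (fun s : ℝ => u + s • v.1) 0 := by fun_prop
      refine this.eventually_ne ?_
      simp only [zero_smul, add_zero]
      exact norm_ne_zero_iff.mp (by rw [hu]; exact one_ne_zero)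
    have c2 : ∀ᶠ s : ℝ in 𝓝 0, ‖s • v.2.1‖ < r + s * v.2.2 := by
      have a1 : ContinuousAt (fun s : ℝ => ‖s • v.2.1‖) 0 := by fun_prop
      have a2 : ContinuousAt (fun s : ℝ => r + s * v.2.2) 0 := by fun_prop
      exact a1.eventually_lt a2 (by simpa using hr)
    filter_upwards [c1, c2] with s h1 h2
    have := (exitTime_spec h1 h2).2.2
    have heq : ((u, 0, r) : Vec k × Vec k × ℝ) + s • v
        = (u + s • v.1, s • v.2.1, r + s * v.2.2) := by
      ext <;> simp
    rw [heq]
    exact this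
  have := hns.unique (hρ.congr_of_eventuallyEq hev)
  simp only [zero_smul, add_zero, exitTime_unit hu hr, inner_smul_left, inner_add_right,
    inner_smul_right, real_inner_self_eq_norm_sq, hu] at this
  have h2 : r * (d + r * inner ℝ u v.1 + inner ℝ u v.2.1 - v.2.2) = 0 := by
    simp at this
    linarith
  have := (mul_eq_zero.mp h2).resolve_left hr.ne'
  linarith

theorem fderiv_rayIntegral (H : StandardProfile k h r γ) {u : Vec k} (hu : ‖u‖ = 1)
    (v : Vec k × Vec k × ℝ) :
    fderiv ℝ (rayIntegral k h α l β) (u, 0, r) v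
      = (α + r * l u + r ^ 2 * β u u) * (h (r ^ 2) * r ^ (k - 1)) *
          (v.2.2 - r * inner ℝ u v.1 - inner ℝ u v.2.1)
        + l v.2.1 * radialPrimitive k h 0 r
        + (l v.1 + β u v.2.1 + β v.2.1 u) * radialPrimitive k h 1 r
        + (β v.1 u + β u v.1) * radialPrimitive k h 2 r := by
  have hτ := ((contDiffAt_exitTime hu H.radius_pos).differentiableAt one_ne_zero).hasFDerivAt
  have hK := ((contDiffAt_rayIntegral α l β H hu).differentiableAt one_ne_zero).hasFDerivAt
  have hline : HasDerivAt (fun s : ℝ => ((u, 0, r) : Vec k × Vec k × ℝ) + s • v) v 0 := by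
    simpa using ((hasDerivAt_id (0 : ℝ)).smul_const v).const_add ((u, 0, r) : Vec k × Vec k × ℝ)
  have hτl : HasDerivAt (fun s : ℝ => exitTime (((u, 0, r) : Vec k × Vec k × ℝ) + s • v))
      (v.2.2 - r * inner ℝ u v.1 - inner ℝ u v.2.1) 0 := by
    rw [← fderiv_exitTime_unit hu H.radius_pos]
    have hτ' : HasFDerivAt (exitTime (k := k)) (fderiv ℝ (exitTime (k := k)) (u, 0, r))
        (((u, 0, r) : Vec k × Vec k × ℝ) + (0 : ℝ) • v) := by simpa using hτ
    exact hτ'.comp_hasDerivAt 0 hline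
  have hKl : HasDerivAt (fun s : ℝ => rayIntegral k h α l β
      (((u, 0, r) : Vec k × Vec k × ℝ) + s • v))
      (fderiv ℝ (rayIntegral k h α l β) (u, 0, r) v) 0 := by
    have hK' : HasFDerivAt (rayIntegral k h α l β)
        (fderiv ℝ (rayIntegral k h α l β) (u, 0, r))
        (((u, 0, r) : Vec k × Vec k × ℝ) + (0 : ℝ) • v) := by simpa using hK
    exact hK'.comp_hasDerivAt 0 hline
  set d := v.2.2 - r * inner ℝ u v.1 - inner ℝ u v.2.1
  have hG : ∀ n, HasDerivAt (fun s : ℝ => radialPrimitive k h n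
      (exitTime (((u, 0, r) : Vec k × Vec k × ℝ) + s • v)))
      (h (r ^ 2) * r ^ (k - 1 + n) * d) 0 := fun n => by
    have hG' : HasDerivAt (radialPrimitive k h n) (h (r ^ 2) * r ^ (k - 1 + n))
        (exitTime (((u, 0, r) : Vec k × Vec k × ℝ) + (0 : ℝ) • v)) := by
      simp only [zero_smul, add_zero, exitTime_unit hu H.radius_pos]
      exact hasDerivAt_radialPrimitive H.anti n H.radius_pos.le H.regular.self_of_nhds.1
    exact hG'.comp 0 hτl
  have hu' : HasDerivAt (fun s : ℝ => u + s • v.1) v.1 0 := by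
    simpa using ((hasDerivAt_id (0 : ℝ)).smul_const v.1).const_add u
  have hb' : HasDerivAt (fun s : ℝ => s • v.2.1) v.2.1 0 := by
    simpa using (hasDerivAt_id (0 : ℝ)).smul_const v.2.1
  have hl : ∀ {f : ℝ → Vec k} {f' : Vec k}, HasDerivAt f f' 0 →
      HasDerivAt (fun s => l (f s)) (l f') 0 := fun hf =>
    l.hasFDerivAt.comp_hasDerivAt 0 hf
  have hβ : ∀ {f g : ℝ → Vec k} {f' g' : Vec k}, HasDerivAt f f' 0 → HasDerivAt g g' 0 →
      HasDerivAt (fun s => β (f s) (g s)) (β f' (g 0) + β (f 0) g') 0 := fun hf hg =>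
    (β.hasFDerivAt.comp_hasDerivAt 0 hf).clm_apply hg
  have hsum := ((((hasDerivAt_const (0 : ℝ) α).add (hl hb')).add (hβ hb' hb')).mul (hG 0)).add
    ((((hl hu').add (hβ hu' hb')).add (hβ hb' hu')).mul (hG 1)) |>.add ((hβ hu' hu').mul (hG 2))
  have hsum' := hsum.congr_of_eventuallyEq
    (f₁ := fun s : ℝ => rayIntegral k h α l β (((u, 0, r) : Vec k × Vec k × ℝ) + s • v))
    (Eventually.of_forall fun s => by simp [rayIntegral])
  refine (hKl.unique hsum').trans ?_
  simp only [Pi.add_apply, zero_smul, add_zero, exitTime_unit hu H.radius_pos, map_zero, zero_add,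
    zero_apply]
  rw [pow_add, pow_add]
  ring

end Rays

/-! ### Differentiation of integrals over moving ellipsoids -/

section Moving

/-- Differentiation under the integral sign over a compact space, for a `C¹` integrand that depends
on the parameter through linear maps. -/
theorem hasFDerivAt_integral_comp_clm {X : Type*} [TopologicalSpace X] [CompactSpace X]
    [SecondCountableTopology X] [MeasurableSpace X] [OpensMeasurableSpace X] (σ : Measure X)
    [IsFiniteMeasure σ] {Θ F : Type*} [NormedAddCommGroup Θ] [NormedSpace ℝ Θ]
    [NormedAddCommGroup F] [NormedSpace ℝ F] {L : X → Θ →L[ℝ] F} (hL : Continuous L)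
    {K : F → ℝ} {θ₀ : Θ} (hK : ∀ x, ContDiffAt ℝ 1 K (L x θ₀)) :
    Integrable (fun x => (fderiv ℝ K (L x θ₀)).comp (L x)) σ ∧
      HasFDerivAt (fun θ => ∫ x, K (L x θ) ∂σ) (∫ x, (fderiv ℝ K (L x θ₀)).comp (L x) ∂σ) θ₀ := by
  have hcf : ∀ x, ContinuousAt (fderiv ℝ K) (L x θ₀) := fun x =>
    ((hK x).fderiv_right (m := 0) (by norm_num)).continuousAt
  have hLθ : ∀ θ, Continuous fun x => L x θ := fun θ => by fun_prop
  have hcont : Continuous fun x => fderiv ℝ K (L x θ₀) :=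
    continuous_iff_continuousAt.mpr fun x => (hcf x).comp (f := fun x => L x θ₀)
      (hLθ θ₀).continuousAt
  have hcomp : Continuous fun x => (fderiv ℝ K (L x θ₀)).comp (L x) := hcont.clm_comp hL
  obtain ⟨C, hC⟩ := isCompact_univ.exists_bound_of_continuousOn hcont.continuousOn
  obtain ⟨C', hC'⟩ := isCompact_univ.exists_bound_of_continuousOn hL.continuousOn
  obtain ⟨C'', hC''⟩ := isCompact_univ.exists_bound_of_continuousOn hcomp.continuousOn
  have hev : ∀ᶠ θ in 𝓝 θ₀, ∀ x ∈ (univ : Set X),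
      ContDiffAt ℝ 1 K (L x θ) ∧ ‖fderiv ℝ K (L x θ)‖ ≤ C + 1 := by
    refine isCompact_univ.eventually_forall_of_forall_eventually fun x _ => ?_
    have h1 : Tendsto (fun z : Θ × X => L z.2 z.1) (𝓝 (θ₀, x)) (𝓝 (L x θ₀)) :=
      (Continuous.clm_apply (hL.comp continuous_snd) continuous_fst).tendsto (θ₀, x)
    have h2 : ∀ᶠ y in 𝓝 (L x θ₀), ContDiffAt ℝ 1 K y := (hK x).eventually (by norm_num)
    have h3 : ∀ᶠ y in 𝓝 (L x θ₀), ‖fderiv ℝ K y‖ < C + 1 :=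
      (hcf x).norm.eventually_lt continuousAt_const
        ((hC x (mem_univ x)).trans_lt (lt_add_one C))
    exact h1.eventually (h2.and (h3.mono fun y hy => hy.le))
  have hmeas : ∀ᶠ θ in 𝓝 θ₀, Continuous fun x => K (L x θ) := hev.mono fun θ hθ =>
    continuous_iff_continuousAt.mpr fun x =>
      (hθ x (mem_univ x)).1.continuousAt.comp (f := fun x => L x θ) (hLθ θ).continuousAt
  obtain ⟨C₀, hC₀⟩ := isCompact_univ.exists_bound_of_continuousOn
    hmeas.self_of_nhds.continuousOn
  refine ⟨Integrable.of_bound hcomp.aestronglyMeasurable C''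
    (ae_of_all _ fun x => hC'' x (mem_univ x)), ?_⟩
  refine hasFDerivAt_integral_of_dominated_of_fderiv_le
    (F' := fun θ x => (fderiv ℝ K (L x θ)).comp (L x)) (bound := fun _ => (C + 1) * C') hev
    (hmeas.mono fun θ hθ => hθ.aestronglyMeasurable)
    (Integrable.of_bound hmeas.self_of_nhds.aestronglyMeasurable C₀
      (ae_of_all _ fun x => hC₀ x (mem_univ x)))
    hcomp.aestronglyMeasurable (ae_of_all _ fun x θ hθ => ?_) (integrable_const _)
    (ae_of_all _ fun x θ hθ => ?_)
  · refine (ContinuousLinearMap.opNorm_comp_le _ _).trans ?_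
    have h1 := (hθ x (mem_univ x)).2
    exact mul_le_mul h1 (hC' x (mem_univ x)) (norm_nonneg _) ((norm_nonneg _).trans h1)
  · exact (((hθ x (mem_univ x)).1.differentiableAt one_ne_zero).hasFDerivAt).comp θ
      (L x).hasFDerivAt

variable {k : ℕ} {h : ℝ → ℝ} {r γ : ℝ}

/-- The parameters `(B, b, ρ)` of the set `{z : ‖B z + b‖ ≤ ρ}`. -/
abbrev MovingParam (k : ℕ) : Type := (Vec k →L[ℝ] Vec k) × Vec k × ℝ

/-- The integral of `w(B z + b)` over `{z : ‖B z + b‖ ≤ ρ}` with respect to the radial measure, for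
the quadratic polynomial `w = α + l + β`. -/
def movingIntegral (k : ℕ) (h : ℝ → ℝ) (α : ℝ) (l : Vec k →L[ℝ] ℝ)
    (β : Vec k →L[ℝ] Vec k →L[ℝ] ℝ) (θ : MovingParam k) : ℝ :=
  ∫ z, {v : Vec k | ‖v‖ ≤ θ.2.2}.indicator (quadPoly α l β) (θ.1 z + θ.2.1) ∂(radialMeasure k h)

variable (α : ℝ) (l : Vec k →L[ℝ] ℝ) (β : Vec k →L[ℝ] Vec k →L[ℝ] ℝ)

theorem continuous_quadPoly : Continuous (quadPoly α l β) := by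
  unfold quadPoly; fun_prop

theorem exists_norm_indicator_quadPoly_le (ρ : ℝ) :
    ∃ C, ∀ v : Vec k, ‖{v : Vec k | ‖v‖ ≤ ρ}.indicator (quadPoly α l β) v‖ ≤ C := by
  obtain ⟨C, hC⟩ := (isCompact_closedBall (0 : Vec k) ρ).exists_bound_of_continuousOn
    (continuous_quadPoly α l β).continuousOn
  refine ⟨max C 0, fun v => ?_⟩
  by_cases hv : ‖v‖ ≤ ρ
  · rw [indicator_of_mem (show v ∈ {v : Vec k | ‖v‖ ≤ ρ} from hv)]
    exact (hC v (by simpa using hv)).trans (le_max_left _ _)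
  · rw [indicator_of_notMem (show v ∉ {v : Vec k | ‖v‖ ≤ ρ} from hv), norm_zero]
    exact le_max_right _ _

theorem measurable_indicator_quadPoly (ρ : ℝ) :
    Measurable ({v : Vec k | ‖v‖ ≤ ρ}.indicator (quadPoly α l β)) :=
  (continuous_quadPoly α l β).measurable.indicator
    (isClosed_le continuous_norm continuous_const).measurableSet

/-- The moving integral in polar coordinates. -/
theorem StandardProfile.movingIntegral_eq (H : StandardProfile k h r γ)
    [IsFiniteMeasure (radialMeasure k h)] {θ : MovingParam k}
    (hB : ∀ ω : Metric.sphere (0 : Vec k) 1, θ.1 ω ≠ 0) (hb : ‖θ.2.1‖ < θ.2.2) :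
    movingIntegral k h α l β θ = ∫ ω : Metric.sphere (0 : Vec k) 1,
      rayIntegral k h α l β (θ.1 ω, θ.2.1, θ.2.2) ∂(volume : Measure (Vec k)).toSphere := by
  obtain ⟨C, hC⟩ := exists_norm_indicator_quadPoly_le α l β θ.2.2
  have hmeas := (measurable_indicator_quadPoly α l β θ.2.2).comp
    (show Measurable fun z => θ.1 z + θ.2.1 by fun_prop)
  have hint : Integrable (fun z => {v : Vec k | ‖v‖ ≤ θ.2.2}.indicator (quadPoly α l β)
      (θ.1 z + θ.2.1)) (radialMeasure k h) :=
    Integrable.of_bound hmeas.aestronglyMeasurable C (ae_of_all _ fun z => hC _)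
  have hint' : Integrable (fun z => h (‖z‖ ^ 2) *
      {v : Vec k | ‖v‖ ≤ θ.2.2}.indicator (quadPoly α l β) (θ.1 z + θ.2.1)) := by
    rw [radialMeasure, integrable_withDensity_iff_integrable_smul'
      (measurable_radialDensity H.anti).ennreal_ofReal
      (ae_of_all _ fun _ => ENNReal.ofReal_lt_top)] at hint
    refine hint.congr (ae_of_all _ fun z => ?_)
    simp only [smul_eq_mul]
    rw [ENNReal.toReal_ofReal (H.nonneg _ (mem_Ici.mpr (sq_nonneg _)))]
  rw [movingIntegral, integral_radialMeasure H.nonneg H.anti, integral_polar H.dim_pos hint']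
  refine integral_congr_ae (ae_of_all _ fun ω => ?_)
  simp only
  rw [← integral_ray_eq α l β H.anti (hB ω) hb]
  refine setIntegral_congr_fun measurableSet_Ioi fun t ht => ?_
  have hnorm : ‖t • (ω : Vec k)‖ = t := by
    rw [norm_smul, norm_eq_of_mem_sphere, mul_one, Real.norm_of_nonneg (le_of_lt ht)]
  simp only [hnorm, map_smul]

/-- The derivative of the moving integral at the unit position `B = 1`, `b = 0`, `ρ = r`: a boundary
term, where the integrand on the sphere is weighted with the speed of the boundary, and the
integrals of the derivative of the weight. -/
theorem StandardProfile.exists_hasFDerivAt_movingIntegral (H : StandardProfile k h r γ)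
    [IsFiniteMeasure (radialMeasure k h)] :
    ∃ D : MovingParam k →L[ℝ] ℝ, HasFDerivAt (movingIntegral k h α l β) D (1, 0, r) ∧
      ∀ v : MovingParam k, D v = ∫ ω, (α + r * l ω + r ^ 2 * β ω ω) *
          (h (r ^ 2) * r ^ (k - 1)) * (v.2.2 - r * inner ℝ ω (v.1 ω) - inner ℝ ω v.2.1)
        + l v.2.1 * radialPrimitive k h 0 r
        + (l (v.1 ω) + β ω v.2.1 + β v.2.1 ω) * radialPrimitive k h 1 r
        + (β (v.1 ω) ω + β ω (v.1 ω)) * radialPrimitive k h 2 r ∂(unitSphereMeasure k) := by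
  let L : Metric.sphere (0 : Vec k) 1 → MovingParam k →L[ℝ] (Vec k × Vec k × ℝ) := fun ω =>
    (ContinuousLinearMap.inl ℝ (Vec k) (Vec k × ℝ)).comp
        ((ContinuousLinearMap.apply ℝ (Vec k) (ω : Vec k)).comp
          (ContinuousLinearMap.fst ℝ (Vec k →L[ℝ] Vec k) (Vec k × ℝ)))
      + (ContinuousLinearMap.inr ℝ (Vec k) (Vec k × ℝ)).comp
          (ContinuousLinearMap.snd ℝ (Vec k →L[ℝ] Vec k) (Vec k × ℝ))
  have hLapp : ∀ ω θ, L ω θ = (θ.1 ω, θ.2.1, θ.2.2) := fun ω θ => by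
    ext <;> simp [L]
  have hL : Continuous L := by
    have h1 : Continuous fun ω : Metric.sphere (0 : Vec k) 1 =>
        ContinuousLinearMap.apply ℝ (Vec k) (ω : Vec k) :=
      (ContinuousLinearMap.apply ℝ (Vec k)).continuous.comp continuous_subtype_val
    exact (continuous_const.clm_comp (h1.clm_comp continuous_const)).add continuous_const
  have hunit : ∀ ω : Metric.sphere (0 : Vec k) 1, ‖(ω : Vec k)‖ = 1 := norm_eq_of_mem_sphere
  have hbase : ∀ ω : Metric.sphere (0 : Vec k) 1,
      L ω ((1, 0, r) : MovingParam k) = ((ω : Vec k), 0, r) := fun ω => by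
    rw [hLapp]; rfl
  obtain ⟨hint, hder⟩ := hasFDerivAt_integral_comp_clm (volume : Measure (Vec k)).toSphere hL
    (K := rayIntegral k h α l β) (θ₀ := ((1, 0, r) : MovingParam k)) (fun ω => by
      rw [hbase]; exact contDiffAt_rayIntegral α l β H (hunit ω))
  refine ⟨_, hder.congr_of_eventuallyEq ?_, fun v => ?_⟩
  · have e1 : ∀ᶠ θ : MovingParam k in 𝓝 (1, 0, r), ‖θ.1 - 1‖ < 1 := by
      have : ContinuousAt (fun θ : MovingParam k => ‖θ.1 - 1‖) (1, 0, r) := by fun_prop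
      exact this.eventually_lt continuousAt_const (by simp)
    have e2 : ∀ᶠ θ : MovingParam k in 𝓝 (1, 0, r), ‖θ.2.1‖ < θ.2.2 := by
      have a1 : ContinuousAt (fun θ : MovingParam k => ‖θ.2.1‖) (1, 0, r) := by fun_prop
      have a2 : ContinuousAt (fun θ : MovingParam k => θ.2.2) (1, 0, r) := by fun_prop
      exact a1.eventually_lt a2 (by simpa using H.radius_pos)
    filter_upwards [e1, e2] with θ h1 h2
    rw [H.movingIntegral_eq α l β (fun ω hω => ?_) h2]
    · simp only [hLapp]
    · have := (θ.1 - 1).le_opNorm (ω : Vec k)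
      rw [sub_apply, hω, hunit, one_apply_eq_self, zero_sub,
        norm_neg, hunit] at this
      linarith
  · rw [ContinuousLinearMap.integral_apply hint, integral_unitSphereMeasure]
    refine integral_congr_ae (ae_of_all _ fun ω => ?_)
    simp only [ContinuousLinearMap.comp_apply]
    rw [hbase, hLapp, fderiv_rayIntegral α l β H (hunit ω)]

end Moving

/-! ### The derivatives of mass, mean and covariance over a moving ellipsoid -/

section SphereIntegrals

variable {k : ℕ}

theorem integrable_unitSphereMeasure {g : Vec k → ℝ} (hg : Continuous g) :
    Integrable g (unitSphereMeasure k) :=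
  integrable_of_continuous_of_norm_le ae_norm_le_one_unitSphereMeasure hg

theorem integral_add_unitSphereMeasure {f g : Vec k → ℝ} (hf : Continuous f) (hg : Continuous g) :
    ∫ ω, (f ω + g ω) ∂(unitSphereMeasure k)
      = ∫ ω, f ω ∂(unitSphereMeasure k) + ∫ ω, g ω ∂(unitSphereMeasure k) :=
  integral_add (integrable_unitSphereMeasure hf) (integrable_unitSphereMeasure hg)

theorem integral_sub_unitSphereMeasure {f g : Vec k → ℝ} (hf : Continuous f) (hg : Continuous g) :
    ∫ ω, (f ω - g ω) ∂(unitSphereMeasure k)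
      = ∫ ω, f ω ∂(unitSphereMeasure k) - ∫ ω, g ω ∂(unitSphereMeasure k) :=
  integral_sub (integrable_unitSphereMeasure hf) (integrable_unitSphereMeasure hg)

theorem integral_sum_unitSphereMeasure {ι : Type*} [Fintype ι] {f : ι → Vec k → ℝ}
    (hf : ∀ i, Continuous (f i)) :
    ∫ ω, ∑ i, f i ω ∂(unitSphereMeasure k) = ∑ i, ∫ ω, f i ω ∂(unitSphereMeasure k) :=
  integral_finsetSum _ fun i _ => integrable_unitSphereMeasure (hf i)

theorem integral_const_unitSphereMeasure (c : ℝ) :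
    ∫ _, c ∂(unitSphereMeasure k) = sphereArea k * c := by
  rw [← integral_norm_pow_unitSphereMeasure (k := k) 0]
  simp

theorem integral_apply_mul_unitSphereMeasure (i j : Fin k) :
    ∫ ω, ω i * ω j ∂(unitSphereMeasure k) = if i = j then sphereArea k / k else 0 := by
  rw [rotationInvariant_unitSphereMeasure.integral_mul ae_norm_le_one_unitSphereMeasure,
    integral_norm_pow_unitSphereMeasure]

theorem integral_odd_unitSphereMeasure {g : Vec k → ℝ} (hg : ∀ ω, g (-ω) = -g ω) :
    ∫ ω, g ω ∂(unitSphereMeasure k) = 0 :=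
  rotationInvariant_unitSphereMeasure.integral_eq_zero (LinearIsometryEquiv.neg ℝ) hg

theorem matMul_neg (M : Matrix (Fin k) (Fin k) ℝ) (x : Vec k) : matMul M (-x) = -matMul M x := by
  simp [matMul_eq_toEuclideanCLM]

theorem inner_matMul (M : Matrix (Fin k) (Fin k) ℝ) (ω : Vec k) :
    inner ℝ ω (matMul M ω) = ∑ a, ∑ b, M a b * (ω a * ω b) := by
  simp only [PiLp.inner_apply, matMul_apply, RCLike.inner_apply, conj_trivial, Finset.sum_mul]
  exact Finset.sum_congr rfl fun a _ => Finset.sum_congr rfl fun b _ => by ring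

theorem integral_inner_matMul (M : Matrix (Fin k) (Fin k) ℝ) :
    ∫ ω, inner ℝ ω (matMul M ω) ∂(unitSphereMeasure k) = sphereArea k / k * M.trace := by
  simp_rw [inner_matMul]
  rw [integral_sum_unitSphereMeasure fun a => by fun_prop, Matrix.trace, Finset.mul_sum]
  refine Finset.sum_congr rfl fun a _ => ?_
  rw [integral_sum_unitSphereMeasure fun b => by fun_prop]
  simp_rw [integral_const_mul, integral_apply_mul_unitSphereMeasure]
  simp [mul_comm]

theorem integral_apply_mul_inner (i : Fin k) (b : Vec k) :
    ∫ ω, ω i * inner ℝ ω b ∂(unitSphereMeasure k) = sphereArea k / k * b i := by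
  have e : ∀ ω : Vec k, ω i * inner ℝ ω b = ∑ a, b a * (ω i * ω a) := fun ω => by
    simp only [PiLp.inner_apply, RCLike.inner_apply, conj_trivial, Finset.mul_sum]
    exact Finset.sum_congr rfl fun a _ => by ring
  simp_rw [e]
  rw [integral_sum_unitSphereMeasure fun a => by fun_prop]
  simp_rw [integral_const_mul, integral_apply_mul_unitSphereMeasure]
  simp [mul_comm]

theorem integral_matMul_apply_mul (M : Matrix (Fin k) (Fin k) ℝ) (i j : Fin k) :
    ∫ ω, matMul M ω i * ω j ∂(unitSphereMeasure k) = sphereArea k / k * M i j := by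
  have e : ∀ ω : Vec k, matMul M ω i * ω j = ∑ a, M i a * (ω a * ω j) := fun ω => by
    simp only [matMul_apply, Finset.sum_mul, mul_assoc]
  simp_rw [e]
  rw [integral_sum_unitSphereMeasure fun a => by fun_prop]
  simp_rw [integral_const_mul, integral_apply_mul_unitSphereMeasure]
  simp [mul_comm]

theorem integral_apply_mul_apply_mul_inner (M : Matrix (Fin k) (Fin k) ℝ) (i j : Fin k) :
    ∫ ω, ω i * ω j * inner ℝ ω (matMul M ω) ∂(unitSphereMeasure k)
      = sphereArea k / (k * (k + 2)) * ((if i = j then M.trace else 0) + M i j + M j i) := by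
  have e : ∀ ω : Vec k, ω i * ω j * inner ℝ ω (matMul M ω)
      = ∑ a, ∑ b, M a b * (ω i * ω j * ω a * ω b) := fun ω => by
    simp only [inner_matMul, Finset.mul_sum]
    exact Finset.sum_congr rfl fun a _ => Finset.sum_congr rfl fun b _ => by ring
  simp_rw [e]
  rw [integral_sum_unitSphereMeasure fun a => by fun_prop]
  have h1 : ∀ a, ∫ ω, ∑ b, M a b * (ω i * ω j * ω a * ω b) ∂(unitSphereMeasure k)
      = sphereArea k / (k * (k + 2)) * ((if i = j then M a a else 0)
        + (if i = a then M a j else 0) + (if j = a then M a i else 0)) := by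
    intro a
    rw [integral_sum_unitSphereMeasure fun b => by fun_prop]
    simp_rw [integral_const_mul, rotationInvariant_unitSphereMeasure.integral_mul_mul_mul
      ae_norm_le_one_unitSphereMeasure, integral_norm_pow_unitSphereMeasure, mul_add,
      Finset.sum_add_distrib]
    congr 1
    · congr 1
      · rw [Finset.sum_eq_single a (fun b _ hb => by simp [hb.symm]) (by simp)]
        by_cases h : i = j <;> simp [h, mul_comm]
      · rw [Finset.sum_eq_single j (fun b _ hb => by simp [hb.symm]) (by simp)]
        by_cases h : i = a <;> simp [h, mul_comm]
    · rw [Finset.sum_eq_single i (fun b _ hb => by simp [hb.symm]) (by simp)]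
      by_cases h : j = a <;> simp [h, mul_comm]
  simp_rw [h1]
  rw [← Finset.mul_sum]
  congr 1
  simp only [Finset.sum_add_distrib, Finset.sum_ite_eq, Finset.mem_univ, if_true]
  by_cases h : i = j <;> simp [h, Matrix.trace]

end SphereIntegrals

section Derivatives

variable {k : ℕ} {h : ℝ → ℝ} {r γ : ℝ}

theorem StandardProfile.area_mul_radialPrimitive_zero (H : StandardProfile k h r γ) :
    sphereArea k * radialPrimitive k h 0 r = γ := H.mass

theorem StandardProfile.area_mul_radialPrimitive_two (H : StandardProfile k h r γ) :
    sphereArea k * radialPrimitive k h 2 r = k * γ := by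
  rw [← H.second_moment, radialPrimitive]
  simp_rw [pow_add, mul_assoc]

theorem continuous_matMul_apply (M : Matrix (Fin k) (Fin k) ℝ) (i : Fin k) :
    Continuous fun ω : Vec k => matMul M ω i := by
  have := continuous_matMul M
  fun_prop

theorem continuous_inner_matMul (M : Matrix (Fin k) (Fin k) ℝ) :
    Continuous fun ω : Vec k => (inner ℝ ω (matMul M ω) : ℝ) := by
  have := continuous_matMul M
  fun_prop

/-- Derivative of the mass of the moving ellipsoid. -/
theorem StandardProfile.hasFDerivAt_mass (H : StandardProfile k h r γ)
    [IsFiniteMeasure (radialMeasure k h)] :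
    ∃ D : MovingParam k →L[ℝ] ℝ, HasFDerivAt (movingIntegral k h 1 0 0) D (1, 0, r) ∧
      ∀ (M : Matrix (Fin k) (Fin k) ℝ) (b : Vec k) (s : ℝ),
        D (Matrix.toEuclideanCLM (𝕜 := ℝ) M, b, s)
          = sphereArea k * (h (r ^ 2) * r ^ (k - 1)) * (s - r / k * M.trace) := by
  obtain ⟨D, hD, hDv⟩ := H.exists_hasFDerivAt_movingIntegral 1 0 0
  refine ⟨D, hD, fun M b s => ?_⟩
  rw [hDv]
  simp only [← matMul_eq_toEuclideanCLM, zero_apply, mul_zero, zero_mul, add_zero, one_mul]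
  have c1 := continuous_inner_matMul M
  rw [integral_const_mul, integral_sub_unitSphereMeasure (by fun_prop) (by fun_prop),
    integral_sub_unitSphereMeasure (by fun_prop) (by fun_prop),
    integral_const_unitSphereMeasure, integral_const_mul, integral_inner_matMul,
    integral_odd_unitSphereMeasure (fun ω => by simp)]
  ring

/-- Derivative of the first moments of the moving ellipsoid. -/
theorem StandardProfile.hasFDerivAt_mean (H : StandardProfile k h r γ)
    [IsFiniteMeasure (radialMeasure k h)] (i : Fin k) :
    ∃ D : MovingParam k →L[ℝ] ℝ,
      HasFDerivAt (movingIntegral k h 0 (EuclideanSpace.proj i) 0) D (1, 0, r) ∧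
      ∀ (M : Matrix (Fin k) (Fin k) ℝ) (b : Vec k) (s : ℝ),
        D (Matrix.toEuclideanCLM (𝕜 := ℝ) M, b, s)
          = (γ - sphereArea k * (h (r ^ 2) * r ^ (k - 1)) * r / k) * b i := by
  obtain ⟨D, hD, hDv⟩ := H.exists_hasFDerivAt_movingIntegral 0 (EuclideanSpace.proj i) 0
  refine ⟨D, hD, fun M b s => ?_⟩
  rw [hDv]
  have c1 := continuous_inner_matMul M
  have c2 := continuous_matMul_apply M i
  have e : ∀ ω : Vec k, (0 + r * EuclideanSpace.proj (𝕜 := ℝ) i ω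
        + r ^ 2 * (0 : Vec k →L[ℝ] Vec k →L[ℝ] ℝ) ω ω) *
          (h (r ^ 2) * r ^ (k - 1)) * (s - r * inner ℝ ω (Matrix.toEuclideanCLM (𝕜 := ℝ) M ω)
            - inner ℝ ω b)
        + EuclideanSpace.proj (𝕜 := ℝ) i b * radialPrimitive k h 0 r
        + (EuclideanSpace.proj (𝕜 := ℝ) i (Matrix.toEuclideanCLM (𝕜 := ℝ) M ω)
          + (0 : Vec k →L[ℝ] Vec k →L[ℝ] ℝ) ω b + (0 : Vec k →L[ℝ] Vec k →L[ℝ] ℝ) b ω)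
            * radialPrimitive k h 1 r
        + ((0 : Vec k →L[ℝ] Vec k →L[ℝ] ℝ) (Matrix.toEuclideanCLM (𝕜 := ℝ) M ω) ω
          + (0 : Vec k →L[ℝ] Vec k →L[ℝ] ℝ) ω (Matrix.toEuclideanCLM (𝕜 := ℝ) M ω))
            * radialPrimitive k h 2 r
      = (r * (h (r ^ 2) * r ^ (k - 1)) * (ω i * (s - r * inner ℝ ω (matMul M ω)))
          + matMul M ω i * radialPrimitive k h 1 r)
        + (b i * radialPrimitive k h 0 r
          - r * (h (r ^ 2) * r ^ (k - 1)) * (ω i * inner ℝ ω b)) := fun ω => by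
    simp only [← matMul_eq_toEuclideanCLM, zero_apply, PiLp.proj_apply]
    ring
  refine (integral_congr_ae (ae_of_all _ e)).trans ?_
  rw [integral_add_unitSphereMeasure (by fun_prop) (by fun_prop),
    integral_odd_unitSphereMeasure (fun ω => by
      simp only [matMul_neg, PiLp.neg_apply, inner_neg_neg]; ring),
    integral_sub_unitSphereMeasure (by fun_prop) (by fun_prop), integral_const_unitSphereMeasure,
    integral_const_mul, integral_apply_mul_inner]
  linear_combination b i * H.area_mul_radialPrimitive_zero

/-- The bilinear form `(u, v) ↦ uᵢ vⱼ`. -/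
def coordForm (i j : Fin k) : Vec k →L[ℝ] Vec k →L[ℝ] ℝ :=
  (EuclideanSpace.proj (𝕜 := ℝ) i : Vec k →L[ℝ] ℝ).smulRight
    (EuclideanSpace.proj (𝕜 := ℝ) j : Vec k →L[ℝ] ℝ)

theorem coordForm_apply (i j : Fin k) (u v : Vec k) : coordForm i j u v = u i * v j := by
  simp [coordForm]

/-- Derivative of the centred second moments of the moving ellipsoid. -/
theorem StandardProfile.hasFDerivAt_cov (H : StandardProfile k h r γ)
    [IsFiniteMeasure (radialMeasure k h)] (i j : Fin k) :
    ∃ D : MovingParam k →L[ℝ] ℝ,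
      HasFDerivAt (movingIntegral k h (-(1 : Matrix (Fin k) (Fin k) ℝ) i j) 0 (coordForm i j)) D
        (1, 0, r) ∧
      ∀ (M : Matrix (Fin k) (Fin k) ℝ) (b : Vec k) (s : ℝ),
        D (Matrix.toEuclideanCLM (𝕜 := ℝ) M, b, s)
          = sphereArea k * (h (r ^ 2) * r ^ (k - 1)) *
            ((if i = j then (r ^ 2 / k - 1) * s + r / k * M.trace else 0)
              - r ^ 3 / (k * (k + 2)) * ((if i = j then M.trace else 0) + M i j + M j i))
            + γ * (M i j + M j i) := by
  obtain ⟨D, hD, hDv⟩ := H.exists_hasFDerivAt_movingIntegral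
    (-(1 : Matrix (Fin k) (Fin k) ℝ) i j) 0 (coordForm i j)
  refine ⟨D, hD, fun M b s => ?_⟩
  rw [hDv]
  have c1 := continuous_inner_matMul M
  have c2 := continuous_matMul_apply M i
  have c3 := continuous_matMul_apply M j
  set g := h (r ^ 2) * r ^ (k - 1) with hg
  set δ := (1 : Matrix (Fin k) (Fin k) ℝ) i j with hδ
  have e : ∀ ω : Vec k, (-δ + r * (0 : Vec k →L[ℝ] ℝ) ω
        + r ^ 2 * coordForm i j ω ω) *
          g * (s - r * inner ℝ ω (Matrix.toEuclideanCLM (𝕜 := ℝ) M ω) - inner ℝ ω b)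
        + (0 : Vec k →L[ℝ] ℝ) b * radialPrimitive k h 0 r
        + ((0 : Vec k →L[ℝ] ℝ) (Matrix.toEuclideanCLM (𝕜 := ℝ) M ω)
          + coordForm i j ω b + coordForm i j b ω) * radialPrimitive k h 1 r
        + (coordForm i j (Matrix.toEuclideanCLM (𝕜 := ℝ) M ω) ω
          + coordForm i j ω (Matrix.toEuclideanCLM (𝕜 := ℝ) M ω)) * radialPrimitive k h 2 r
      = ((-δ + r ^ 2 * (ω i * ω j)) * g * (-inner ℝ ω b)
          + (ω i * b j + b i * ω j) * radialPrimitive k h 1 r)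
        + (((-δ * g * s + r ^ 2 * g * s * (ω i * ω j)) + δ * g * r * inner ℝ ω (matMul M ω))
          - r ^ 3 * g * (ω i * ω j * inner ℝ ω (matMul M ω)))
        + radialPrimitive k h 2 r * (matMul M ω i * ω j + matMul M ω j * ω i) := fun ω => by
    simp only [← matMul_eq_toEuclideanCLM, zero_apply, coordForm_apply]
    ring
  refine (integral_congr_ae (ae_of_all _ e)).trans ?_
  rw [integral_add_unitSphereMeasure (by fun_prop) (by fun_prop),
    integral_add_unitSphereMeasure (by fun_prop) (by fun_prop),
    integral_odd_unitSphereMeasure (fun ω => by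
      simp only [PiLp.neg_apply, inner_neg_left]; ring),
    integral_sub_unitSphereMeasure (by fun_prop) (by fun_prop),
    integral_add_unitSphereMeasure (by fun_prop) (by fun_prop),
    integral_add_unitSphereMeasure (by fun_prop) (by fun_prop),
    integral_const_unitSphereMeasure, integral_const_mul, integral_const_mul, integral_const_mul,
    integral_const_mul, integral_add_unitSphereMeasure (by fun_prop) (by fun_prop),
    integral_matMul_apply_mul, integral_matMul_apply_mul, integral_apply_mul_apply_mul_inner,
    integral_inner_matMul, integral_apply_mul_unitSphereMeasure]
  have hk : (k : ℝ) ≠ 0 := by exact_mod_cast H.dim_pos.ne'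
  have h2 : sphereArea k / k * radialPrimitive k h 2 r = γ := by
    rw [div_mul_eq_mul_div, H.area_mul_radialPrimitive_two]
    field_simp
  have hδ' : δ = if i = j then 1 else 0 := Matrix.one_apply
  rw [hδ']
  split_ifs
  · linear_combination (M i j + M j i) * h2
  · linear_combination (M i j + M j i) * h2

end Derivatives

/-! ### Differentiability of `Λ` -/

section LinearChainRule

variable {E F G : Type*} [AddCommGroup E] [Module ℝ E] [TopologicalSpace E] [AddCommGroup F]
  [Module ℝ F] [TopologicalSpace F] [AddCommGroup G] [Module ℝ G] [TopologicalSpace G]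

/-- Chain rule with an inner continuous linear map, for spaces without a chosen norm. -/
theorem HasFDerivAt.comp_clm_right {g : F → G} {g' : F →L[ℝ] G} (L : E →L[ℝ] F) {x : E}
    (hg : HasFDerivAt g g' (L x)) : HasFDerivAt (fun y => g (L y)) (g'.comp L) x := by
  refine .of_isLittleOTVS ?_
  have h1 := hg.isLittleOTVS.comp_tendsto (L.continuous.tendsto x)
  have h2 := ContinuousLinearMap.isBigOTVS_comp (l := 𝓝 x) (f := fun y => y - x) L
  refine (h1.congr_left fun y => ?_).trans_isBigOTVS (h2.congr_left fun y => ?_) <;> simp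

/-- Chain rule with an outer continuous linear map, for spaces without a chosen norm. -/
theorem HasFDerivAt.comp_clm_left {g : E → F} {g' : E →L[ℝ] F} {x : E} (hg : HasFDerivAt g g' x)
    (L : F →L[ℝ] G) : HasFDerivAt (fun y => L (g y)) (L.comp g') x := by
  refine .of_isLittleOTVS ?_
  have h1 := ContinuousLinearMap.isBigOTVS_comp (l := 𝓝 x)
    (f := fun y => g y - g x - g' (y - x)) L
  refine (h1.trans_isLittleOTVS hg.isLittleOTVS).congr_left fun y => ?_
  simp

end LinearChainRule

section Lambda

variable {k : ℕ}

/-- The parameters `(B, b, ρ)` of the set `{z : ‖G⁻¹ (N z + μ - m)‖ ≤ ρ}`, as a function of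
`(G, m, ρ)`. -/
def pulledBackParam (N : Matrix (Fin k) (Fin k) ℝ) (μ : Vec k) (θ : MovingParam k) :
    MovingParam k :=
  (Ring.inverse θ.1 * Matrix.toEuclideanCLM (𝕜 := ℝ) N, Ring.inverse θ.1 (μ - θ.2.1), θ.2.2)

theorem ringInverse_toEuclideanCLM (G : Matrix (Fin k) (Fin k) ℝ) :
    Ring.inverse (Matrix.toEuclideanCLM (𝕜 := ℝ) G) = Matrix.toEuclideanCLM (𝕜 := ℝ) G⁻¹ := by
  rw [Matrix.nonsing_inv_eq_ringInverse]
  by_cases hG : IsUnit G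
  · obtain ⟨u, rfl⟩ := hG
    rw [Ring.inverse_unit]
    exact Ring.inverse_unit (Units.map ((Matrix.toEuclideanCLM (𝕜 := ℝ) (n := Fin k) :
      Matrix (Fin k) (Fin k) ℝ ≃* (Vec k →L[ℝ] Vec k)) :
        Matrix (Fin k) (Fin k) ℝ →* (Vec k →L[ℝ] Vec k)) u)
  · rw [Ring.inverse_non_unit _ hG, Ring.inverse_non_unit, map_zero]
    exact fun h => hG ((MulEquiv.isUnit_map (Matrix.toEuclideanCLM (𝕜 := ℝ) (n := Fin k))).mp h)

theorem matMul_sub_affine (N G : Matrix (Fin k) (Fin k) ℝ) (μ m z : Vec k) (ρ : ℝ) :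
    matMul G⁻¹ (matMul N z + μ - m)
      = (pulledBackParam N μ (Matrix.toEuclideanCLM (𝕜 := ℝ) G, m, ρ)).1 z
        + (pulledBackParam N μ (Matrix.toEuclideanCLM (𝕜 := ℝ) G, m, ρ)).2.1 := by
  simp only [pulledBackParam, ringInverse_toEuclideanCLM, mul_apply_eq_comp,
    matMul_eq_toEuclideanCLM, add_sub_assoc, map_add]

/-- Derivative of `pulledBackParam` at `(N, μ, r)`. -/
theorem hasFDerivAt_pulledBackParam {N : Matrix (Fin k) (Fin k) ℝ} (hN : N.PosDef) (μ : Vec k)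
    (r : ℝ) :
    pulledBackParam N μ (Matrix.toEuclideanCLM (𝕜 := ℝ) N, μ, r) = (1, 0, r) ∧
    ∃ D : MovingParam k →L[ℝ] MovingParam k,
      HasFDerivAt (pulledBackParam N μ) D (Matrix.toEuclideanCLM (𝕜 := ℝ) N, μ, r) ∧
      ∀ (H : Matrix (Fin k) (Fin k) ℝ) (a : Vec k) (s : ℝ),
        D (Matrix.toEuclideanCLM (𝕜 := ℝ) H, a, s)
          = (Matrix.toEuclideanCLM (𝕜 := ℝ) (-(N⁻¹ * H)), -matMul N⁻¹ a, s) := by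
  have hT : Matrix.toEuclideanCLM (𝕜 := ℝ) N⁻¹ * Matrix.toEuclideanCLM (𝕜 := ℝ) N = 1 := by
    rw [← map_mul, hN.inv_mul_self, map_one]
  have hT' : Matrix.toEuclideanCLM (𝕜 := ℝ) N * Matrix.toEuclideanCLM (𝕜 := ℝ) N⁻¹ = 1 := by
    rw [← map_mul, hN.mul_inv_self, map_one]
  constructor
  · simp [pulledBackParam, ringInverse_toEuclideanCLM, hT]
  let u : (Vec k →L[ℝ] Vec k)ˣ :=
    ⟨Matrix.toEuclideanCLM (𝕜 := ℝ) N, Matrix.toEuclideanCLM (𝕜 := ℝ) N⁻¹, hT', hT⟩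
  let θ₀ : MovingParam k := (Matrix.toEuclideanCLM (𝕜 := ℝ) N, μ, r)
  have hinv := HasFDerivAt.comp_clm_right
    (ContinuousLinearMap.fst ℝ (Vec k →L[ℝ] Vec k) (Vec k × ℝ)) (x := θ₀)
    (hasFDerivAt_ringInverse (𝕜 := ℝ) u)
  have h1 := hinv.mul_const' (Matrix.toEuclideanCLM (𝕜 := ℝ) N)
  let Lm : MovingParam k →L[ℝ] Vec k :=
    (ContinuousLinearMap.fst ℝ (Vec k) ℝ).comp (ContinuousLinearMap.snd ℝ _ _)
  let Lr : MovingParam k →L[ℝ] ℝ :=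
    (ContinuousLinearMap.snd ℝ (Vec k) ℝ).comp (ContinuousLinearMap.snd ℝ _ _)
  have hm : HasFDerivAt Lm Lm θ₀ := Lm.hasFDerivAt
  have hr : HasFDerivAt Lr Lr θ₀ := Lr.hasFDerivAt
  have h2 := hinv.clm_apply (hm.const_sub μ)
  refine ⟨_, h1.prodMk (h2.prodMk hr), fun H a s => ?_⟩
  have hu : ((u⁻¹ : (Vec k →L[ℝ] Vec k)ˣ) : Vec k →L[ℝ] Vec k)
    = Matrix.toEuclideanCLM (𝕜 := ℝ) N⁻¹ := rfl
  refine Prod.ext ?_ (Prod.ext ?_ ?_)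
  · refine ContinuousLinearMap.ext fun z => ?_
    change -(matMul N⁻¹ (matMul H (matMul N⁻¹ (matMul N z)))) = matMul (-(N⁻¹ * H)) z
    rw [← matMul_mul N⁻¹ N, hN.inv_mul_self, matMul_one, ← matMul_mul]
    simp only [matMul_eq_toEuclideanCLM, map_neg]
    rfl
  · simp [hu, θ₀, Lm, ringInverse_toEuclideanCLM, matMul_eq_toEuclideanCLM]
  · simp [Lr]

section Integrals

variable {h : ℝ → ℝ} {r γ : ℝ} {N : Matrix (Fin k) (Fin k) ℝ} {μ : Vec k} {P : Measure (Vec k)}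

theorem integral_scatterBall (hN : N.PosDef)
    (hP : P = (radialMeasure k h).map fun z => matMul N z + μ) (α : ℝ) (l : Vec k →L[ℝ] ℝ)
    (β : Vec k →L[ℝ] Vec k →L[ℝ] ℝ) (m : Vec k) (G : Matrix (Fin k) (Fin k) ℝ) (ρ : ℝ) :
    ∫ y, (scatterBall m G ρ).indicator (fun y => quadPoly α l β (matMul G⁻¹ (y - m))) y ∂P
      = movingIntegral k h α l β
          (pulledBackParam N μ (Matrix.toEuclideanCLM (𝕜 := ℝ) G, m, ρ)) := by
  rw [hP, (measurableEmbedding_affine hN μ).integral_map, movingIntegral]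
  refine integral_congr_ae (ae_of_all _ fun z => ?_)
  simp only [indicator, scatterBall, mem_ofPred_eq, matMul_sub_affine N G μ m z ρ]
  rfl

theorem integrable_scatterBall [IsFiniteMeasure P] (α : ℝ) (l : Vec k →L[ℝ] ℝ)
    (β : Vec k →L[ℝ] Vec k →L[ℝ] ℝ) (m : Vec k) (G : Matrix (Fin k) (Fin k) ℝ) (ρ : ℝ) :
    Integrable ((scatterBall m G ρ).indicator
      fun y => quadPoly α l β (matMul G⁻¹ (y - m))) P := by
  obtain ⟨C, hC⟩ := exists_norm_indicator_quadPoly_le α l β ρ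
  have hc : Continuous fun y : Vec k => matMul G⁻¹ (y - m) :=
    (continuous_matMul _).comp (by fun_prop)
  have := (measurable_indicator_quadPoly α l β ρ).comp hc.measurable
  exact Integrable.of_bound this.aestronglyMeasurable C (ae_of_all _ fun y => hC _)

theorem Lam1_apply [IsFiniteMeasure P] (hN : N.PosDef)
    (hP : P = (radialMeasure k h).map fun z => matMul N z + μ)
    (m : Vec k) (G : Matrix (Fin k) (Fin k) ℝ) (ρ : ℝ) (i : Fin k) :
    Lam1 P m G ρ i = movingIntegral k h 0 (EuclideanSpace.proj i) 0
      (pulledBackParam N μ (Matrix.toEuclideanCLM (𝕜 := ℝ) G, m, ρ)) := by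
  have e : ∀ (i : Fin k) (y : Vec k),
      ((scatterBall m G ρ).indicator (fun y => matMul G⁻¹ (y - m)) y) i
        = (scatterBall m G ρ).indicator
          (fun y => quadPoly 0 (EuclideanSpace.proj i) 0 (matMul G⁻¹ (y - m))) y := by
    intro i y
    by_cases hy : y ∈ scatterBall m G ρ <;> simp [hy, quadPoly]
  rw [← integral_scatterBall hN hP, Lam1, eval_integral_piLp]
  · simp_rw [e]
  · intro j
    simp_rw [e]
    exact integrable_scatterBall _ _ _ m G ρ

theorem Lam2_apply (hN : N.PosDef) (hP : P = (radialMeasure k h).map fun z => matMul N z + μ)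
    (m : Vec k) {G : Matrix (Fin k) (Fin k) ℝ} (hG : G.IsSymm) (ρ : ℝ) (i j : Fin k) :
    Lam2 P m G ρ i j = movingIntegral k h (-(1 : Matrix (Fin k) (Fin k) ℝ) i j) 0 (coordForm i j)
      (pulledBackParam N μ (Matrix.toEuclideanCLM (𝕜 := ℝ) G, m, ρ)) := by
  have hGi : (G⁻¹).transpose = G⁻¹ := by
    rw [Matrix.transpose_nonsing_inv]; exact congrArg _ hG
  rw [← integral_scatterBall hN hP, Lam2, Matrix.of_apply]
  congr 1
  funext y
  congr 1
  funext y
  have : Matrix.vecMul (y - m).ofLp G⁻¹ = G⁻¹.mulVec (y - m).ofLp := by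
    conv_lhs => rw [← hGi]
    exact Matrix.vecMul_transpose _ _
  rw [Matrix.mul_vecMulVec, Matrix.vecMulVec_mul, this, Matrix.sub_apply, Matrix.vecMulVec_apply,
    quadPoly, coordForm_apply, zero_apply]
  simp only [matMul]
  ring

theorem Lam3_eq [IsProbabilityMeasure P] (hN : N.PosDef)
    (hP : P = (radialMeasure k h).map fun z => matMul N z + μ)
    (m : Vec k) (G : Matrix (Fin k) (Fin k) ℝ) (ρ : ℝ) :
    Lam3 P γ m G ρ = movingIntegral k h 1 0 0
      (pulledBackParam N μ (Matrix.toEuclideanCLM (𝕜 := ℝ) G, m, ρ)) - γ := by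
  have e : (scatterBall m G ρ).indicator (fun _ => (1 : ℝ))
      = (scatterBall m G ρ).indicator (fun y => quadPoly 1 0 0 (matMul G⁻¹ (y - m))) := by
    congr 1
    funext y
    simp [quadPoly]
  have hi := integrable_scatterBall (P := P) 1 0 0 m G ρ
  rw [← integral_scatterBall hN hP, Lam3, e, integral_sub hi (integrable_const _)]
  simp

end Integrals

end Lambda

/-! ### Non-singularity of the derivative of `Λ` -/

section Nonsingular

variable {k : ℕ}

/-- The equation `N X + X N = 0` for symmetric `X` and positive definite `N` has only the zero
solution: multiplication by `X` and the trace give `2 tr (X N X) = 0`, a sum of nonnegative terms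
`xⱼ' N xⱼ` over the columns `xⱼ` of `X`. -/
theorem Matrix.PosDef.eq_zero_of_mul_add_mul_eq_zero {N X : Matrix (Fin k) (Fin k) ℝ}
    (hN : N.PosDef) (hX : X.IsSymm) (h : N * X + X * N = 0) : X = 0 := by
  have h1 : (X * N * X).trace = 0 := by
    have e1 : (X * (N * X + X * N)).trace = 0 := by simp [h]
    rw [mul_add, Matrix.trace_add, ← mul_assoc, ← mul_assoc, Matrix.mul_assoc X X N,
      Matrix.trace_mul_comm X (X * N)] at e1
    linarith
  have h2 : ∀ j, (X * N * X) j j = (fun a => X a j) ⬝ᵥ N.mulVec fun a => X a j := fun j => by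
    rw [Matrix.mul_assoc, Matrix.mul_apply]
    exact Finset.sum_congr rfl fun a _ => by rw [hX.apply]; rfl
  have h3 : ∀ j, 0 ≤ (X * N * X) j j := fun j => by
    rw [h2]
    simpa using hN.posSemidef.dotProduct_mulVec_nonneg fun a => X a j
  ext a j
  by_contra hne
  have h4 := hN.dotProduct_mulVec_pos (x := fun a => X a j) fun h0 => hne (congrFun h0 a)
  have h5 := (Finset.sum_eq_zero_iff_of_nonneg fun j _ => h3 j).mp h1 j (Finset.mem_univ j)
  rw [h2] at h5
  exact h4.ne' (by simpa using h5)

/-- The symmetrization `(Y + Y') / 2`. It makes the entrywise derivatives of `Λ₂` into a map to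
`symMat k`, and fixes matrices that are symmetric already. -/
def symmetrize (k : ℕ) : (Fin k → Fin k → ℝ) →ₗ[ℝ] symMat k where
  toFun Y := ⟨Matrix.of fun i j => (Y i j + Y j i) / 2, by
    change Matrix.transpose _ = _
    ext i j
    simp [add_comm]⟩
  map_add' Y Z := by
    ext i j
    simp
    ring
  map_smul' c Y := by
    ext i j
    simp
    ring

/-- Reassembles the coordinates of a value of `Λ`. -/
def assemble (k : ℕ) :
    ((Fin k → ℝ) × (Fin k → Fin k → ℝ) × ℝ) →L[ℝ] Vec k × symMat k × ℝ :=
  LinearMap.toContinuousLinearMap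
    (LinearMap.prodMap (WithLp.linearEquiv 2 ℝ (Fin k → ℝ)).symm.toLinearMap
      (LinearMap.prodMap (symmetrize k) LinearMap.id))

theorem assemble_apply (u : Fin k → ℝ) (Y : Fin k → Fin k → ℝ) (s : ℝ) :
    assemble k (u, Y, s) = (WithLp.toLp 2 u, symmetrize k Y, s) := rfl

/-- The embedding `(m, G, ρ) ↦ (G, m, ρ)` that regards a matrix as a linear map. -/
def embedParam (k : ℕ) : (Vec k × symMat k × ℝ) →L[ℝ] MovingParam k :=
  LinearMap.toContinuousLinearMap
    { toFun := fun θ => (Matrix.toEuclideanCLM (𝕜 := ℝ) θ.2.1.1, θ.1, θ.2.2)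
      map_add' := fun θ η => by simp
      map_smul' := fun c θ => by simp }

theorem embedParam_apply (m : Vec k) (G : symMat k) (ρ : ℝ) :
    embedParam k (m, G, ρ) = (Matrix.toEuclideanCLM (𝕜 := ℝ) G.1, m, ρ) := rfl

variable {h : ℝ → ℝ} {r γ : ℝ} {N : Matrix (Fin k) (Fin k) ℝ} {μ : Vec k} {P : Measure (Vec k)}

theorem StandardProfile.area_mul_pow_lt (H : StandardProfile k h r γ) :
    sphereArea k * (h (r ^ 2) * r ^ (k - 1)) * r < k * γ := by
  have h1 := H.area_lt
  have e : r ^ k = r ^ (k - 1) * r := by rw [← pow_succ, Nat.sub_add_cancel H.dim_pos]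
  rw [e] at h1
  linarith

theorem StandardProfile.area_mul_pow_mul_cube_lt (H : StandardProfile k h r γ) :
    sphereArea k * (h (r ^ 2) * r ^ (k - 1)) * r ^ 3 < k * (k + 2) * γ := by
  have h1 := H.area_mul_sq_lt
  have e : k + 2 = (k - 1) + 3 := by have := H.dim_pos; omega
  rw [e, pow_add] at h1
  linarith

/-- The linearized moment equations have only the trivial solution: the mean decouples from mass and
covariance, and every coefficient that appears is non-zero as `h` exceeds its boundary value inside
the ball. -/
theorem StandardProfile.eq_zero_of_linearized (H : StandardProfile k h r γ)
    {M : Matrix (Fin k) (Fin k) ℝ} {b : Vec k} {s : ℝ}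
    (hmean : ∀ i, (γ - sphereArea k * (h (r ^ 2) * r ^ (k - 1)) * r / k) * b i = 0)
    (hcov : ∀ i j, sphereArea k * (h (r ^ 2) * r ^ (k - 1)) *
            ((if i = j then (r ^ 2 / k - 1) * s + r / k * M.trace else 0)
              - r ^ 3 / (k * (k + 2)) * ((if i = j then M.trace else 0) + M i j + M j i))
            + γ * (M i j + M j i) = 0)
    (hmass : sphereArea k * (h (r ^ 2) * r ^ (k - 1)) * (s - r / k * M.trace) = 0) :
    b = 0 ∧ (∀ i j, M i j + M j i = 0) ∧ s = 0 := by
  have hk : (0 : ℝ) < k := by exact_mod_cast H.dim_pos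
  have hr := H.radius_pos
  have hγ := H.mass_pos
  have hg : 0 < sphereArea k * (h (r ^ 2) * r ^ (k - 1)) :=
    mul_pos (sphereArea_pos H.dim_pos) (mul_pos H.profile_pos (pow_pos hr _))
  have hlt1 := H.area_mul_pow_lt
  have hlt2 := H.area_mul_pow_mul_cube_lt
  set c := sphereArea k * (h (r ^ 2) * r ^ (k - 1)) with hc
  have hs : s = r / k * M.trace := by
    rcases mul_eq_zero.mp hmass with h0 | h0
    · exact absurd h0 hg.ne'
    · linarith
  have htr : M.trace = 0 := by
    -- Summing the diagonal equations, the terms with `r` cancel and `2 γ tr M = 0` remains.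
    have hsum : ∑ i, (c * (((r ^ 2 / k - 1) * s + r / k * M.trace)
        - r ^ 3 / (k * (k + 2)) * (M.trace + M i i + M i i)) + γ * (M i i + M i i)) = 0 :=
      Finset.sum_eq_zero fun i _ => by simpa using hcov i i
    simp only [Finset.sum_add_distrib, ← Finset.mul_sum, Finset.sum_sub_distrib,
      Finset.sum_const, Finset.card_univ, Fintype.card_fin, nsmul_eq_mul] at hsum
    have ht : ∑ i, M i i = M.trace := rfl
    rw [ht, hs] at hsum
    have e : 2 * γ * M.trace = 0 := by
      rw [← hsum]
      field_simp
      ring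
    rcases mul_eq_zero.mp e with h0 | h0
    · linarith
    · exact h0
  have hs0 : s = 0 := by rw [hs, htr, mul_zero]
  refine ⟨?_, fun i j => ?_, hs0⟩
  · ext i
    rcases mul_eq_zero.mp (hmean i) with h0 | h0
    · have : c * r / k < γ := by rw [div_lt_iff₀ hk]; linarith
      linarith
    · simpa using h0
  · have := hcov i j
    rw [hs0, htr] at this
    have e : (γ - c * r ^ 3 / (k * (k + 2))) * (M i j + M j i) = 0 := by
      rw [← this]
      split_ifs <;> ring
    rcases mul_eq_zero.mp e with h0 | h0
    · have : c * r ^ 3 / (k * (k + 2)) < γ := by rw [div_lt_iff₀ (by positivity)]; linarith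
      linarith
    · exact h0

/-- `Λ` is differentiable at the MCD parameters with non-singular derivative. -/
theorem StandardProfile.exists_hasFDerivAt_Lam (H : StandardProfile k h r γ)
    [IsProbabilityMeasure P] (hN : N.PosDef)
    (hP : P = (radialMeasure k h).map fun z => matMul N z + μ) :
    ∃ D : (Vec k × symMat k × ℝ) →L[ℝ] (Vec k × symMat k × ℝ),
      HasFDerivAt (Lam P γ) D (μ, ⟨N, hN.isSymm_real⟩, r) ∧ Function.Bijective D := by
  have := isProbabilityMeasure_radialMeasure hN hP
  obtain ⟨hbase, Dψ, hDψ, hDψv⟩ := hasFDerivAt_pulledBackParam hN μ r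
  choose D1 hD1 hD1v using H.hasFDerivAt_mean
  choose D2 hD2 hD2v using H.hasFDerivAt_cov
  obtain ⟨D3, hD3, hD3v⟩ := H.hasFDerivAt_mass
  let Φ : MovingParam k → (Fin k → ℝ) × (Fin k → Fin k → ℝ) × ℝ := fun θ =>
    (fun i => movingIntegral k h 0 (EuclideanSpace.proj i) 0 θ,
      fun i j => movingIntegral k h (-(1 : Matrix (Fin k) (Fin k) ℝ) i j) 0 (coordForm i j) θ,
      movingIntegral k h 1 0 0 θ - γ)
  let DΦ : MovingParam k →L[ℝ] (Fin k → ℝ) × (Fin k → Fin k → ℝ) × ℝ :=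
    (ContinuousLinearMap.pi D1).prod
      ((ContinuousLinearMap.pi fun i => ContinuousLinearMap.pi (D2 i)).prod D3)
  have hΦ : HasFDerivAt Φ DΦ (1, 0, r) :=
    (hasFDerivAt_pi.mpr hD1).prodMk
      ((hasFDerivAt_pi.mpr fun i => hasFDerivAt_pi.mpr (hD2 i)).prodMk (hD3.sub_const γ))
  have hcomp : HasFDerivAt (fun θ => Φ (pulledBackParam N μ θ)) (DΦ.comp Dψ)
      (Matrix.toEuclideanCLM (𝕜 := ℝ) N, μ, r) :=
    HasFDerivAt.comp _ (hbase ▸ hΦ) hDψ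
  have hLam : Lam P γ = fun θ => assemble k (Φ (pulledBackParam N μ (embedParam k θ))) := by
    funext θ
    obtain ⟨m, G, ρ⟩ := θ
    rw [embedParam_apply, assemble_apply]
    refine Prod.ext ?_ (Prod.ext ?_ ?_)
    · ext i
      exact Lam1_apply hN hP m G.1 ρ i
    · refine Subtype.ext (Matrix.ext fun i j => ?_)
      have hs : Lam2 P m G.1 ρ j i = Lam2 P m G.1 ρ i j :=
        Matrix.IsSymm.apply (Lam2_mem P m G ρ) i j
      have h1 := Lam2_apply hN hP m G.2 ρ i j
      have h2 := Lam2_apply hN hP m G.2 ρ j i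
      calc Lam2 P m G.1 ρ i j = (Lam2 P m G.1 ρ i j + Lam2 P m G.1 ρ j i) / 2 := by rw [hs]; ring
        _ = _ := by rw [h1, h2]; rfl
    · exact Lam3_eq hN hP m G.1 ρ
  let D := (assemble k).comp ((DΦ.comp Dψ).comp (embedParam k))
  have hDer : HasFDerivAt (Lam P γ) D (μ, ⟨N, hN.isSymm_real⟩, r) := by
    rw [hLam]
    exact (HasFDerivAt.comp_clm_right (embedParam k) (x := (μ, ⟨N, hN.isSymm_real⟩, r))
      hcomp).comp_clm_left (assemble k)
  refine ⟨D, hDer, ?_⟩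
  have hinj : Function.Injective D := by
    rw [injective_iff_map_eq_zero]
    rintro ⟨a, X, s⟩ h0
    have hD0 : assemble k (DΦ (Dψ (embedParam k (a, X, s)))) = 0 := h0
    rw [embedParam_apply, hDψv] at hD0
    have hXsymm : X.1.IsSymm := X.2
    have e1 : ∀ i, D1 i (Matrix.toEuclideanCLM (𝕜 := ℝ) (-(N⁻¹ * X.1)), -matMul N⁻¹ a, s) = 0 :=
      fun i => congrFun (congrArg WithLp.ofLp (congrArg Prod.fst hD0)) i
    have e2 : ∀ i j, (D2 i j (Matrix.toEuclideanCLM (𝕜 := ℝ) (-(N⁻¹ * X.1)), -matMul N⁻¹ a, s)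
        + D2 j i (Matrix.toEuclideanCLM (𝕜 := ℝ) (-(N⁻¹ * X.1)), -matMul N⁻¹ a, s)) / 2 = 0 :=
      fun i j => congrFun (congrFun (congrArg Subtype.val
        (congrArg (fun p => p.2.1) hD0)) i) j
    have e3 : D3 (Matrix.toEuclideanCLM (𝕜 := ℝ) (-(N⁻¹ * X.1)), -matMul N⁻¹ a, s) = 0 :=
      congrArg (fun p => p.2.2) hD0
    obtain ⟨hb, hM, hs⟩ := H.eq_zero_of_linearized (M := -(N⁻¹ * X.1)) (b := -matMul N⁻¹ a)
      (s := s) (fun i => by rw [← e1 i, hD1v]) (fun i j => by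
        have := e2 i j
        rw [hD2v, hD2v] at this
        simp only [eq_comm (a := j) (b := i)] at this
        linarith) (by rw [← e3, hD3v])
    have ha : a = 0 := by
      have := congrArg (matMul N) (neg_eq_zero.mp hb)
      rw [← matMul_mul, hN.mul_inv_self, matMul_one] at this
      simpa [matMul_eq_toEuclideanCLM] using this
    have hX : X.1 = 0 := by
      refine hN.inv.eq_zero_of_mul_add_mul_eq_zero hXsymm (Matrix.ext fun i j => ?_)
      have ht : X.1 * N⁻¹ = (N⁻¹ * X.1).transpose := by
        rw [Matrix.transpose_mul, hXsymm.eq, hN.inv.isSymm_real.eq]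
      have := hM i j
      rw [ht]
      simp only [Matrix.neg_apply, Matrix.add_apply, Matrix.transpose_apply,
        Matrix.zero_apply] at this ⊢
      linarith
    have hX' : X = 0 := Subtype.ext hX
    rw [ha, hX', hs]
    rfl
  exact ⟨hinj, (LinearMap.injective_iff_surjective (f := D.toLinearMap)).mp hinj⟩

end Nonsingular

/-! ### The density on the boundary of the central ellipsoid -/

section Boundary

variable {k : ℕ} {h : ℝ → ℝ} {r γ : ℝ} {N : Matrix (Fin k) (Fin k) ℝ} {μ : Vec k}

theorem contPosNearBoundary_ellipticalDensity {S : Matrix (Fin k) (Fin k) ℝ} (hS : S.PosDef)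
    (μ : Vec k) (h_reg : ∀ᶠ t in 𝓝 (r ^ 2), ContinuousAt h t ∧ 0 < h t) :
    ContPosNearBoundary (ellipticalDensity μ S h) μ S r := by
  have hc := continuous_mahalanobisSq μ S
  refine ⟨mahalanobisSq μ S ⁻¹' interior {t | ContinuousAt h t ∧ 0 < h t},
    isOpen_interior.preimage hc, fun x hx => ?_, fun x hx => ?_, fun x hx => ?_⟩
  · have h1 : mahalanobisSq μ S x = r ^ 2 := frontier_le_subset_eq hc continuous_const hx
    rw [mem_preimage, h1]
    exact mem_interior_iff_mem_nhds.mpr h_reg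
  · have h1 := interior_subset (mem_preimage.mp hx)
    exact (continuousAt_const.mul (h1.1.comp hc.continuousAt)).continuousWithinAt
  · have h1 := interior_subset (mem_preimage.mp hx)
    exact mul_pos (Real.rpow_pos_of_pos hS.det_pos _) h1.2

theorem norm_flipCoord (i : Fin k) (ω : Vec k) : ‖flipCoord i ω‖ = ‖ω‖ := by
  rw [EuclideanSpace.norm_eq, EuclideanSpace.norm_eq]
  congr 1
  refine Finset.sum_congr rfl fun j _ => ?_
  by_cases hj : j = i
  · subst hj
    simp [flipCoord]
  · simp [flipCoord, hj]

theorem halfSpaceSymmetric_ellipticalDensity (hN : N.PosDef) (μ : Vec k) (h : ℝ → ℝ) (r : ℝ) :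
    HalfSpaceSymmetric (ellipticalDensity μ (N * N) h) μ N r := fun i ω _ => by
  rw [ellipticalDensity_affine hN, ellipticalDensity_affine hN, norm_flipCoord]

/-- On the sphere of radius `r` the density is constant, so `ν` is a multiple of the surface
measure. -/
theorem boundaryMeasure_eq (hN : N.PosDef) (μ : Vec k) (h : ℝ → ℝ) (hr : 0 < r) :
    boundaryMeasure (ellipticalDensity μ (N * N) h) μ N r
      = ENNReal.ofReal (h (r ^ 2)) • surfaceMeasure k r := by
  rw [boundaryMeasure, ← withDensity_const]
  refine withDensity_congr_ae ?_
  have hc : Continuous fun ω : Metric.sphere (0 : Vec k) 1 => r • (ω : Vec k) := by fun_prop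
  have h1 : ∀ᵐ ω ∂(surfaceMeasure k r), ‖ω‖ = r := by
    refine Measure.ae_smul_measure ?_ _
    rw [ae_map_iff hc.aemeasurable (isClosed_eq continuous_norm continuous_const).measurableSet]
    exact ae_of_all _ fun ω => by simp [norm_smul, abs_of_pos hr]
  filter_upwards [h1] with ω hω
  rw [ellipticalDensity_affine hN, hω, mul_inv_cancel_left₀ hN.det_pos.ne']

theorem integral_boundaryMeasure (hN : N.PosDef) (μ : Vec k) (hr : 0 < r) (h0 : 0 ≤ h (r ^ 2))
    {g : Vec k → ℝ} (hg : Continuous g) :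
    ∫ ω, g ω ∂(boundaryMeasure (ellipticalDensity μ (N * N) h) μ N r)
      = h (r ^ 2) * r ^ (k - 1) * ∫ ω, g (r • ω) ∂(unitSphereMeasure k) := by
  have hc : Continuous fun ω : Metric.sphere (0 : Vec k) 1 => r • (ω : Vec k) := by fun_prop
  rw [boundaryMeasure_eq hN μ h hr, surfaceMeasure, integral_smul_measure, integral_smul_measure,
    integral_map hc.aemeasurable hg.aestronglyMeasurable, ENNReal.toReal_ofReal h0,
    ENNReal.toReal_ofReal (by positivity), integral_unitSphereMeasure, smul_eq_mul, smul_eq_mul,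
    mul_assoc]

namespace StandardProfile

theorem integral_sq_boundaryMeasure (H : StandardProfile k h r γ) (hN : N.PosDef) (μ : Vec k)
    (i : Fin k) :
    ∫ ω, ω i ^ 2 ∂(boundaryMeasure (ellipticalDensity μ (N * N) h) μ N r)
      = sphereArea k * (h (r ^ 2) * r ^ (k - 1)) * r ^ 2 / k := by
  rw [integral_boundaryMeasure hN μ H.radius_pos H.profile_pos.le (by fun_prop)]
  have e : ∀ ω : Vec k, (r • ω) i ^ 2 = r ^ 2 * (ω i * ω i) := fun ω => by
    rw [PiLp.smul_apply, smul_eq_mul]; ring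
  simp_rw [e]
  rw [integral_const_mul, integral_apply_mul_unitSphereMeasure, if_pos rfl]
  ring

theorem integral_sq_mul_sq_boundaryMeasure (H : StandardProfile k h r γ) (hN : N.PosDef)
    (μ : Vec k) (i j : Fin k) :
    ∫ ω, ω i ^ 2 * ω j ^ 2 ∂(boundaryMeasure (ellipticalDensity μ (N * N) h) μ N r)
      = sphereArea k * (h (r ^ 2) * r ^ (k - 1)) * r ^ 4 / (k * (k + 2))
        * (1 + 2 * if i = j then 1 else 0) := by
  rw [integral_boundaryMeasure hN μ H.radius_pos H.profile_pos.le (by fun_prop)]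
  have e : ∀ ω : Vec k, (r • ω) i ^ 2 * (r • ω) j ^ 2 = r ^ 4 * (ω i * ω i * ω j * ω j) :=
    fun ω => by
      simp only [PiLp.smul_apply, smul_eq_mul]; ring
  simp_rw [e]
  rw [integral_const_mul, rotationInvariant_unitSphereMeasure.integral_mul_mul_mul
      ae_norm_le_one_unitSphereMeasure, integral_norm_pow_unitSphereMeasure]
  by_cases hij : i = j
  · simp only [hij, if_true]
    ring
  · simp only [hij, if_true, if_false]
    ring

theorem integral_sq_boundaryMeasure_ne (H : StandardProfile k h r γ) (hN : N.PosDef) (μ : Vec k)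
    (i : Fin k) :
    ∫ ω, ω i ^ 2 ∂(boundaryMeasure (ellipticalDensity μ (N * N) h) μ N r) ≠ γ * r := by
  have hk : (0 : ℝ) < k := by exact_mod_cast H.dim_pos
  rw [H.integral_sq_boundaryMeasure hN]
  refine ne_of_lt ?_
  rw [div_lt_iff₀ hk]
  nlinarith [mul_lt_mul_of_pos_right H.area_mul_pow_lt H.radius_pos]

theorem integral_sq_mul_sq_boundaryMeasure_ne (H : StandardProfile k h r γ) (hN : N.PosDef)
    (μ : Vec k) {i j : Fin k} (hij : i ≠ j) :
    ∫ ω, ω i ^ 2 * ω j ^ 2 ∂(boundaryMeasure (ellipticalDensity μ (N * N) h) μ N r) ≠ γ * r := by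
  have hk : (0 : ℝ) < k := by exact_mod_cast H.dim_pos
  rw [H.integral_sq_mul_sq_boundaryMeasure hN, if_neg hij, mul_zero, add_zero, mul_one]
  refine ne_of_lt ?_
  rw [div_lt_iff₀ (by positivity)]
  nlinarith [mul_lt_mul_of_pos_right H.area_mul_pow_mul_cube_lt H.radius_pos]

/-- The moment matrix is a multiple of the all-ones matrix, which annihilates vectors of sum zero,
plus a non-zero multiple of the identity. -/
theorem eq_zero_of_momentMatrix_mulVec (H : StandardProfile k h r γ) (hN : N.PosDef) (μ : Vec k)
    {x : Fin k → ℝ}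
    (hx : (momentMatrix (boundaryMeasure (ellipticalDensity μ (N * N) h) μ N r) γ r).mulVec x = 0)
    (hsum : ∑ i, x i = 0) : x = 0 := by
  have hk : (0 : ℝ) < k := by exact_mod_cast H.dim_pos
  have hr := H.radius_pos
  set c := sphereArea k * (h (r ^ 2) * r ^ (k - 1)) with hc
  obtain ⟨d, hd⟩ : ∃ d, ∀ i j,
      momentMatrix (boundaryMeasure (ellipticalDensity μ (N * N) h) μ N r) γ r i j
        = d + (c * r ^ 4 / (k * (k + 2)) * 2 - 2 * γ * r) * if i = j then 1 else 0 :=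
    ⟨_, fun i j => by
      rw [momentMatrix, Matrix.of_apply, H.integral_sq_mul_sq_boundaryMeasure hN,
        H.integral_sq_boundaryMeasure hN, H.integral_sq_boundaryMeasure hN, ← hc, mul_add, mul_one,
        sub_mul, ← mul_assoc, add_sub_right_comm, add_sub_assoc]⟩
  funext i
  have hi := congrFun hx i
  simp only [Matrix.mulVec, dotProduct, hd, add_mul, Finset.sum_add_distrib, ← Finset.mul_sum,
    hsum, mul_assoc, ite_mul, one_mul, zero_mul, Finset.sum_ite_eq, Finset.mem_univ, if_true,
    Pi.zero_apply, mul_zero, zero_add] at hi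
  rcases mul_eq_zero.mp hi with h0 | h0
  · have h1 : c * r ^ 3 / (k * (k + 2)) < γ := by
      rw [div_lt_iff₀ (by positivity)]
      linarith [H.area_mul_pow_mul_cube_lt]
    have h2 := mul_lt_mul_of_pos_right h1 hr
    have h3 : c * r ^ 4 / (k * (k + 2)) = c * r ^ 3 / (k * (k + 2)) * r := by ring
    nlinarith
  · exact h0

end StandardProfile

end Boundary

/-! ### Rescaling to a standard profile -/

section Rescaling

variable {k : ℕ} {h : ℝ → ℝ} {r γ : ℝ}

/-- Passing from `(S, h)` to `(a² S, aᵏ h(a² ·))` does not change the elliptical density. -/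
theorem ellipticalDensity_rescale {S : Matrix (Fin k) (Fin k) ℝ} (hS : S.PosDef) (μ : Vec k)
    (h : ℝ → ℝ) {a : ℝ} (ha : 0 < a) :
    ellipticalDensity μ (a ^ 2 • S) (fun t => a ^ k * h (a ^ 2 * t)) = ellipticalDensity μ S h := by
  funext x
  have ha2 : a ^ 2 ≠ 0 := by positivity
  have hdet : ((a ^ 2 • S).det) ^ (-(1 / 2) : ℝ) = (a ^ k)⁻¹ * S.det ^ (-(1 / 2) : ℝ) := by
    rw [Matrix.det_smul, Fintype.card_fin, Real.mul_rpow (by positivity) hS.det_pos.le, ← pow_mul,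
      mul_comm 2 k, pow_mul, Real.rpow_neg (by positivity), ← Real.sqrt_eq_rpow,
      Real.sqrt_sq (by positivity)]
  rw [ellipticalDensity, ellipticalDensity, hdet, mahalanobisSq_smul_matrix _ _ ha2,
    mul_inv_cancel_left₀ ha2]
  have : a ^ k ≠ 0 := by positivity
  field_simp

theorem integral_rescaled_profile (h : ℝ → ℝ) (r : ℝ) (hk : 0 < k) {a : ℝ} (ha : 0 < a) (n : ℕ) :
    ∫ t in (0 : ℝ)..r / a, a ^ k * h (a ^ 2 * t ^ 2) * t ^ (k - 1) * t ^ n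
      = (a ^ n)⁻¹ * ∫ t in (0 : ℝ)..r, h (t ^ 2) * t ^ (k - 1) * t ^ n := by
  have e : ∀ t : ℝ, a ^ k * h (a ^ 2 * t ^ 2) * t ^ (k - 1) * t ^ n
      = (a ^ n)⁻¹ * a * (h ((a * t) ^ 2) * (a * t) ^ (k - 1) * (a * t) ^ n) := fun t => by
    have h1 : a ^ k = a ^ (k - 1) * a := by rw [← pow_succ, Nat.sub_add_cancel hk]
    rw [h1, mul_pow, mul_pow, mul_pow]
    field_simp
  simp_rw [e]
  rw [intervalIntegral.integral_const_mul,
    intervalIntegral.integral_comp_mul_left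
      (fun u => h (u ^ 2) * u ^ (k - 1) * u ^ n) ha.ne', mul_zero, mul_div_cancel₀ _ ha.ne',
    smul_eq_mul, mul_assoc, mul_inv_cancel_left₀ ha.ne']

/-- A profile with the correct mass becomes a standard one after rescaling. -/
theorem exists_standardProfile_rescale (hk : 0 < k) (hγ : 0 < γ)
    (h_nonneg : ∀ t ∈ Ici (0 : ℝ), 0 ≤ h t) (h_anti : AntitoneOn h (Ici (0 : ℝ))) (hr : 0 < r)
    (hmass : sphereArea k * ∫ s in (0 : ℝ)..r, h (s ^ 2) * s ^ (k - 1) = γ)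
    (h_reg : ∀ᶠ t in 𝓝 (r ^ 2), ContinuousAt h t ∧ 0 < h t)
    (h_nonconst : ∃ s ∈ Ioo (0 : ℝ) (r ^ 2), ∃ t ∈ Ioo (0 : ℝ) (r ^ 2), h s ≠ h t) :
    ∃ a : ℝ, 0 < a ∧ StandardProfile k (fun t => a ^ k * h (a ^ 2 * t)) (r / a) γ := by
  have hk' : (0 : ℝ) < k := by exact_mod_cast hk
  have hA := sphereArea_pos hk
  set I := ∫ t in (0 : ℝ)..r, h (t ^ 2) * t ^ (k - 1) * t ^ 2 with hI
  have hIpos : 0 < I := by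
    have h1 := pow_div_lt_integral_profile h_anti hr h_nonconst (k - 1 + 2)
    have h2 : 0 ≤ h (r ^ 2) := h_nonneg _ (mem_Ici.mpr (sq_nonneg r))
    have h3 : ∀ t : ℝ, h (t ^ 2) * t ^ (k - 1 + 2) = h (t ^ 2) * t ^ (k - 1) * t ^ 2 := fun t => by
      rw [pow_add]; ring
    simp_rw [h3] at h1
    exact lt_of_le_of_lt (by positivity) h1
  -- `a²` is the ratio between the second moment of the profile and the standard value `k γ`.
  have hq : 0 < sphereArea k * I / (k * γ) := by positivity
  set a := √(sphereArea k * I / (k * γ)) with ha_def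
  have ha : 0 < a := Real.sqrt_pos.mpr hq
  have ha2 : a ^ 2 = sphereArea k * I / (k * γ) := Real.sq_sqrt hq.le
  have hsq : a ^ 2 * (r / a) ^ 2 = r ^ 2 := by field_simp
  refine ⟨a, ha, ⟨hk, hγ, div_pos hr ha, fun t ht => ?_, fun s hs t ht hst => ?_, ?_, ?_, ?_, ?_⟩⟩
  · exact mul_nonneg (by positivity) (h_nonneg _ (mem_Ici.mpr (mul_nonneg (by positivity) ht)))
  · exact mul_le_mul_of_nonneg_left (h_anti (mem_Ici.mpr (mul_nonneg (by positivity) hs))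
      (mem_Ici.mpr (mul_nonneg (by positivity) ht))
      (mul_le_mul_of_nonneg_left hst (by positivity))) (by positivity)
  · have ht : Tendsto (fun t => a ^ 2 * t) (𝓝 ((r / a) ^ 2)) (𝓝 (r ^ 2)) := by
      rw [← hsq]
      exact (continuous_const.mul continuous_id).tendsto _
    filter_upwards [ht.eventually h_reg] with t h1
    refine ⟨continuousAt_const.mul (ContinuousAt.comp (f := fun t => a ^ 2 * t) h1.1
      (by fun_prop)), mul_pos (by positivity) h1.2⟩
  · obtain ⟨s, hs, t, ht, hst⟩ := h_nonconst
    have hmem : ∀ u ∈ Ioo (0 : ℝ) (r ^ 2), u / a ^ 2 ∈ Ioo (0 : ℝ) ((r / a) ^ 2) := fun u hu => by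
      refine ⟨div_pos hu.1 (by positivity), ?_⟩
      rw [div_pow]
      exact div_lt_div_of_pos_right hu.2 (by positivity)
    have hcancel : ∀ u, a ^ 2 * (u / a ^ 2) = u := fun u => mul_div_cancel₀ u (by positivity)
    refine ⟨s / a ^ 2, hmem s hs, t / a ^ 2, hmem t ht, fun he => hst ?_⟩
    simp only [hcancel] at he
    exact mul_left_cancel₀ (pow_ne_zero k ha.ne') he
  · have := integral_rescaled_profile h r hk ha 0
    simp only [pow_zero, mul_one, inv_one, one_mul] at this
    rw [this, hmass]
  · rw [integral_rescaled_profile h r hk ha 2, ← hI, ha2]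
    field_simp

end Rescaling

end

theorem proposition4p1
    {k : ℕ} (hk : 0 < k)
    (γ : ℝ) (hγ : γ ∈ Ioc (0 : ℝ) 1)
    -- the elliptically contoured distribution
    (μ : Vec k) (S : Matrix (Fin k) (Fin k) ℝ) (hS : S.PosDef)
    (h : ℝ → ℝ) (h_nonneg : ∀ t ∈ Ici (0 : ℝ), 0 ≤ h t) (h_anti : AntitoneOn h (Ici (0 : ℝ)))
    (P : Measure (Vec k)) [IsProbabilityMeasure P]
    (hP : P = volume.withDensity (fun x => ENNReal.ofReal (ellipticalDensity μ S h x)))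
    -- the radius `r(γ)`
    (r : ℝ) (hr : 0 < r)
    (hrγ : 2 * Real.pi ^ ((k : ℝ) / 2) / Real.Gamma ((k : ℝ) / 2) *
      ∫ s in (0 : ℝ)..r, h (s ^ 2) * s ^ (k - 1) = γ)
    -- `h` is continuous and positive near `r(γ)²`, and not constant on `(0, r(γ)²)`
    (h_reg : ∀ᶠ t in 𝓝 (r ^ 2), ContinuousAt h t ∧ 0 < h t)
    (h_nonconst : ∃ s ∈ Ioo (0 : ℝ) (r ^ 2), ∃ t ∈ Ioo (0 : ℝ) (r ^ 2), h s ≠ h t) :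
    ∃ (μ₀ : Vec k) (Γ₀ : symMat k) (ρ₀ : ℝ),
      Γ₀.1.PosDef ∧ 0 < ρ₀ ∧
      -- the MCD functional is uniquely defined
      IsUniqueMCD P γ μ₀ (Γ₀.1 * Γ₀.1) ρ₀ ∧
      -- regularity and half-space symmetry of the density
      ContPosNearBoundary (ellipticalDensity μ S h) μ₀ (Γ₀.1 * Γ₀.1) ρ₀ ∧
      HalfSpaceSymmetric (ellipticalDensity μ S h) μ₀ Γ₀.1 ρ₀ ∧
      -- the moment conditions on the boundary measure
      (∀ i : Fin k,
        ∫ ω, ω i ^ 2 ∂(boundaryMeasure (ellipticalDensity μ S h) μ₀ Γ₀.1 ρ₀) ≠ γ * ρ₀) ∧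
      (∀ i j : Fin k, i ≠ j →
        ∫ ω, ω i ^ 2 * ω j ^ 2 ∂(boundaryMeasure (ellipticalDensity μ S h) μ₀ Γ₀.1 ρ₀)
          ≠ γ * ρ₀) ∧
      (∀ x : Fin k → ℝ,
        (momentMatrix (boundaryMeasure (ellipticalDensity μ S h) μ₀ Γ₀.1 ρ₀) γ ρ₀).mulVec x = 0 →
          ∑ i, x i = 0 → x = 0) ∧
      -- the derivative of `Λ` at `θ₀ = (μ₀, Γ₀, ρ₀)` exists and is non-singular
      ∃ D : (Vec k × symMat k × ℝ) →L[ℝ] (Vec k × symMat k × ℝ),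
        HasFDerivAt (Lam P γ) D (μ₀, Γ₀, ρ₀) ∧ Function.Bijective D := by
  rw [← sphereArea_eq hk] at hrγ
  obtain ⟨a, ha, H⟩ :=
    exists_standardProfile_rescale hk hγ.1 h_nonneg h_anti hr hrγ h_reg h_nonconst
  obtain ⟨N, hN, hNS⟩ := (hS.smul (show (0 : ℝ) < a ^ 2 by positivity)).exists_posDef_mul_self
  rw [← ellipticalDensity_rescale hS μ h ha, ← hNS] at hP ⊢
  exact ⟨μ, ⟨N, hN.isSymm_real⟩, r / a, hN, H.radius_pos, H.isUniqueMCD hN hP,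
    contPosNearBoundary_ellipticalDensity hN.mul_self μ H.regular,
    halfSpaceSymmetric_ellipticalDensity hN μ _ _,
    H.integral_sq_boundaryMeasure_ne hN μ,
    fun _ _ hij => H.integral_sq_mul_sq_boundaryMeasure_ne hN μ hij,
    fun _ hx hsum => H.eq_zero_of_momentMatrix_mulVec hN μ hx hsum,
    H.exists_hasFDerivAt_Lam hN (hP.trans (withDensity_ellipticalDensity hN μ _))⟩
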